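/- Let $n\ge 1$, $1<p<\infty$, $1<q<\infty$, $\frac1p+\frac1{p'}=1$, $\frac1q+\frac1{q'}=1$, $-\frac np<r<0$ and $\varrho=-n-r$. For $J\in\mathbb Z$, $M\in\mathbb Z^n$ let $Q_{J,M}=2^{-J}(M+[-1,1]^n)$. All functions are complex-valued, measurable on $\mathbb R^n$, and identified when equal almost everywhere. **Morrey spaces.** Let $L_p^r$ be the space of functions $f\in L_p^{\mathrm{loc}}$ with $\|f\|_{L_p^r}=\sup_{J,M}2^{J(n/p+r)}\|f\|_{L_p(Q_{J,M})}<\infty$. Let $L_p^r(\ell_q)$ be the space of sequences $f=(f_j)_{j\ge 0}$ in $L_p^r$ with norm $\|f\|_{L_p^r(\ell_q)}=\bigl\|(\sum_j|f_j|^q)^{1/q}\bigr\|_{L_p^r}<\infty$. Let $\mathring L_p^r(\ell_q)$ be the space of all $f\in L_p^r(\ell_q)$ for which there are $f_j^k\in C_c^\infty(\mathbb R^n)$ with $f_j^k=0$ for $j>k$ and $\|(f_j-f_j^k)_j\|_{L_p^r(\ell_q)}\to0$ as $k\to\infty$, with the norm of $L_p^r(\ell_q)$. For $1<u<\infty$ let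 $L_u(\ell_q)$ be the space of sequences $f$ with $\|f\|_{L_u(\ell_q)}=\bigl\|(\sum_j|f_j|^q)^{1/q}\bigr\|_{L_u(\mathbb R^n)}<\infty$. **Predual Morrey spaces.** Let $H^\varrho L_{p'}$ be the space of tempered distributions $h=\sum_{J,M}\lambda_{J,M}a_{J,M}$ (convergence in $S'(\mathbb R^n)$), where $\sum_{J,M}|\lambda_{J,M}|<\infty$, $\operatorname{supp}a_{J,M}\subset Q_{J,M}$ and $\|a_{J,M}\|_{L_{p'}}\le 2^{-J(n/p'+\varrho)}$; its norm is the infimum of $\sum_{J,M}|\lambda_{J,M}|$ over all such representations. Let $H^\varrho L_{p'}(\ell_{q'})$ be the space of sequences $g=(g_j)_{j\ge0}$ of functions in $H^\varrho L_{p'}$ such that $|g|_{q'}=(\sum_j|g_j|^{q'})^{1/q'}$ is finite almost everywhere and belongs to $H^\varrho L_{p'}$, with norm $\|g\|=\bigl\||g|_{q'}\bigr\|_{H^\varrho L_{p'}}$. **Theorem.** 1. $L_{-n/r}(\ell_q)\subset\mathring L_p^r(\ell_q)$, with $\|f\|_{L_p^r(\ell_q)}\le C\|f\|_{L_{-n/r}(\ell_q)}$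 for a constant $C$ that does not depend on $f$. 2. For all $g\in H^\varrho L_{p'}(\ell_{q'})$ and $f\in\mathring L_p^r(\ell_q)$ the series $\sum_j g_jf_j$ converges absolutely almost everywhere to an integrable function, and $$g\longmapsto\Bigl(f\mapsto\int_{\mathbb R^n}\sum_{j\ge0}g_j(x)f_j(x)\,dx\Bigr)$$ is a linear isometric isomorphism of $H^\varrho L_{p'}(\ell_{q'})$ onto the dual space of $\mathring L_p^r(\ell_q)$. 3. For every bounded linear functional $G$ on $\mathring L_p^r(\ell_q)$ there is exactly one $g\in H^\varrho L_{p'}(\ell_{q'})$ with $G(f)=\int_{\mathbb R^n}\sum_j g_jf_j\,dx$ for all $f\in L_{-n/r}(\ell_q)$. For this $g$ the functional $G$ is the image of $g$ under the isomorphism in 2, and $\|G\|=\|g\|$. 4. For every $g\in H^\varrho L_{p'}(\ell_{q'})$, $$\|g\|_{H^\varrho L_{p'}(\ell_{q'})}=\sup\Bigl\{\Bigl|\int_{\mathbb R^n}\sum_{j\ge0}g_jf_j\,dx\Bigr|:\ f\in\mathring L_p^r(\ell_q),\ \|f\|_{L_p^r(\ell_q)}\le1\Bigr\}.$$ -/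

import Mathlib

open MeasureTheory Filter Topology
open scoped ENNReal NNReal ContDiff SchwartzMap

namespace MorreyDuality

noncomputable section

/-- The Euclidean space of dimension `n`. -/
abbrev Sp (n : ℕ) := EuclideanSpace ℝ (Fin n)

/-- Index set of the dyadic cubes: pairs `(J, M)` of an integer and a lattice point. -/
abbrev Idx (n : ℕ) := ℤ × (Fin n → ℤ)

/-- Sequences of (classes of almost everywhere equal, measurable, complex) functions. -/
abbrev FunSeq (n : ℕ) := ℕ → (Sp n →ₘ[volume] ℂ)

/-- The closed dyadic cube `2 ^ (-J) * (M + [-1, 1] ^ n)`. -/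
def dyadicCube {n : ℕ} (i : Idx n) : Set (Sp n) :=
  {x | ∀ k, x k ∈ Set.Icc ((2 : ℝ) ^ (-i.1) * ((i.2 k : ℝ) - 1))
    ((2 : ℝ) ^ (-i.1) * ((i.2 k : ℝ) + 1))}

/-- The pointwise `ℓ_q` norm of a sequence of functions, with values in `[0, ∞]`. -/
def lqNorm {n : ℕ} (q : ℝ) (f : FunSeq n) (x : Sp n) : ℝ≥0∞ :=
  (∑' j, ‖f j x‖ₑ ^ q) ^ (1 / q)

/-! ### Pointwise `ℓ_q` norms -/

variable {n : ℕ} {p q r ρ : ℝ}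

theorem measurable_lqNorm (q : ℝ) (f : FunSeq n) : Measurable (lqNorm q f) := by
  have : ∀ j, Measurable fun x => ‖f j x‖ₑ ^ q := fun j =>
    ((f j).stronglyMeasurable.measurable.enorm).pow_const q
  exact (Measurable.tsum this).pow_const _

theorem enorm_le_lqNorm (hq : 1 < q) (f : FunSeq n) (j : ℕ) (x : Sp n) :
    ‖f j x‖ₑ ≤ lqNorm q f x := by
  have h0 : 0 < q := by linarith
  have h1 : (‖f j x‖ₑ ^ q) ^ (1 / q) = ‖f j x‖ₑ := by
    rw [← ENNReal.rpow_mul, mul_one_div_cancel h0.ne', ENNReal.rpow_one]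
  rw [← h1]
  exact ENNReal.rpow_le_rpow (ENNReal.le_tsum j) (by positivity)

theorem lqNorm_add_le (hq : 1 < q) (f g : FunSeq n) :
    ∀ᵐ x, lqNorm q (f + g) x ≤ lqNorm q f x + lqNorm q g x := by
  have h : ∀ᵐ x, ∀ j, (f + g) j x = f j x + g j x :=
    ae_all_iff.2 fun j => AEEqFun.coeFn_add (f j) (g j)
  filter_upwards [h] with x hx
  have h0 : 0 < q := by linarith
  have := ENNReal.lintegral_Lp_add_le (μ := Measure.count) (p := q)
    (f := fun j : ℕ => ‖f j x‖ₑ) (g := fun j : ℕ => ‖g j x‖ₑ)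
    (measurable_of_countable _).aemeasurable (measurable_of_countable _).aemeasurable hq.le
  simp only [lintegral_count, Pi.add_apply] at this
  refine le_trans ?_ this
  unfold lqNorm
  refine ENNReal.rpow_le_rpow (ENNReal.tsum_le_tsum fun j => ?_) (by positivity)
  rw [hx j]
  exact ENNReal.rpow_le_rpow (enorm_add_le _ _) h0.le

theorem lqNorm_smul (hq : 1 < q) (c : ℂ) (f : FunSeq n) :
    ∀ᵐ x, lqNorm q (c • f) x = ‖c‖ₑ * lqNorm q f x := by
  have h : ∀ᵐ x, ∀ j, (c • f) j x = c * f j x :=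
    ae_all_iff.2 fun j => AEEqFun.coeFn_smul c (f j)
  filter_upwards [h] with x hx
  have h0 : 0 < q := by linarith
  simp only [lqNorm, hx, enorm_mul, ENNReal.mul_rpow_of_nonneg _ _ h0.le, ENNReal.tsum_mul_left]
  rw [ENNReal.mul_rpow_of_nonneg _ _ (by positivity), ← ENNReal.rpow_mul,
    mul_one_div_cancel h0.ne', ENNReal.rpow_one]

theorem lqNorm_zero (hq : 1 < q) : ∀ᵐ x, lqNorm q (0 : FunSeq n) x = 0 := by
  have := lqNorm_smul hq 0 (0 : FunSeq n)
  rw [show (0 : ℂ) • (0 : FunSeq n) = 0 from smul_zero (A := FunSeq n) (0 : ℂ)] at this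
  simpa using this

theorem eq_zero_of_lqNorm (hq : 1 < q) (f : FunSeq n) (h : ∀ᵐ x, lqNorm q f x = 0) : f = 0 := by
  funext j
  apply AEEqFun.ext
  filter_upwards [h, AEEqFun.coeFn_zero (α := Sp n) (β := ℂ) (μ := volume)] with x hx h0
  have := enorm_le_lqNorm hq f j x
  rw [hx] at this
  rw [Pi.zero_apply, h0]
  simpa using this

/-! ### Morrey spaces -/

/-- The Morrey norm, with values in `[0, ∞]`: the supremum over all dyadic cubes `Q_{J,M}` of
`2 ^ (J (n / p + r))` times the `L_p` norm on the cube. -/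
def morreyENorm {ε : Type*} [TopologicalSpace ε] [ContinuousENorm ε] (p r : ℝ)
    (F : Sp n → ε) : ℝ≥0∞ :=
  ⨆ i : Idx n, ENNReal.ofReal ((2 : ℝ) ^ ((i.1 : ℝ) * ((n : ℝ) / p + r))) *
    eLpNorm F (ENNReal.ofReal p) (volume.restrict (dyadicCube i))

theorem morreyENorm_mono {ε ε' : Type*} [TopologicalSpace ε] [ContinuousENorm ε]
    [TopologicalSpace ε'] [ContinuousENorm ε'] {F : Sp n → ε} {G : Sp n → ε'}
    (h : ∀ᵐ x, ‖F x‖ₑ ≤ ‖G x‖ₑ) : morreyENorm p r F ≤ morreyENorm p r G :=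
  iSup_mono fun _ => mul_le_mul_right (eLpNorm_mono_enorm_ae (ae_restrict_of_ae h)) _

theorem morreyENorm_add_le (hp : 1 < p) {F G : Sp n → ℝ≥0∞} (hF : Measurable F)
    (hG : Measurable G) : morreyENorm p r (F + G) ≤ morreyENorm p r F + morreyENorm p r G := by
  refine iSup_le fun i => ?_
  have h := eLpNorm_add_le (p := ENNReal.ofReal p)
    (hF.aestronglyMeasurable (μ := volume.restrict (dyadicCube i)))
    (hG.aestronglyMeasurable (μ := volume.restrict (dyadicCube i)))
    (by simpa using ENNReal.ofReal_le_ofReal hp.le)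
  refine (mul_le_mul_right h _).trans ?_
  rw [mul_add]
  exact add_le_add (le_iSup (fun i : Idx n => ENNReal.ofReal _ *
    eLpNorm F (ENNReal.ofReal p) (volume.restrict (dyadicCube i))) i)
    (le_iSup (fun i : Idx n => ENNReal.ofReal _ *
    eLpNorm G (ENNReal.ofReal p) (volume.restrict (dyadicCube i))) i)

theorem morreyENorm_const_mul (c : ℝ≥0) (F : Sp n → ℝ≥0∞) :
    morreyENorm p r (fun x => (c : ℝ≥0∞) * F x) ≤ c * morreyENorm p r F := by
  refine iSup_le fun i => ?_
  have h : eLpNorm (fun x => (c : ℝ≥0∞) * F x) (ENNReal.ofReal p)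
      (volume.restrict (dyadicCube i)) ≤
      c * eLpNorm F (ENNReal.ofReal p) (volume.restrict (dyadicCube i)) :=
    eLpNorm_le_nnreal_smul_eLpNorm_of_ae_le_mul' (Eventually.of_forall fun x => by simp) _
  calc _ ≤ _ := mul_le_mul_right h _
    _ = c * (_ * _) := mul_left_comm _ _ _
    _ ≤ _ := mul_le_mul_right (le_iSup (fun i : Idx n => ENNReal.ofReal _ *
    eLpNorm F (ENNReal.ofReal p) (volume.restrict (dyadicCube i))) i) _

theorem exists_mem_dyadicCube (x : Sp n) : ∃ i : Idx n, x ∈ dyadicCube i := by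
  refine ⟨(0, fun k => ⌊x k⌋), fun k => ?_⟩
  have h1 := Int.floor_le (x k)
  have h2 := Int.lt_floor_add_one (x k)
  simp only [neg_zero, zpow_zero, one_mul]
  constructor <;> linarith

theorem isClosed_dyadicCube (i : Idx n) : IsClosed (dyadicCube i) := by
  have : dyadicCube i = ⋂ k, {x : Sp n | x k ∈ Set.Icc ((2 : ℝ) ^ (-i.1) * ((i.2 k : ℝ) - 1))
    ((2 : ℝ) ^ (-i.1) * ((i.2 k : ℝ) + 1))} := by
    ext x; simp [dyadicCube]
  rw [this]
  exact isClosed_iInter fun k => isClosed_Icc.preimage (by fun_prop)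

theorem ae_zero_of_morreyENorm (hp : 1 < p) {F : Sp n → ℝ≥0∞} (hF : Measurable F)
    (h : morreyENorm p r F = 0) : ∀ᵐ x, F x = 0 := by
  have h1 : ∀ i : Idx n, ∀ᵐ x, x ∈ dyadicCube i → F x = 0 := by
    intro i
    have h2 := ENNReal.iSup_eq_zero.1 h i
    have h3 : ENNReal.ofReal ((2 : ℝ) ^ ((i.1 : ℝ) * ((n : ℝ) / p + r))) ≠ 0 := by
      simp only [ne_eq, ENNReal.ofReal_eq_zero, not_le]; positivity
    have h4 := (mul_eq_zero.1 h2).resolve_left h3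
    rw [eLpNorm_eq_zero_iff hF.aestronglyMeasurable
      (by simp only [ne_eq, ENNReal.ofReal_eq_zero, not_le]; linarith)] at h4
    exact (ae_restrict_iff' (isClosed_dyadicCube i).measurableSet).1 h4
  filter_upwards [ae_all_iff.2 h1] with x hx
  obtain ⟨i, hi⟩ := exists_mem_dyadicCube x
  exact hx i hi

/-- The norm of a sequence of functions in `L_p^r(ℓ_q)`, with values in `[0, ∞]`. -/
def morreySeqENorm (p q r : ℝ) (f : FunSeq n) : ℝ≥0∞ := morreyENorm p r (lqNorm q f)

theorem morreySeqENorm_add_le (hp : 1 < p) (hq : 1 < q) (f g : FunSeq n) :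
    morreySeqENorm p q r (f + g) ≤ morreySeqENorm p q r f + morreySeqENorm p q r g :=
  (morreyENorm_mono (lqNorm_add_le hq f g)).trans
    (morreyENorm_add_le hp (measurable_lqNorm q f) (measurable_lqNorm q g))

theorem morreySeqENorm_smul_le (hq : 1 < q) (c : ℂ) (f : FunSeq n) :
    morreySeqENorm p q r (c • f) ≤ ‖c‖ₑ * morreySeqENorm p q r f := by
  refine (morreyENorm_mono ?_).trans (morreyENorm_const_mul ‖c‖₊ (lqNorm q f))
  filter_upwards [lqNorm_smul hq c f] with x hx
  rw [hx]; exact le_of_eq rfl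

theorem morreySeqENorm_smul (hq : 1 < q) (c : ℂ) (f : FunSeq n) :
    morreySeqENorm p q r (c • f) = ‖c‖ₑ * morreySeqENorm p q r f := by
  refine le_antisymm (morreySeqENorm_smul_le hq c f) ?_
  rcases eq_or_ne c 0 with rfl | hc
  · simp
  have h := morreySeqENorm_smul_le (p := p) (r := r) hq c⁻¹ (c • f)
  rw [inv_smul_smul₀ hc, enorm_inv hc] at h
  calc _ ≤ ‖c‖ₑ * (‖c‖ₑ⁻¹ * morreySeqENorm p q r (c • f)) := mul_le_mul_right h _
    _ = _ := by rw [← mul_assoc, ENNReal.mul_inv_cancel (by simpa using hc) (by simp), one_mul]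

theorem morreySeqENorm_zero (hq : 1 < q) : morreySeqENorm p q r (0 : FunSeq n) = 0 := by
  have := morreySeqENorm_smul (p := p) (r := r) hq 0 (0 : FunSeq n)
  rw [show (0 : ℂ) • (0 : FunSeq n) = 0 from smul_zero (A := FunSeq n) (0 : ℂ)] at this
  simpa using this

/-- The vector-valued Morrey space `L_p^r(ℓ_q)`: all sequences of functions in `L_p^r` whose
pointwise `ℓ_q` norm has finite Morrey norm. -/
def MorreySeq (n : ℕ) (p q r : ℝ) (hp : 1 < p) (hq : 1 < q) : Submodule ℂ (FunSeq n) where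
  carrier := {f | (∀ j, morreyENorm p r (f j) < ⊤) ∧ morreySeqENorm p q r f < ⊤}
  zero_mem' := by
    have h0 := morreySeqENorm_zero (n := n) (p := p) (r := r) hq
    refine ⟨fun j => (morreyENorm_mono (G := lqNorm q (0 : FunSeq n))
      (Eventually.of_forall fun x => enorm_le_lqNorm hq _ j x)).trans_lt ?_, ?_⟩ <;>
    · change morreySeqENorm p q r (0 : FunSeq n) < ⊤
      simp [h0]
  add_mem' := by
    intro f g hf hg
    have h : morreySeqENorm p q r (f + g) < ⊤ :=
      (morreySeqENorm_add_le hp hq f g).trans_lt (ENNReal.add_lt_top.2 ⟨hf.2, hg.2⟩)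
    exact ⟨fun j => (morreyENorm_mono (G := lqNorm q (f + g))
      (Eventually.of_forall fun x => enorm_le_lqNorm hq _ j x)).trans_lt h, h⟩
  smul_mem' := by
    intro c f hf
    have h : morreySeqENorm p q r (c • f) < ⊤ :=
      (morreySeqENorm_smul_le hq c f).trans_lt (ENNReal.mul_lt_top (by simp) hf.2)
    exact ⟨fun j => (morreyENorm_mono (G := lqNorm q (c • f))
      (Eventually.of_forall fun x => enorm_le_lqNorm hq _ j x)).trans_lt h, h⟩

variable {hp : 1 < p} {hq : 1 < q}

instance : Norm (MorreySeq n p q r hp hq) := ⟨fun f => (morreySeqENorm p q r f.1).toReal⟩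

theorem morreySeq_core : NormedSpace.Core ℂ (MorreySeq n p q r hp hq) where
  norm_nonneg _ := ENNReal.toReal_nonneg
  norm_smul c f := by
    change (morreySeqENorm p q r (c • f.1)).toReal = _
    rw [morreySeqENorm_smul hq, ENNReal.toReal_mul]
    simp [Norm.norm]
  norm_triangle f g := by
    change (morreySeqENorm p q r (f.1 + g.1)).toReal ≤
      (morreySeqENorm p q r f.1).toReal + (morreySeqENorm p q r g.1).toReal
    rw [← ENNReal.toReal_add f.2.2.ne g.2.2.ne]
    exact ENNReal.toReal_mono (ENNReal.add_lt_top.2 ⟨f.2.2, g.2.2⟩).ne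
      (morreySeqENorm_add_le hp hq f.1 g.1)
  norm_eq_zero_iff f := by
    change (morreySeqENorm p q r f.1).toReal = 0 ↔ _
    constructor
    · intro h
      rcases (ENNReal.toReal_eq_zero_iff _).1 h with h | h
      · exact Subtype.ext (eq_zero_of_lqNorm hq f.1
          (ae_zero_of_morreyENorm hp (measurable_lqNorm q f.1) h))
      · exact absurd h f.2.2.ne
    · rintro rfl
      simp [morreySeqENorm_zero hq]

instance : NormedAddCommGroup (MorreySeq n p q r hp hq) := NormedAddCommGroup.ofCore morreySeq_core

instance : NormedSpace ℂ (MorreySeq n p q r hp hq) := NormedSpace.ofCore morreySeq_core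

/-- `f` is (the class of) a test function: smooth with compact support. -/
def IsTestFun (f : Sp n →ₘ[volume] ℂ) : Prop :=
  ∃ φ : Sp n → ℂ, ContDiff ℝ ∞ φ ∧ HasCompactSupport φ ∧ f =ᵐ[volume] φ

theorem IsTestFun.zero : IsTestFun (0 : Sp n →ₘ[volume] ℂ) :=
  ⟨fun _ => 0, contDiff_const, HasCompactSupport.zero, AEEqFun.coeFn_zero⟩

theorem IsTestFun.add {f g : Sp n →ₘ[volume] ℂ} (hf : IsTestFun f) (hg : IsTestFun g) :
    IsTestFun (f + g) := by
  obtain ⟨φ, h1, h2, h3⟩ := hf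
  obtain ⟨ψ, h1', h2', h3'⟩ := hg
  exact ⟨φ + ψ, h1.add h1', h2.add h2', (AEEqFun.coeFn_add f g).trans (h3.add h3')⟩

theorem IsTestFun.smul (c : ℂ) {f : Sp n →ₘ[volume] ℂ} (hf : IsTestFun f) :
    IsTestFun (c • f) := by
  obtain ⟨φ, h1, h2, h3⟩ := hf
  exact ⟨c • φ, h1.const_smul c, HasCompactSupport.smul_left (f := fun _ => c) h2,
    (AEEqFun.coeFn_smul c f).trans (h3.const_smul c)⟩

/-- The closure in `L_p^r(ℓ_q)` of the finitely supported sequences of test functions. -/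
def MorreySeqCirc (n : ℕ) (p q r : ℝ) (hp : 1 < p) (hq : 1 < q) :
    Submodule ℂ (MorreySeq n p q r hp hq) where
  carrier := {f | ∃ φ : ℕ → FunSeq n, (∀ k j, IsTestFun (φ k j)) ∧ (∀ k j, k < j → φ k j = 0) ∧
    Tendsto (fun k => morreySeqENorm p q r (f.1 - φ k)) atTop (𝓝 0)}
  zero_mem' := ⟨fun _ _ => 0, fun _ _ => IsTestFun.zero, fun _ _ _ => rfl, by
    have : ∀ k : ℕ, ((0 : MorreySeq n p q r hp hq).1 - (fun _ => 0 : FunSeq n)) = 0 := by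
      intro k; funext j; simp
    simp_rw [this 0, morreySeqENorm_zero hq]; exact tendsto_const_nhds⟩
  add_mem' := by
    rintro f g ⟨φ, h1, h2, h3⟩ ⟨ψ, h1', h2', h3'⟩
    refine ⟨φ + ψ, fun k j => (h1 k j).add (h1' k j), fun k j hkj => ?_, ?_⟩
    · simp [h2 k j hkj, h2' k j hkj]
    · have h4 := h3.add h3'
      rw [add_zero] at h4
      refine tendsto_of_tendsto_of_tendsto_of_le_of_le tendsto_const_nhds h4
        (fun _ => zero_le) fun k => ?_
      have : (f + g).1 - (φ + ψ) k = (f.1 - φ k) + (g.1 - ψ k) := by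
        simp only [Submodule.coe_add, Pi.add_apply]; abel
      simp only [this]
      exact morreySeqENorm_add_le hp hq _ _
  smul_mem' := by
    rintro c f ⟨φ, h1, h2, h3⟩
    refine ⟨c • φ, fun k j => (h1 k j).smul c, fun k j hkj => ?_, ?_⟩
    · change c • φ k j = 0
      rw [h2 k j hkj]; exact smul_zero (A := Sp n →ₘ[volume] ℂ) c
    · have : ∀ k, morreySeqENorm p q r ((c • f).1 - (c • φ) k) =
          ‖c‖ₑ * morreySeqENorm p q r (f.1 - φ k) := fun k => by
        rw [← morreySeqENorm_smul hq, smul_sub]; rfl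
      simp_rw [this]
      simpa using ENNReal.Tendsto.const_mul h3 (Or.inr (by simp))


/-! ### Predual Morrey spaces -/

/-- Admissible coefficients `λ_{J,M}` and atoms `a_{J,M}`: the function `a_{J,M}` is in `L_p`, is
supported in `Q_{J,M}` and has `L_p` norm at most `2 ^ (-J (n / p + ρ))`, and the coefficients are
absolutely summable. -/
structure IsAtomic (p ρ : ℝ) (lam : Idx n → ℂ) (a : Idx n → Sp n → ℂ) : Prop where
  memLp : ∀ i, MemLp (a i) (ENNReal.ofReal p) volume
  supp : ∀ i, ∀ᵐ x, x ∉ dyadicCube i → a i x = 0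
  norm_le : ∀ i, eLpNorm (a i) (ENNReal.ofReal p) volume ≤
    ENNReal.ofReal ((2 : ℝ) ^ (-((i.1 : ℝ) * ((n : ℝ) / p + ρ))))
  summable : Summable fun i => ‖lam i‖

/-- `T = ∑ λ_{J,M} a_{J,M}` with convergence in the space of tempered distributions, for admissible
coefficients and atoms. -/
structure IsAtomicDecomp (p ρ : ℝ) (T : 𝓢'(Sp n, ℂ)) (lam : Idx n → ℂ) (a : Idx n → Sp n → ℂ) :
    Prop extends IsAtomic p ρ lam a where
  hasSum : ∀ φ : 𝓢(Sp n, ℂ), HasSum (fun i => lam i * ∫ x, φ x * a i x) (T φ)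

/-- The predual Morrey space `H^ρ L_p`, a set of tempered distributions. -/
def predualMorrey (n : ℕ) (p ρ : ℝ) : Set 𝓢'(Sp n, ℂ) :=
  {T | ∃ lam a, IsAtomicDecomp p ρ T lam a}

/-- The norm of `H^ρ L_p`: the infimum of `∑ |λ_{J,M}|` over all atomic decompositions. -/
def predualENorm (p ρ : ℝ) (T : 𝓢'(Sp n, ℂ)) : ℝ≥0∞ :=
  ⨅ (lam) (a) (_ : IsAtomicDecomp p ρ T lam a), ∑' i, ‖lam i‖ₑ

/-- The tempered distribution `T` is regular, and it is generated by the locally integrable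
function `h`. -/
def Generates (h : Sp n → ℂ) (T : 𝓢'(Sp n, ℂ)) : Prop :=
  LocallyIntegrable h volume ∧
    ∀ φ : 𝓢(Sp n, ℂ), Integrable (fun x => φ x * h x) volume ∧ T φ = ∫ x, φ x * h x

/-- The function `h` belongs to `H^ρ L_p`, as a regular distribution. -/
def MemPredual (p ρ : ℝ) (h : Sp n → ℂ) : Prop := ∃ T ∈ predualMorrey n p ρ, Generates h T

/-- The norm in `H^ρ L_p` of a function, with values in `[0, ∞]`. -/
def predualFunENorm (p ρ : ℝ) (h : Sp n → ℂ) : ℝ≥0∞ :=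
  ⨅ (T) (_ : Generates h T), predualENorm p ρ T

theorem dyadicCube_eq (i : Idx n) : dyadicCube i = WithLp.ofLp ⁻¹'
    (Set.Icc (fun k => (2 : ℝ) ^ (-i.1) * ((i.2 k : ℝ) - 1))
      (fun k => (2 : ℝ) ^ (-i.1) * ((i.2 k : ℝ) + 1))) := by
  ext x
  simp only [dyadicCube, Set.mem_ofPred_eq, Set.mem_preimage, Set.mem_Icc, Pi.le_def]
  exact forall_and

theorem volume_dyadicCube (i : Idx n) :
    volume (dyadicCube i) = ENNReal.ofReal ((2 : ℝ) ^ ((n : ℝ) * (1 - (i.1 : ℝ)))) := by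
  rw [dyadicCube_eq, (PiLp.volume_preserving_ofLp (Fin n)).measure_preimage
    measurableSet_Icc.nullMeasurableSet, Real.volume_Icc_pi]
  have : ∀ k : Fin n, (2 : ℝ) ^ (-i.1) * ((i.2 k : ℝ) + 1) - (2 : ℝ) ^ (-i.1) * ((i.2 k : ℝ) - 1)
      = (2 : ℝ) ^ (1 - (i.1 : ℝ)) := by
    intro k
    rw [Real.rpow_sub two_pos, Real.rpow_intCast, zpow_neg, Real.rpow_one]; ring
  simp_rw [this]
  rw [Finset.prod_const, Finset.card_univ, Fintype.card_fin, ← ENNReal.ofReal_pow (by positivity),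
    ← Real.rpow_natCast, ← Real.rpow_mul two_pos.le, mul_comm]

/-- The exponent `u = -n / ρ`, for which `H^ρ L_p` embeds into `L_u`. -/
def uExp (n : ℕ) (ρ : ℝ) : ℝ≥0∞ := ENNReal.ofReal (-(n : ℝ) / ρ)

/-- The index range of the predual Morrey spaces: `1 < p < ∞` and `-n < ρ < -n / p`. -/
structure PredualIndex (n : ℕ) (p ρ : ℝ) : Prop where
  one_lt : 1 < p
  lower : -(n : ℝ) < ρ
  upper : ρ < -(n : ℝ) / p

theorem PredualIndex.rho_neg (h : PredualIndex n p ρ) : ρ < 0 := by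
  have h1 := h.one_lt
  have : (0 : ℝ) ≤ n / p := by positivity
  have h2 := h.upper
  rw [neg_div] at h2
  linarith

theorem PredualIndex.n_pos (h : PredualIndex n p ρ) : (0 : ℝ) < n := by
  have := h.rho_neg; have := h.lower; linarith

theorem PredualIndex.one_le_u (h : PredualIndex n p ρ) : 1 ≤ uExp n ρ := by
  have h1 := h.rho_neg
  have h2 := h.lower
  rw [uExp, ← ENNReal.ofReal_one]
  apply ENNReal.ofReal_le_ofReal
  rw [le_div_iff_of_neg h1]; linarith

theorem PredualIndex.u_le (h : PredualIndex n p ρ) : uExp n ρ ≤ ENNReal.ofReal p := by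
  have h1 := h.rho_neg
  have h2 := h.upper
  have h3 := h.one_lt
  apply ENNReal.ofReal_le_ofReal
  rw [div_le_iff_of_neg h1]
  rw [lt_div_iff₀ (by linarith)] at h2
  linarith

/-- A uniform bound for the `L_u` norms of atoms. -/
def uBound (n : ℕ) (p ρ : ℝ) : ℝ≥0∞ := ENNReal.ofReal ((2 : ℝ) ^ (-((n : ℝ) / p + ρ)))

theorem atom_bound (h : PredualIndex n p ρ) {i : Idx n} {a : Sp n → ℂ}
    (ha : MemLp a (ENNReal.ofReal p) volume) (hs : ∀ᵐ x, x ∉ dyadicCube i → a x = 0)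
    (hn : eLpNorm a (ENNReal.ofReal p) volume ≤
      ENNReal.ofReal ((2 : ℝ) ^ (-((i.1 : ℝ) * ((n : ℝ) / p + ρ))))) :
    eLpNorm a (uExp n ρ) volume ≤ uBound n p ρ := by
  have hm := (isClosed_dyadicCube i).measurableSet
  have h1 : a =ᵐ[volume] (dyadicCube i).indicator a := by
    filter_upwards [hs] with x hx
    by_cases hxi : x ∈ dyadicCube i
    · rw [Set.indicator_of_mem hxi]
    · rw [Set.indicator_of_notMem hxi, hx hxi]
  rw [eLpNorm_congr_ae h1, eLpNorm_indicator_eq_eLpNorm_restrict hm]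
  have hn0 := h.n_pos
  have hr0 := h.rho_neg
  have hp0 : 0 < p := by linarith [h.one_lt]
  have hu0 : 0 < -(n : ℝ) / ρ := div_pos_of_neg_of_neg (by linarith) hr0
  refine (eLpNorm_le_eLpNorm_mul_rpow_measure_univ h.u_le ha.1.restrict).trans ?_
  rw [Measure.restrict_apply_univ, volume_dyadicCube, uExp, ENNReal.toReal_ofReal hu0.le,
    ENNReal.toReal_ofReal hp0.le]
  have h2 : eLpNorm a (ENNReal.ofReal p) (volume.restrict (dyadicCube i)) ≤ _ :=
    (eLpNorm_mono_measure a Measure.restrict_le_self).trans hn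
  refine (mul_le_mul_left h2 _).trans (le_of_eq ?_)
  rw [ENNReal.ofReal_rpow_of_pos (by positivity), ← ENNReal.ofReal_mul (by positivity),
    ← Real.rpow_mul two_pos.le, ← Real.rpow_add two_pos, uBound]
  congr 2
  field_simp
  ring

theorem IsAtomic.exists_decomp (h : PredualIndex n p ρ) {lam : Idx n → ℂ} {a : Idx n → Sp n → ℂ}
    (H : IsAtomic p ρ lam a) :
    (∀ᵐ x, Summable fun i => lam i * a i x) ∧
    AEStronglyMeasurable (fun x => ∑' i, lam i * a i x) volume ∧
    eLpNorm (fun x => ∑' i, lam i * a i x) (uExp n ρ) volume ≤ uBound n p ρ * ∑' i, ‖lam i‖ₑ ∧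
    ∃ T : 𝓢'(Sp n, ℂ), IsAtomicDecomp p ρ T lam a ∧ Generates (fun x => ∑' i, lam i * a i x) T := by
  have : Fact (1 ≤ uExp n ρ) := ⟨h.one_le_u⟩
  have hb : ∀ i, eLpNorm (a i) (uExp n ρ) volume ≤ uBound n p ρ := fun i =>
    atom_bound h (H.memLp i) (H.supp i) (H.norm_le i)
  have hU : ∀ i, MemLp (a i) (uExp n ρ) volume := fun i =>
    ⟨(H.memLp i).1, (hb i).trans_lt ENNReal.ofReal_lt_top⟩
  have hl : ∑' i, ‖lam i‖ₑ ≠ ⊤ := tsum_enorm_ne_top_iff_summable_norm.2 H.summable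
  set F : Idx n → Lp ℂ (uExp n ρ) (volume : Measure (Sp n)) := fun i => lam i • (hU i).toLp (a i)
    with hF
  have hFn : ∀ i, ‖F i‖ₑ ≤ ‖lam i‖ₑ * uBound n p ρ := fun i => by
    rw [hF]; simp only [enorm_smul, Lp.enorm_toLp]; gcongr; exact hb i
  have hsum : ∑' i, ‖F i‖ₑ ≤ uBound n p ρ * ∑' i, ‖lam i‖ₑ := by
    rw [mul_comm, ← ENNReal.tsum_mul_right]; exact ENNReal.tsum_le_tsum hFn
  have hfin : ∑' i, ‖F i‖ₑ ≠ ⊤ :=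
    (hsum.trans_lt (ENNReal.mul_lt_top ENNReal.ofReal_lt_top hl.lt_top)).ne
  have hFs : Summable F := Summable.of_enorm hfin
  have hae : ∀ᵐ x, ∀ i, F i x = lam i * a i x := by
    refine ae_all_iff.2 fun i => ?_
    filter_upwards [Lp.coeFn_smul (lam i) ((hU i).toLp (a i)), (hU i).coeFn_toLp] with x h1 h2
    rw [hF]; simp only; rw [h1, Pi.smul_apply, h2, smul_eq_mul]
  have hS := Lp.hasSum_coeFn_tsum hfin
  have hS' : ∀ᵐ x, HasSum (fun i => lam i * a i x) ((∑' i, F i : Lp ℂ (uExp n ρ) _) x) := by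
    filter_upwards [hS, hae] with x h1 h2
    simpa only [h2] using h1
  have hSe : (fun x => ∑' i, lam i * a i x) =ᵐ[volume] (∑' i, F i : Lp ℂ (uExp n ρ) _) := by
    filter_upwards [hS'] with x hx using hx.tsum_eq
  refine ⟨hS'.mono fun x hx => hx.summable, (Lp.aestronglyMeasurable _).congr hSe.symm, ?_,
    Lp.toTemperedDistribution (∑' i, F i), ⟨H, fun φ => ?_⟩,
    ?_, fun φ => ⟨?_, ?_⟩⟩
  · rw [eLpNorm_congr_ae hSe, ← Lp.enorm_def]
    exact (enorm_tsum_le_tsum_enorm).trans hsum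
  · have h1 := hFs.hasSum.mapL (Lp.toTemperedDistributionCLM ℂ volume (uExp n ρ))
    have h2 : HasSum (fun i => Lp.toTemperedDistribution (F i) φ)
        (Lp.toTemperedDistribution (∑' i, F i) φ) :=
      h1.mapL (PointwiseConvergenceCLM.evalCLM (RingHom.id ℂ) ℂ φ)
    convert h2 using 2 with i
    rw [Lp.toTemperedDistribution_apply, ← integral_const_mul]
    refine integral_congr_ae ?_
    filter_upwards [hae] with x hx
    rw [hx i, smul_eq_mul]; ring
  · exact ((Lp.memLp (∑' i, F i)).locallyIntegrable h.one_le_u).congr hSe.symm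
  · have := ENNReal.HolderConjugate.inv_one_sub_inv' h.one_le_u
    have : ENNReal.HolderTriple (1 - (uExp n ρ)⁻¹)⁻¹ (uExp n ρ) 1 := 
      ENNReal.HolderConjugate.symm (p := uExp n ρ)
    have h1 : MemLp φ (1 - (uExp n ρ)⁻¹)⁻¹ volume := φ.memLp _ _
    refine (h1.integrable_mul (Lp.memLp (∑' i, F i))).congr ?_
    filter_upwards [hSe] with x hx
    rw [hx]; rfl
  · rw [Lp.toTemperedDistribution_apply]
    refine integral_congr_ae ?_
    filter_upwards [hSe] with x hx
    rw [hx]; rfl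

theorem Generates.ae_eq {h h' : Sp n → ℂ} {T : 𝓢'(Sp n, ℂ)} (H : Generates h T)
    (H' : Generates h' T) : h =ᵐ[volume] h' := by
  refine ae_eq_of_integral_contDiff_smul_eq H.1 H'.1 fun g hg hgc => ?_
  have hg₁ : HasCompactSupport (Complex.ofRealCLM ∘ g) := hgc.comp_left rfl
  have hg₂ : ContDiff ℝ ∞ (Complex.ofRealCLM ∘ g) := by fun_prop
  have h1 := (H.2 (hg₁.toSchwartzMap hg₂)).2
  have h2 := (H'.2 (hg₁.toSchwartzMap hg₂)).2
  rw [h1] at h2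
  simpa using h2

theorem Generates.congr {h h' : Sp n → ℂ} {T : 𝓢'(Sp n, ℂ)} (H : Generates h T)
    (e : h =ᵐ[volume] h') : Generates h' T := by
  have e' : ∀ φ : 𝓢(Sp n, ℂ), (fun x => φ x * h x) =ᵐ[volume] fun x => φ x * h' x := fun φ => by
    filter_upwards [e] with x hx
    rw [hx]
  exact ⟨H.1.congr e, fun φ => ⟨(H.2 φ).1.congr (e' φ),
    (H.2 φ).2.trans (integral_congr_ae (e' φ))⟩⟩

theorem IsAtomicDecomp.ae_eq (h : PredualIndex n p ρ) {T : 𝓢'(Sp n, ℂ)} {lam : Idx n → ℂ}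
    {a : Idx n → Sp n → ℂ} (H : IsAtomicDecomp p ρ T lam a) {f : Sp n → ℂ} (hf : Generates f T) :
    f =ᵐ[volume] fun x => ∑' i, lam i * a i x := by
  obtain ⟨-, -, -, T', H', hT'⟩ := H.toIsAtomic.exists_decomp h
  have : T = T' := by
    ext φ
    exact (H.hasSum φ).unique (H'.hasSum φ)
  subst this
  exact hf.ae_eq hT'

theorem exists_of_predualFunENorm_lt (h : PredualIndex n p ρ) {f : Sp n → ℂ} {c : ℝ≥0∞}
    (hf : predualFunENorm p ρ f < c) : ∃ lam a, IsAtomic p ρ lam a ∧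
      (f =ᵐ[volume] fun x => ∑' i, lam i * a i x) ∧ ∑' i, ‖lam i‖ₑ < c := by
  simp only [predualFunENorm, predualENorm, iInf_lt_iff] at hf
  obtain ⟨T, hT, lam, a, H, hc⟩ := hf
  exact ⟨lam, a, H.toIsAtomic, H.ae_eq h hT, hc⟩

theorem IsAtomic.memPredual (h : PredualIndex n p ρ) {f : Sp n → ℂ} {lam : Idx n → ℂ}
    {a : Idx n → Sp n → ℂ} (H : IsAtomic p ρ lam a)
    (e : f =ᵐ[volume] fun x => ∑' i, lam i * a i x) :
    MemPredual p ρ f ∧ predualFunENorm p ρ f ≤ ∑' i, ‖lam i‖ₑ := by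
  obtain ⟨-, -, -, T, HT, hT⟩ := H.exists_decomp h
  have hf := hT.congr e.symm
  exact ⟨⟨T, ⟨lam, a, HT⟩, hf⟩, iInf₂_le_of_le T hf (iInf_le_of_le lam (iInf₂_le_of_le a HT le_rfl))⟩

theorem memPredual_iff (h : PredualIndex n p ρ) {f : Sp n → ℂ} :
    MemPredual p ρ f ↔ predualFunENorm p ρ f < ⊤ := by
  constructor
  · rintro ⟨T, ⟨lam, a, H⟩, hT⟩
    exact (iInf₂_le_of_le T hT (iInf_le_of_le lam (iInf₂_le_of_le a H le_rfl))).trans_lt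
      (tsum_enorm_ne_top_iff_summable_norm.2 H.summable).lt_top
  · intro hf
    obtain ⟨lam, a, H, e, -⟩ := exists_of_predualFunENorm_lt h hf
    exact (H.memPredual h e).1

theorem predualFunENorm_mono (h : PredualIndex n p ρ) {f g : Sp n → ℂ}
    (hf : AEStronglyMeasurable f volume) (hfg : ∀ᵐ x, ‖f x‖ ≤ ‖g x‖) :
    predualFunENorm p ρ f ≤ predualFunENorm p ρ g := by
  refine le_of_forall_gt fun c hc => ?_
  obtain ⟨lam, a, H, e, hlam⟩ := exists_of_predualFunENorm_lt h hc
  have hg : AEStronglyMeasurable g volume := (H.exists_decomp h).2.1.congr e.symm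
  have hm : AEStronglyMeasurable (fun x => f x / g x) volume :=
    (hf.aemeasurable.div hg.aemeasurable).aestronglyMeasurable
  have hle : ∀ i, ∀ᵐ x, ‖a i x * (f x / g x)‖ ≤ ‖a i x‖ := fun i => by
    filter_upwards [hfg] with x hx
    rw [norm_mul, norm_div]
    exact mul_le_of_le_one_right (norm_nonneg _) (div_le_one_of_le₀ hx (norm_nonneg _))
  have H' : IsAtomic p ρ lam (fun i x => a i x * (f x / g x)) :=
    ⟨fun i => (H.memLp i).mono ((H.memLp i).1.mul hm) (hle i),
      fun i => (H.supp i).mono fun x hx hxi => by rw [hx hxi, zero_mul],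
      fun i => (eLpNorm_mono_ae (hle i)).trans (H.norm_le i), H.summable⟩
  refine ((H'.memPredual h ?_).2).trans_lt hlam
  filter_upwards [e, hfg] with x hx hx'
  simp_rw [← mul_assoc]
  rw [tsum_mul_right, ← hx]
  rcases eq_or_ne (g x) 0 with h0 | h0
  · rw [h0, norm_zero] at hx'
    rw [h0, zero_mul]
    simpa using hx'
  · field_simp

theorem predualFunENorm_add_le (h : PredualIndex n p ρ) (f g : Sp n → ℂ) :
    predualFunENorm p ρ (f + g) ≤ predualFunENorm p ρ f + predualFunENorm p ρ g := by
  rcases eq_or_ne (predualFunENorm p ρ f) ⊤ with hf | hf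
  · simp [hf]
  rcases eq_or_ne (predualFunENorm p ρ g) ⊤ with hg | hg
  · simp [hg]
  refine ENNReal.le_of_forall_pos_le_add fun ε hε _ => ?_
  have hε2 : ((ε / 2 : ℝ≥0) : ℝ≥0∞) ≠ 0 := by simpa using hε.ne'
  obtain ⟨l, a, H, e, hl⟩ := exists_of_predualFunENorm_lt h (ENNReal.lt_add_right hf hε2)
  obtain ⟨m, b, K, e', hm⟩ := exists_of_predualFunENorm_lt h (ENNReal.lt_add_right hg hε2)
  have hp1 : 1 ≤ ENNReal.ofReal p := by simpa using ENNReal.ofReal_le_ofReal h.one_lt.le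
  set s : Idx n → ℝ := fun i => ‖l i‖ + ‖m i‖ with hs
  have hs0 : ∀ i, 0 ≤ s i := fun i => by positivity
  set c : Idx n → Sp n → ℂ := fun i x => (l i / s i) * a i x + (m i / s i) * b i x with hc
  have hmul : ∀ i x, (s i : ℂ) * c i x = l i * a i x + m i * b i x := by
    intro i x
    rcases eq_or_ne (s i) 0 with h0 | h0
    · have h1 : ‖l i‖ = 0 := le_antisymm (by have := norm_nonneg (m i); simp only [hs] at h0; linarith)
        (norm_nonneg _)
      have h2 : ‖m i‖ = 0 := le_antisymm (by have := norm_nonneg (l i); simp only [hs] at h0; linarith)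
        (norm_nonneg _)
      rw [norm_eq_zero] at h1 h2
      simp [h0, h1, h2]
    · have : (s i : ℂ) ≠ 0 := by exact_mod_cast h0
      simp only [hc]; field_simp
  have hcn : ∀ i, ‖l i / s i‖ₑ + ‖m i / s i‖ₑ ≤ 1 := by
    intro i
    rw [← ofReal_norm, ← ofReal_norm, ← ENNReal.ofReal_add (norm_nonneg _)
      (norm_nonneg _), ← ENNReal.ofReal_one]
    apply ENNReal.ofReal_le_ofReal
    rw [norm_div, norm_div, ← add_div, Complex.norm_real, Real.norm_of_nonneg (hs0 i)]
    exact div_self_le_one _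
  have J : IsAtomic p ρ (fun i => (s i : ℂ)) c := by
    refine ⟨fun i => ((H.memLp i).const_mul _).add ((K.memLp i).const_mul _), fun i => ?_,
      fun i => ?_, ?_⟩
    · filter_upwards [H.supp i, K.supp i] with x h1 h2 hx
      simp [hc, h1 hx, h2 hx]
    · calc eLpNorm (c i) (ENNReal.ofReal p) volume
          ≤ eLpNorm (fun x => (l i / s i) * a i x) (ENNReal.ofReal p) volume +
            eLpNorm (fun x => (m i / s i) * b i x) (ENNReal.ofReal p) volume :=
            eLpNorm_add_le ((H.memLp i).1.const_mul _) ((K.memLp i).1.const_mul _) hp1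
        _ = ‖l i / s i‖ₑ * eLpNorm (a i) (ENNReal.ofReal p) volume +
            ‖m i / s i‖ₑ * eLpNorm (b i) (ENNReal.ofReal p) volume := by
            congr 1
            · exact eLpNorm_const_smul (l i / s i : ℂ) (a i) _ _
            · exact eLpNorm_const_smul (m i / s i : ℂ) (b i) _ _
        _ ≤ _ := add_le_add (mul_le_mul_right (H.norm_le i) _) (mul_le_mul_right (K.norm_le i) _)
        _ ≤ _ := by
            rw [← add_mul]
            exact (mul_le_mul_left (hcn i) _).trans (one_mul _).le
    · have : ∀ i, ‖(s i : ℂ)‖ = ‖l i‖ + ‖m i‖ := fun i => by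
        rw [Complex.norm_real, Real.norm_of_nonneg (hs0 i)]
      simp_rw [this]
      exact H.summable.add K.summable
  have hsum : ∑' i, ‖(s i : ℂ)‖ₑ = ∑' i, ‖l i‖ₑ + ∑' i, ‖m i‖ₑ := by
    rw [← ENNReal.tsum_add]
    congr 1; funext i
    rw [← ofReal_norm, Complex.norm_real, Real.norm_of_nonneg (hs0 i),
      ENNReal.ofReal_add (norm_nonneg _) (norm_nonneg _), ofReal_norm,
      ofReal_norm]
  refine ((J.memPredual h ?_).2).trans ?_
  · filter_upwards [e, e', (H.exists_decomp h).1, (K.exists_decomp h).1] with x h1 h2 h3 h4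
    simp_rw [hmul]
    rw [Pi.add_apply, h1, h2, h3.tsum_add h4]
  · rw [hsum]
    refine (add_le_add hl.le hm.le).trans (le_of_eq ?_)
    rw [add_add_add_comm, ← ENNReal.coe_add, add_halves]

theorem predualFunENorm_const_mul_le (h : PredualIndex n p ρ) (c : ℂ) (f : Sp n → ℂ) :
    predualFunENorm p ρ (fun x => c * f x) ≤ ‖c‖ₑ * predualFunENorm p ρ f := by
  rcases eq_or_ne c 0 with rfl | hc
  · have H : IsAtomic p ρ (0 : Idx n → ℂ) (0 : Idx n → Sp n → ℂ) :=
      ⟨fun _ => MemLp.zero, fun _ => by simp, fun _ => by simp, by simp⟩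
    simpa using (H.memPredual h (f := fun x => 0 * f x) (by simp)).2
  have hc0 : ‖c‖ₑ ≠ 0 := by simpa using hc
  rw [mul_comm, ← ENNReal.div_le_iff hc0 (by simp)]
  refine le_of_forall_gt fun t ht => ?_
  obtain ⟨lam, a, H, e, hlam⟩ := exists_of_predualFunENorm_lt h ht
  have H' : IsAtomic p ρ (fun i => c * lam i) a :=
    ⟨H.memLp, H.supp, H.norm_le, by simpa using H.summable.mul_left ‖c‖⟩
  refine lt_of_le_of_lt ?_ hlam
  rw [ENNReal.div_le_iff hc0 (by simp)]
  refine ((H'.memPredual h ?_).2).trans (le_of_eq ?_)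
  · filter_upwards [e] with x hx
    simp_rw [mul_assoc]
    rw [tsum_mul_left, hx]
  · simp_rw [enorm_mul]
    rw [ENNReal.tsum_mul_left, mul_comm]

theorem ae_zero_of_predualFunENorm (h : PredualIndex n p ρ) {f : Sp n → ℂ}
    (hf : predualFunENorm p ρ f = 0) : f =ᵐ[volume] 0 := by
  have hU0 : uExp n ρ ≠ 0 := (zero_lt_one.trans_le h.one_le_u).ne'
  have hm : AEStronglyMeasurable f volume := by
    obtain ⟨lam, a, H, e, -⟩ := exists_of_predualFunENorm_lt h (hf.trans_lt ENNReal.zero_lt_top)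
    exact (H.exists_decomp h).2.1.congr e.symm
  rw [← eLpNorm_eq_zero_iff hm hU0]
  have hB : uBound n p ρ ≠ 0 := by
    simp only [uBound, ne_eq, ENNReal.ofReal_eq_zero, not_le]; positivity
  have hB' : uBound n p ρ ≠ ⊤ := ENNReal.ofReal_ne_top
  refine le_antisymm (le_of_forall_gt fun c hc => ?_) zero_le
  have hc' : 0 < c / uBound n p ρ := ENNReal.div_pos hc.ne' hB'
  obtain ⟨lam, a, H, e, hlam⟩ := exists_of_predualFunENorm_lt h (hf.trans_lt hc')
  rw [eLpNorm_congr_ae e]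
  refine (H.exists_decomp h).2.2.1.trans_lt ?_
  rw [mul_comm]
  exact (ENNReal.lt_div_iff_mul_lt (Or.inl hB) (Or.inl hB')).1 hlam

/-- The pointwise `ℓ_q` norm as a complex-valued function. -/
def lqFun (q : ℝ) (g : FunSeq n) (x : Sp n) : ℂ := ((lqNorm q g x).toReal : ℂ)

/-- The norm of a sequence of functions in `H^ρ L_p(ℓ_q)`, with values in `[0, ∞]`. -/
def predualSeqENorm (p q ρ : ℝ) (g : FunSeq n) : ℝ≥0∞ := predualFunENorm p ρ (lqFun q g)

theorem measurable_lqFun (q : ℝ) (g : FunSeq n) : Measurable (lqFun q g) :=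
  Complex.measurable_ofReal.comp (measurable_lqNorm q g).ennreal_toReal

theorem norm_lqFun (q : ℝ) (g : FunSeq n) (x : Sp n) : ‖lqFun q g x‖ = (lqNorm q g x).toReal := by
  rw [lqFun, Complex.norm_real, Real.norm_of_nonneg ENNReal.toReal_nonneg]

theorem memPredual_component (h : PredualIndex n p ρ) (hq : 1 < q) {g : FunSeq n}
    (h1 : ∀ᵐ x, lqNorm q g x < ⊤) (h2 : predualSeqENorm p q ρ g < ⊤) (j : ℕ) :
    MemPredual p ρ (g j) := by
  rw [memPredual_iff h]
  refine (predualFunENorm_mono h (g j).aestronglyMeasurable ?_).trans_lt h2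
  filter_upwards [h1] with x hx
  rw [norm_lqFun, ← toReal_enorm]
  exact ENNReal.toReal_mono hx.ne (enorm_le_lqNorm hq g j x)

theorem predualSeqENorm_add_le (h : PredualIndex n p ρ) (hq : 1 < q) {f g : FunSeq n}
    (hf : ∀ᵐ x, lqNorm q f x < ⊤) (hg : ∀ᵐ x, lqNorm q g x < ⊤) :
    predualSeqENorm p q ρ (f + g) ≤ predualSeqENorm p q ρ f + predualSeqENorm p q ρ g := by
  refine (predualFunENorm_mono h (measurable_lqFun q _).aestronglyMeasurable ?_).trans
    (predualFunENorm_add_le h (lqFun q f) (lqFun q g))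
  filter_upwards [hf, hg, lqNorm_add_le hq f g] with x h1 h2 h3
  rw [norm_lqFun, Pi.add_apply, lqFun, lqFun, ← Complex.ofReal_add, Complex.norm_real,
    Real.norm_of_nonneg (by positivity), ← ENNReal.toReal_add h1.ne h2.ne]
  exact ENNReal.toReal_mono (ENNReal.add_lt_top.2 ⟨h1, h2⟩).ne h3

theorem predualSeqENorm_smul_le (h : PredualIndex n p ρ) (hq : 1 < q) (c : ℂ) (f : FunSeq n) :
    predualSeqENorm p q ρ (c • f) ≤ ‖c‖ₑ * predualSeqENorm p q ρ f := by
  refine (predualFunENorm_mono h (measurable_lqFun q _).aestronglyMeasurable ?_).trans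
    (predualFunENorm_const_mul_le h c (lqFun q f))
  filter_upwards [lqNorm_smul hq c f] with x hx
  rw [norm_mul, norm_lqFun, norm_lqFun, hx, ENNReal.toReal_mul, toReal_enorm]

theorem predualSeqENorm_smul (h : PredualIndex n p ρ) (hq : 1 < q) (c : ℂ) (f : FunSeq n) :
    predualSeqENorm p q ρ (c • f) = ‖c‖ₑ * predualSeqENorm p q ρ f := by
  refine le_antisymm (predualSeqENorm_smul_le h hq c f) ?_
  rcases eq_or_ne c 0 with rfl | hc
  · simp
  have h := predualSeqENorm_smul_le h hq c⁻¹ (c • f)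
  rw [inv_smul_smul₀ hc, enorm_inv hc] at h
  calc _ ≤ ‖c‖ₑ * (‖c‖ₑ⁻¹ * predualSeqENorm p q ρ (c • f)) := mul_le_mul_right h _
    _ = _ := by rw [← mul_assoc, ENNReal.mul_inv_cancel (by simpa using hc) (by simp), one_mul]

theorem predualSeqENorm_zero (h : PredualIndex n p ρ) (hq : 1 < q) :
    predualSeqENorm p q ρ (0 : FunSeq n) = 0 := by
  have := predualSeqENorm_smul h hq 0 (0 : FunSeq n)
  rw [show (0 : ℂ) • (0 : FunSeq n) = 0 from smul_zero (A := FunSeq n) (0 : ℂ)] at this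
  simpa using this

/-- The vector-valued predual Morrey space `H^ρ L_p(ℓ_q)`: all sequences of functions in
`H^ρ L_p` whose pointwise `ℓ_q` norm is (finite almost everywhere and) in `H^ρ L_p`. -/
def PredualSeq (n : ℕ) (p q ρ : ℝ) (h : PredualIndex n p ρ) (hq : 1 < q) :
    Submodule ℂ (FunSeq n) where
  carrier := {g | (∀ j, MemPredual p ρ (g j)) ∧ (∀ᵐ x, lqNorm q g x < ⊤) ∧
    MemPredual p ρ (lqFun q g)}
  zero_mem' := by
    have h1 : ∀ᵐ x, lqNorm q (0 : FunSeq n) x < ⊤ :=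
      (lqNorm_zero hq).mono fun x hx => by simp [hx]
    have h2 : predualSeqENorm p q ρ (0 : FunSeq n) < ⊤ := by simp [predualSeqENorm_zero h hq]
    exact ⟨memPredual_component h hq h1 h2, h1, (memPredual_iff h).2 h2⟩
  add_mem' := by
    intro f g hf hg
    have h1 : ∀ᵐ x, lqNorm q (f + g) x < ⊤ := by
      filter_upwards [hf.2.1, hg.2.1, lqNorm_add_le hq f g] with x a b c
      exact c.trans_lt (ENNReal.add_lt_top.2 ⟨a, b⟩)
    have h2 : predualSeqENorm p q ρ (f + g) < ⊤ :=
      (predualSeqENorm_add_le h hq hf.2.1 hg.2.1).trans_lt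
        (ENNReal.add_lt_top.2 ⟨(memPredual_iff h).1 hf.2.2, (memPredual_iff h).1 hg.2.2⟩)
    exact ⟨memPredual_component h hq h1 h2, h1, (memPredual_iff h).2 h2⟩
  smul_mem' := by
    intro c f hf
    have h1 : ∀ᵐ x, lqNorm q (c • f) x < ⊤ := by
      filter_upwards [hf.2.1, lqNorm_smul hq c f] with x a b
      rw [b]; exact ENNReal.mul_lt_top (by simp) a
    have h2 : predualSeqENorm p q ρ (c • f) < ⊤ :=
      (predualSeqENorm_smul_le h hq c f).trans_lt
        (ENNReal.mul_lt_top (by simp) ((memPredual_iff h).1 hf.2.2))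
    exact ⟨memPredual_component h hq h1 h2, h1, (memPredual_iff h).2 h2⟩

variable {h : PredualIndex n p ρ}

theorem PredualSeq.enorm_lt_top (g : PredualSeq n p q ρ h hq) :
    predualSeqENorm p q ρ g.1 < ⊤ := (memPredual_iff h).1 g.2.2.2

instance : Norm (PredualSeq n p q ρ h hq) := ⟨fun g => (predualSeqENorm p q ρ g.1).toReal⟩

theorem predualSeq_core : NormedSpace.Core ℂ (PredualSeq n p q ρ h hq) where
  norm_nonneg _ := ENNReal.toReal_nonneg
  norm_smul c f := by
    change (predualSeqENorm p q ρ (c • f.1)).toReal = _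
    rw [predualSeqENorm_smul h hq, ENNReal.toReal_mul]
    simp [Norm.norm]
  norm_triangle f g := by
    change (predualSeqENorm p q ρ (f.1 + g.1)).toReal ≤
      (predualSeqENorm p q ρ f.1).toReal + (predualSeqENorm p q ρ g.1).toReal
    rw [← ENNReal.toReal_add (PredualSeq.enorm_lt_top f).ne (PredualSeq.enorm_lt_top g).ne]
    exact ENNReal.toReal_mono (ENNReal.add_lt_top.2 ⟨(PredualSeq.enorm_lt_top f), (PredualSeq.enorm_lt_top g)⟩).ne
      (predualSeqENorm_add_le h hq f.2.2.1 g.2.2.1)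
  norm_eq_zero_iff f := by
    change (predualSeqENorm p q ρ f.1).toReal = 0 ↔ _
    constructor
    · intro h0
      rcases (ENNReal.toReal_eq_zero_iff _).1 h0 with h0 | h0
      · refine Subtype.ext (eq_zero_of_lqNorm hq f.1 ?_)
        filter_upwards [ae_zero_of_predualFunENorm h h0, f.2.2.1] with x hx hx'
        have h3 := norm_lqFun q f.1 x
        rw [hx, Pi.zero_apply, norm_zero] at h3
        exact ((ENNReal.toReal_eq_zero_iff _).1 h3.symm).resolve_right hx'.ne
      · exact absurd h0 (PredualSeq.enorm_lt_top f).ne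
    · rintro rfl
      simp [predualSeqENorm_zero h hq]

instance : NormedAddCommGroup (PredualSeq n p q ρ h hq) := NormedAddCommGroup.ofCore predualSeq_core

instance : NormedSpace ℂ (PredualSeq n p q ρ h hq) := NormedSpace.ofCore predualSeq_core

/-- The norm of a sequence of functions in the Lebesgue space `L_u(ℓ_q)`, with values
in `[0, ∞]`. -/
def lebesgueSeqENorm (u q : ℝ) (f : FunSeq n) : ℝ≥0∞ :=
  eLpNorm (lqNorm q f) (ENNReal.ofReal u) volume

/-- The pairing `∫ ∑ g_j f_j` of two sequences of functions. -/
def pairing (g f : FunSeq n) : ℂ := ∫ x, ∑' j, g j x * f j x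

/-- The series `∑ g_j f_j` converges absolutely almost everywhere and its sum is integrable, so
that `pairing g f` is an honest integral. -/
def PairingConverges (g f : FunSeq n) : Prop :=
  (∀ᵐ x, Summable fun j => ‖g j x * f j x‖) ∧
    Integrable (fun x => ∑' j, g j x * f j x) volume

/-- If `1 / p + 1 / p' = 1`, `-n / p < r < 0` and `r + ρ = -n`, then `1 < p' < ∞` and
`-n < ρ < -n / p'`. -/
theorem predualIndex_of_holderConjugate {p' : ℝ} (hp : p.HolderConjugate p')
    (hr : -(n : ℝ) / p < r) (hr0 : r < 0) (hrρ : r + ρ = -(n : ℝ)) : PredualIndex n p' ρ := by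
  refine ⟨hp.symm.lt, by linarith, ?_⟩
  have h1 := hp.inv_add_inv_eq_one
  have h2 : -(n : ℝ) / p + -(n : ℝ) / p' = -n := by
    rw [div_eq_mul_inv, div_eq_mul_inv, ← mul_add, h1, mul_one]
  linarith

end

end MorreyDuality

open MorreyDuality

/-!
Hölder's inequality on each cube, applied to an atomic decomposition of `g`, bounds the pairing by
`‖g‖ ‖f‖`.

Conversely, restricting `f` to all dyadic cubes `Q_i` embeds `L_p^r(ℓ_q)` isometrically into the
weighted `ℓ_∞`-sum, with weights `w_i`, of the spaces `L_p(Q_i; ℓ_q)`. By Hahn–Banach a functional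
`G` extends with the same norm to this sum. The extension restricted to the `i`-th summand has a
density `g_i`, and testing it on finitely many Hölder extremals at once gives
`∑ w_i⁻¹ ‖g_i‖ ≤ ‖G‖`, norms being taken in `L_{p'}(Q_i; ℓ_{q'})`. As each `|g_i|_{q'}` is a
multiple of an atom, `g = ∑ g_i` has predual norm at most `‖G‖`. A functional on an `ℓ_∞`-sum need
not be the sum of its entries, but for a test sequence `f` the weighted norms over `Q_i` tend to
zero along the cofinite filter: over small cubes since `r < 0`, over large cubes since
`n / p + r > 0`, and over distant cubes of a fixed size since they miss the support. Hence
`G f = ∑ ∫_{Q_i} g_i f = ∫ g f` for these `f`, which are dense.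
-/

namespace MorreyDuality

/-! ### Inequalities for sequences and integrals in `[0, ∞]` -/

section Inequalities

variable {ι κ α : Type*} {p q : ℝ}

theorem tsum_mul_le_Lp_mul_Lq (hpq : p.HolderConjugate q) (a b : ι → ℝ≥0∞) :
    ∑' i, a i * b i ≤ (∑' i, a i ^ p) ^ (1 / p) * (∑' i, b i ^ q) ^ (1 / q) := by
  have hp := hpq.pos
  have hq := hpq.symm.pos
  rw [ENNReal.tsum_eq_iSup_sum]
  refine iSup_le fun s => (ENNReal.inner_le_Lp_mul_Lq s a b hpq).trans ?_
  gcongr <;> exact ENNReal.sum_le_tsum s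

theorem Lp_add_le_tsum (hp : 1 ≤ p) (a b : ι → ℝ≥0∞) :
    (∑' i, (a i + b i) ^ p) ^ (1 / p) ≤ (∑' i, a i ^ p) ^ (1 / p) + (∑' i, b i ^ p) ^ (1 / p) := by
  have hp0 : 0 < p := by linarith
  rw [one_div, ENNReal.rpow_inv_le_iff hp0, ENNReal.tsum_eq_iSup_sum]
  refine iSup_le fun s => ?_
  rw [← ENNReal.rpow_inv_le_iff hp0, ← one_div]
  refine (ENNReal.Lp_add_le s a b hp).trans ?_
  gcongr <;> exact ENNReal.sum_le_tsum s

theorem Lp_sum_le_sum_Lp (hp : 1 ≤ p) (a : κ → ι → ℝ≥0∞) (s : Finset κ) :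
    (∑' i, (∑ k ∈ s, a k i) ^ p) ^ (1 / p) ≤ ∑ k ∈ s, (∑' i, a k i ^ p) ^ (1 / p) := by
  classical
  have hp0 : 0 < p := by linarith
  induction s using Finset.induction_on with
  | empty => simp [hp0]
  | insert k s hk ih =>
    simp only [Finset.sum_insert hk]
    exact (Lp_add_le_tsum hp _ _).trans (by gcongr)

theorem Lp_tsum_le_tsum_Lp (hp : 1 ≤ p) (a : κ → ι → ℝ≥0∞) :
    (∑' i, (∑' k, a k i) ^ p) ^ (1 / p) ≤ ∑' k, (∑' i, a k i ^ p) ^ (1 / p) := by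
  have hp0 : 0 < p := by linarith
  rw [one_div, ENNReal.rpow_inv_le_iff hp0, ENNReal.tsum_eq_iSup_sum]
  refine iSup_le fun t => ?_
  have hlim : Tendsto (fun s : Finset κ => ∑ i ∈ t, (∑ k ∈ s, a k i) ^ p) atTop
      (𝓝 (∑ i ∈ t, (∑' k, a k i) ^ p)) :=
    tendsto_finsetSum _ fun i _ =>
      (ENNReal.continuous_rpow_const.tendsto _).comp ENNReal.summable.hasSum
  refine le_of_tendsto' hlim fun s => ?_
  rw [← ENNReal.rpow_inv_le_iff hp0, ← one_div]
  refine le_trans ?_ ((Lp_sum_le_sum_Lp hp a s).trans (ENNReal.sum_le_tsum s))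
  gcongr
  exact ENNReal.sum_le_tsum t

theorem Lp_le_tsum (hp : 1 ≤ p) (a : ι → ℝ≥0∞) : (∑' i, a i ^ p) ^ (1 / p) ≤ ∑' i, a i := by
  rw [one_div, ENNReal.rpow_inv_le_iff (by linarith)]
  have hsplit (x : ℝ≥0∞) : x ^ p = x * x ^ (p - 1) := by
    conv_lhs => rw [← add_sub_cancel 1 p,
      ENNReal.rpow_add_of_nonneg _ _ zero_le_one (by linarith), ENNReal.rpow_one]
  simp only [hsplit]
  rw [← ENNReal.tsum_mul_right]
  gcongr with i
  exact ENNReal.le_tsum i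

theorem enorm_ofReal_toReal {t : ℝ≥0∞} (ht : t ≠ ⊤) : ‖(t.toReal : ℂ)‖ₑ = t := by
  rw [← ofReal_norm, Complex.norm_real, Real.norm_of_nonneg ENNReal.toReal_nonneg,
    ENNReal.ofReal_toReal ht]

variable [MeasurableSpace α] {μ : Measure α}

theorem eLpNorm_ofReal_eq_lintegral {ε : Type*} [TopologicalSpace ε] [ContinuousENorm ε]
    (hp : 0 < p) (f : α → ε) :
    eLpNorm f (ENNReal.ofReal p) μ = (∫⁻ x, ‖f x‖ₑ ^ p ∂μ) ^ (1 / p) := by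
  rw [eLpNorm_eq_lintegral_rpow_enorm_toReal (by simpa using hp) ENNReal.ofReal_ne_top,
    ENNReal.toReal_ofReal hp.le]

theorem ae_lt_top_of_eLpNorm_ne_top (hp : 0 < p) {k : α → ℝ≥0∞} (hk : Measurable k)
    (hk' : eLpNorm k (ENNReal.ofReal p) μ ≠ ⊤) : ∀ᵐ x ∂μ, k x < ⊤ := by
  rw [eLpNorm_ofReal_eq_lintegral hp, ne_eq, ENNReal.rpow_eq_top_iff_of_pos (by positivity)] at hk'
  filter_upwards [ae_lt_top (hk.enorm.pow_const p) hk'] with x hx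
  exact (ENNReal.rpow_lt_top_iff_of_pos hp).1 hx

theorem lintegral_enorm_mul_le_eLpNorm_mul_eLpNorm {ε : Type*} [TopologicalSpace ε]
    [ContinuousENorm ε] (hpq : p.HolderConjugate q) {f : α → ε} {F : α → ℝ≥0∞}
    (hf : AEStronglyMeasurable f μ) (hF : AEMeasurable F μ) :
    ∫⁻ x, ‖f x‖ₑ * F x ∂μ ≤
      eLpNorm f (ENNReal.ofReal p) μ * eLpNorm F (ENNReal.ofReal q) μ := by
  rw [eLpNorm_ofReal_eq_lintegral hpq.pos, eLpNorm_ofReal_eq_lintegral hpq.symm.pos]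
  exact ENNReal.lintegral_mul_le_Lp_mul_Lq μ hpq hf.enorm hF

theorem lintegral_enorm_mul_le_of_support {ε : Type*} [TopologicalSpace ε] [ESeminormedAddMonoid ε]
    (hpq : p.HolderConjugate q) {s : Set α} (hs : MeasurableSet s) {f : α → ε} {F : α → ℝ≥0∞}
    (hf : AEStronglyMeasurable f μ) (hfs : ∀ᵐ x ∂μ, x ∉ s → f x = 0) (hF : AEMeasurable F μ) :
    ∫⁻ x, ‖f x‖ₑ * F x ∂μ ≤
      eLpNorm f (ENNReal.ofReal p) μ * eLpNorm F (ENNReal.ofReal q) (μ.restrict s) := by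
  have hrestrict : ∫⁻ x, ‖f x‖ₑ * F x ∂μ = ∫⁻ x in s, ‖f x‖ₑ * F x ∂μ := by
    rw [← lintegral_indicator hs]
    refine lintegral_congr_ae ?_
    filter_upwards [hfs] with x hx
    by_cases hxs : x ∈ s
    · simp [hxs]
    · simp [hxs, hx hxs]
  rw [hrestrict]
  refine (lintegral_enorm_mul_le_eLpNorm_mul_eLpNorm hpq hf.restrict hF.restrict).trans ?_
  gcongr
  exact Measure.restrict_le_self

end Inequalities

/-! ### Densities of functionals on Lebesgue spaces over finite measures -/

section Density

variable {α : Type*} [MeasurableSpace α] {ν : Measure α} [IsFiniteMeasure ν] {P : ℝ≥0∞}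

theorem sum_indicatorConstLp_one (P : ℝ≥0∞) {s : ℕ → Set α} (hs : ∀ i, MeasurableSet (s i))
    (hd : Pairwise (Function.onFun Disjoint s)) (t : Finset ℕ) :
    ∑ i ∈ t, indicatorConstLp P (hs i) (measure_ne_top ν _) (1 : ℂ) =
      indicatorConstLp P (t.measurableSet_biUnion fun i _ => hs i) (measure_ne_top ν _) 1 := by
  refine Lp.ext ((Lp.coeFn_fun_finsetSum t _).trans ?_)
  have hind : ∀ᵐ x ∂ν, ∀ i, indicatorConstLp P (hs i) (measure_ne_top ν _) (1 : ℂ) x =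
      (s i).indicator (fun _ => 1) x := ae_all_iff.2 fun i => indicatorConstLp_coeFn
  filter_upwards [hind, indicatorConstLp_coeFn (p := P) (c := (1 : ℂ))
    (hs := t.measurableSet_biUnion fun i _ => hs i) (hμs := measure_ne_top ν _)] with x hx hx'
  rw [hx', Finset.indicator_biUnion_apply t s fun i _ j _ hij => hd hij]
  exact Finset.sum_congr rfl fun i _ => hx i

theorem tendsto_measure_symmDiff_biUnion_iUnion {s : ℕ → Set α} (hs : ∀ i, MeasurableSet (s i))
    (hd : Pairwise (Function.onFun Disjoint s)) :
    Tendsto (fun t : Finset ℕ => ν (symmDiff (⋃ i ∈ t, s i) (⋃ i, s i))) atTop (𝓝 0) := by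
  have hsub (t : Finset ℕ) : (⋃ i ∈ t, s i) ⊆ ⋃ i, s i :=
    Set.iUnion₂_subset fun i _ => Set.subset_iUnion s i
  have hdiff (t : Finset ℕ) : ν (symmDiff (⋃ i ∈ t, s i) (⋃ i, s i)) =
      ∑' i, ν (s i) - ∑ i ∈ t, ν (s i) := by
    rw [symmDiff_of_le (hsub t), measure_sdiff (hsub t)
      (t.measurableSet_biUnion fun i _ => hs i).nullMeasurableSet (measure_ne_top _ _),
      measure_biUnion_finset (fun i _ j _ hij => hd hij) fun i _ => hs i, measure_iUnion hd hs]
  have htop : ∑' i, ν (s i) ≠ ⊤ := measure_iUnion hd hs ▸ measure_ne_top ν _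
  simp only [hdiff]
  simpa only [tsub_self, SummationFilter.unconditional_filter] using
    ENNReal.Tendsto.sub tendsto_const_nhds (ENNReal.summable (f := fun i => ν (s i))).hasSum
      (Or.inl htop)

/-- The set function `s ↦ 1_s` with values in `L_P`. Composing it with a functional on `L_P` gives
the complex measure to which the Radon–Nikodym theorem applies. -/
noncomputable def indicatorVectorMeasure (ν : Measure α) [IsFiniteMeasure ν] [Fact (1 ≤ P)]
    (hP : P ≠ ⊤) : VectorMeasure α (Lp ℂ P ν) := by
  classical
  exact {
    measureOf' := fun s =>
      if hs : MeasurableSet s then indicatorConstLp P hs (measure_ne_top ν s) 1 else 0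
    empty' := by simp only [MeasurableSet.empty, dif_pos, indicatorConstLp_empty]
    not_measurable' := fun s hs => dif_neg hs
    m_iUnion' := fun s hs hd => by
      simp only [hs, MeasurableSet.iUnion hs, dif_pos, HasSum, sum_indicatorConstLp_one P hs hd]
      exact tendsto_indicatorConstLp_set hP (tendsto_measure_symmDiff_biUnion_iUnion hs hd) }

theorem indicatorVectorMeasure_apply [Fact (1 ≤ P)] (hP : P ≠ ⊤) {s : Set α}
    (hs : MeasurableSet s) :
    indicatorVectorMeasure ν hP s = indicatorConstLp P hs (measure_ne_top ν s) 1 :=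
  dif_pos hs

theorem indicatorVectorMeasure_absolutelyContinuous [Fact (1 ≤ P)] (hP : P ≠ ⊤) :
    indicatorVectorMeasure ν hP ≪ᵥ ν.toENNRealVectorMeasure := by
  refine VectorMeasure.AbsolutelyContinuous.mk fun s hs hνs => ?_
  rw [Measure.toENNRealVectorMeasure_apply_measurable hs] at hνs
  rw [indicatorVectorMeasure_apply hP hs]
  refine Lp.ext (indicatorConstLp_coeFn.trans ?_)
  filter_upwards [Lp.coeFn_zero ℂ P ν, measure_eq_zero_iff_ae_notMem.1 hνs] with x hx hxs
  rw [Set.indicator_of_notMem hxs, hx, Pi.zero_apply]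

theorem withDensityᵥ_complexMeasure_rnDeriv {m : ComplexMeasure α}
    (hm : m ≪ᵥ ν.toENNRealVectorMeasure) : ν.withDensityᵥ (m.rnDeriv ν) = m := by
  obtain ⟨hre, him⟩ := (ComplexMeasure.absolutelyContinuous_ennreal_iff _ _).1 hm
  refine VectorMeasure.ext fun s hs => ?_
  rw [withDensityᵥ_apply (m.integrable_rnDeriv ν) hs]
  have hint : IntegrableOn (m.rnDeriv ν) s ν := (m.integrable_rnDeriv ν).integrableOn
  refine Complex.ext ?_ ?_
  · calc (∫ x in s, m.rnDeriv ν x ∂ν).re = ∫ x in s, m.re.rnDeriv ν x ∂ν :=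
          (integral_re hint).symm
      _ = m.re s := by
          rw [← withDensityᵥ_apply (SignedMeasure.integrable_rnDeriv _ _) hs,
            SignedMeasure.withDensityᵥ_rnDeriv_eq _ _ hre]
  · calc (∫ x in s, m.rnDeriv ν x ∂ν).im = ∫ x in s, m.im.rnDeriv ν x ∂ν :=
          (integral_im hint).symm
      _ = m.im s := by
          rw [← withDensityᵥ_apply (SignedMeasure.integrable_rnDeriv _ _) hs,
            SignedMeasure.withDensityᵥ_rnDeriv_eq _ _ him]

theorem measurable_complexMeasure_rnDeriv (m : ComplexMeasure α) (ν : Measure α) :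
    Measurable (m.rnDeriv ν) :=
  measurable_of_re_im (SignedMeasure.measurable_rnDeriv m.re ν)
    (SignedMeasure.measurable_rnDeriv m.im ν)

theorem exists_integral_eq_indicatorConstLp [Fact (1 ≤ P)] (hP : P ≠ ⊤)
    (Λ : Lp ℂ P ν →L[ℂ] ℂ) :
    ∃ g : α → ℂ, Measurable g ∧ Integrable g ν ∧ ∀ (s : Set α) (hs : MeasurableSet s),
      Λ (indicatorConstLp P hs (measure_ne_top ν s) 1) = ∫ x in s, g x ∂ν := by
  let m : ComplexMeasure α :=
    (indicatorVectorMeasure ν hP).mapRange (Λ : Lp ℂ P ν →+ ℂ) Λ.continuous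
  have hΛ (s : Set α) : m s = Λ (indicatorVectorMeasure ν hP s) := rfl
  have hm : m ≪ᵥ ν.toENNRealVectorMeasure := fun s hs => by
    rw [hΛ, indicatorVectorMeasure_absolutelyContinuous hP hs, map_zero]
  refine ⟨m.rnDeriv ν, measurable_complexMeasure_rnDeriv m ν, m.integrable_rnDeriv ν,
    fun s hs => ?_⟩
  rw [← withDensityᵥ_apply (m.integrable_rnDeriv ν) hs, withDensityᵥ_complexMeasure_rnDeriv hm, hΛ,
    indicatorVectorMeasure_apply hP hs]

theorem toLp_simpleFunc_eq_integral {Λ : Lp ℂ P ν →ₗ[ℂ] ℂ} {g : α → ℂ} (hg : Integrable g ν)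
    (hΛ : ∀ (s : Set α) (hs : MeasurableSet s),
      Λ (indicatorConstLp P hs (measure_ne_top ν s) 1) = ∫ x in s, g x ∂ν)
    (f : SimpleFunc α ℂ) :
    Λ ((f.memLp_of_isFiniteMeasure P ν).toLp f) = ∫ x, g x * f x ∂ν := by
  have hint (f : SimpleFunc α ℂ) : Integrable (fun x => g x * f x) ν := by
    obtain ⟨C, hC⟩ := f.exists_forall_norm_le
    exact hg.mul_bdd (c := C) f.aestronglyMeasurable (Eventually.of_forall hC)
  induction f using SimpleFunc.induction with
  | @const c s hs =>
    have hsmul : (SimpleFunc.memLp_of_isFiniteMeasure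
        (.piecewise s hs (.const α c) (.const α 0)) P ν).toLp _ =
        c • indicatorConstLp P hs (measure_ne_top ν s) (1 : ℂ) := by
      refine Lp.ext ((MemLp.coeFn_toLp _).trans ?_)
      filter_upwards [Lp.coeFn_smul c (indicatorConstLp P hs (measure_ne_top ν s) (1 : ℂ)),
        indicatorConstLp_coeFn (p := P) (hs := hs) (hμs := measure_ne_top ν s) (c := (1 : ℂ))]
        with x hx hx'
      rw [hx, Pi.smul_apply, hx']
      by_cases hxs : x ∈ s <;> simp [hxs]
    rw [hsmul, map_smul, hΛ s hs, smul_eq_mul, ← integral_const_mul, ← integral_indicator hs]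
    congr with x
    by_cases hxs : x ∈ s <;> simp [hxs, mul_comm]
  | @add f f' _ hf hf' =>
    have hadd : ((f + f').memLp_of_isFiniteMeasure P ν).toLp _ =
      (f.memLp_of_isFiniteMeasure P ν).toLp f + (f'.memLp_of_isFiniteMeasure P ν).toLp f' := rfl
    rw [hadd, map_add, hf, hf', ← integral_add (hint f) (hint f')]
    simp only [SimpleFunc.coe_add, Pi.add_apply, mul_add]

theorem exists_integral_eq_of_continuousLinearMap [Fact (1 ≤ P)] (hP : P ≠ ⊤)
    (Λ : Lp ℂ P ν →L[ℂ] ℂ) :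
    ∃ g : α → ℂ, Measurable g ∧ Integrable g ν ∧ ∀ (f : α → ℂ) (hf : MemLp f P ν) (M : ℝ),
      Measurable f → (∀ x, ‖f x‖ ≤ M) → Λ (hf.toLp f) = ∫ x, g x * f x ∂ν := by
  obtain ⟨g, hg, hgi, hΛ⟩ := exists_integral_eq_indicatorConstLp hP Λ
  refine ⟨g, hg, hgi, fun f hf M hfm hM => ?_⟩
  let F (k : ℕ) : SimpleFunc α ℂ := SimpleFunc.approxOn f hfm (Set.range f ∪ {0}) 0 (by simp) k
  have hF (k : ℕ) (x : α) : ‖F k x‖ ≤ M + M :=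
    (SimpleFunc.norm_approxOn_zero_le hfm _ x k).trans (add_le_add (hM x) (hM x))
  have hΛF : Tendsto (fun k => Λ (((F k).memLp_of_isFiniteMeasure P ν).toLp (F k))) atTop
      (𝓝 (Λ (hf.toLp f))) :=
    (Λ.continuous.tendsto _).comp (SimpleFunc.tendsto_approxOn_range_Lp hP hfm hf)
  have hintF : Tendsto (fun k => ∫ x, g x * F k x ∂ν) atTop (𝓝 (∫ x, g x * f x ∂ν)) := by
    refine tendsto_integral_of_dominated_convergence (fun x => ‖g x‖ * (M + M))
      (fun k => (hg.mul (F k).measurable).aestronglyMeasurable) (hgi.norm.mul_const _)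
      (fun k => Eventually.of_forall fun x => ?_) (Eventually.of_forall fun x => ?_)
    · rw [norm_mul]
      exact mul_le_mul_of_nonneg_left (hF k x) (norm_nonneg _)
    · exact (SimpleFunc.tendsto_approxOn hfm _ (subset_closure (by simp))).const_mul _
  refine tendsto_nhds_unique hΛF (hintF.congr fun k => ?_)
  exact (toLp_simpleFunc_eq_integral (Λ := Λ.toLinearMap) hgi hΛ (F k)).symm

end Density

/-! ### Extremal functions for the duality of mixed Lebesgue norms -/

section Extremal

variable {α : Type*} [MeasurableSpace α] {ν : Measure α} {p p' q q' : ℝ}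

/-- The norm of a sequence of functions in the mixed Lebesgue space `L_p(ν; ℓ_q)`, allowed to be
infinite. -/
noncomputable def mixedENorm (p q : ℝ) (ν : Measure α) (f : ℕ → α → ℂ) : ℝ≥0∞ :=
  eLpNorm (fun x => (∑' j, ‖f j x‖ₑ ^ q) ^ (1 / q)) (ENNReal.ofReal p) ν

theorem mixedENorm_eq_lintegral (hp : 0 < p) (q : ℝ) (ν : Measure α) (f : ℕ → α → ℂ) :
    mixedENorm p q ν f = (∫⁻ x, (∑' j, ‖f j x‖ₑ ^ q) ^ (p / q) ∂ν) ^ (1 / p) := by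
  rw [mixedENorm, eLpNorm_ofReal_eq_lintegral hp]
  simp only [enorm_eq_self, ← ENNReal.rpow_mul, one_div_mul_eq_div]

theorem mixedENorm_const_mul (hp : 0 < p) (hq : 0 < q) (c : ℂ) (f : ℕ → α → ℂ) :
    mixedENorm p q ν (fun j x => c * f j x) = ‖c‖ₑ * mixedENorm p q ν f := by
  have hpt (x : α) : (∑' j, ‖c * f j x‖ₑ ^ q) ^ (p / q) =
      ‖c‖ₑ ^ p * (∑' j, ‖f j x‖ₑ ^ q) ^ (p / q) := by
    simp only [enorm_mul, ENNReal.mul_rpow_of_nonneg _ _ hq.le, ENNReal.tsum_mul_left]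
    rw [ENNReal.mul_rpow_of_nonneg _ _ (by positivity), ← ENNReal.rpow_mul,
      mul_div_cancel₀ p hq.ne']
  simp only [mixedENorm_eq_lintegral hp, hpt]
  rw [lintegral_const_mul' _ _ (ENNReal.rpow_ne_top_of_nonneg hp.le enorm_ne_top),
    ENNReal.mul_rpow_of_nonneg _ _ (by positivity), ← ENNReal.rpow_mul, mul_one_div_cancel hp.ne',
    ENNReal.rpow_one]

theorem tsum_enorm_rpow (hq : 0 ≤ q) {z : ℕ → ℂ} (hz : Summable fun j => ‖z j‖ ^ q) :
    ∑' j, ‖z j‖ₑ ^ q = ENNReal.ofReal (∑' j, ‖z j‖ ^ q) := by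
  rw [ENNReal.ofReal_tsum_of_nonneg (fun j => by positivity) hz]
  simp only [← ENNReal.ofReal_rpow_of_nonneg (norm_nonneg _) hq, ofReal_norm]

/-- The extremal sequence `z_j ↦ ‖z‖^(p' - q') |z_j|^(q' - 2) conj z_j`, with the norm of `ℓ_q'`, in
Hölder's inequality for `ℓ_q'`. The scaling by the power of the norm makes it extremal for the
mixed norm with exponents `p'` and `q'` as well. -/
noncomputable def extremalSeq (p' q' : ℝ) (z : ℕ → ℂ) (j : ℕ) : ℂ :=
  ((‖z j‖ ^ (q' - 2) * (∑' i, ‖z i‖ ^ q') ^ (p' / q' - 1) : ℝ) : ℂ) * starRingEnd ℂ (z j)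

theorem extremalSeq_of_eq_zero (p' q' : ℝ) {z : ℕ → ℂ} {j : ℕ} (hj : z j = 0) :
    extremalSeq p' q' z j = 0 := by
  rw [extremalSeq, hj, map_zero, mul_zero]

theorem tsum_mul_extremalSeq (hp' : 0 < p') (hq' : 0 < q') (z : ℕ → ℂ) :
    ∑' j, z j * extremalSeq p' q' z j = (((∑' j, ‖z j‖ ^ q') ^ (p' / q') : ℝ) : ℂ) := by
  have hterm (j : ℕ) : z j * extremalSeq p' q' z j =
      ((‖z j‖ ^ q' * (∑' i, ‖z i‖ ^ q') ^ (p' / q' - 1) : ℝ) : ℂ) := by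
    have hpow : ‖z j‖ ^ q' = ‖z j‖ ^ 2 * ‖z j‖ ^ (q' - 2) := by
      rw [← Real.rpow_two, ← Real.rpow_add' (norm_nonneg _) (by simpa using hq'.ne'),
        add_sub_cancel]
    rw [extremalSeq, mul_left_comm, Complex.mul_conj, Complex.normSq_eq_norm_sq, hpow]
    push_cast
    ring
  have hexp : 1 + (p' / q' - 1) ≠ 0 := by simpa using (div_pos hp' hq').ne'
  rw [tsum_congr hterm, ← Complex.ofReal_tsum, tsum_mul_right,
    ← Real.rpow_one_add' (tsum_nonneg fun j => by positivity) hexp, add_sub_cancel]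

theorem norm_extremalSeq (hq' : 1 < q') (z : ℕ → ℂ) (j : ℕ) :
    ‖extremalSeq p' q' z j‖ = ‖z j‖ ^ (q' - 1) * (∑' i, ‖z i‖ ^ q') ^ (p' / q' - 1) := by
  have hS : 0 ≤ ∑' i, ‖z i‖ ^ q' := tsum_nonneg fun i => by positivity
  have hpow : ‖z j‖ ^ (q' - 1) = ‖z j‖ ^ (q' - 2) * ‖z j‖ := by
    rw [← Real.rpow_add_one' (norm_nonneg _) (by linarith)]
    ring_nf
  rw [extremalSeq, norm_mul, RCLike.norm_conj, Complex.norm_real,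
    Real.norm_of_nonneg (mul_nonneg (by positivity) (Real.rpow_nonneg hS _)), hpow]
  ring

theorem summable_norm_extremalSeq_rpow (hq : q.HolderConjugate q') {z : ℕ → ℂ}
    (hz : Summable fun j => ‖z j‖ ^ q') : Summable fun j => ‖extremalSeq p' q' z j‖ ^ q := by
  simp only [norm_extremalSeq hq.symm.lt, Real.mul_rpow (Real.rpow_nonneg (norm_nonneg _) _)
    (Real.rpow_nonneg (tsum_nonneg fun j => Real.rpow_nonneg (norm_nonneg (z j)) _) _),
    ← Real.rpow_mul (norm_nonneg _), hq.symm.sub_one_mul_conj]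
  exact hz.mul_right _

theorem tsum_norm_extremalSeq_rpow (hp' : 1 < p') (hq : q.HolderConjugate q') (z : ℕ → ℂ) :
    ∑' j, ‖extremalSeq p' q' z j‖ ^ q = (∑' j, ‖z j‖ ^ q') ^ ((p' - 1) * (q - 1)) := by
  have hS : 0 ≤ ∑' j, ‖z j‖ ^ q' := tsum_nonneg fun j => by positivity
  have hterm (j : ℕ) : ‖extremalSeq p' q' z j‖ ^ q =
      ‖z j‖ ^ q' * (∑' i, ‖z i‖ ^ q') ^ ((p' / q' - 1) * q) := by
    rw [norm_extremalSeq hq.symm.lt, Real.mul_rpow (by positivity) (by positivity),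
      ← Real.rpow_mul (norm_nonneg _), ← Real.rpow_mul hS, hq.symm.sub_one_mul_conj]
  have hexp : 1 + (p' / q' - 1) * q = (p' - 1) * (q - 1) := by
    have := hq.symm.pos.ne'
    have := hq.mul_eq_add
    field_simp
    linear_combination (-p') * this
  have hpos : 0 < (p' - 1) * (q - 1) := mul_pos (by linarith) hq.sub_one_pos
  rw [tsum_congr hterm, tsum_mul_right, ← Real.rpow_one_add' hS (hexp ▸ hpos.ne'), hexp]

theorem tsum_enorm_extremalSeq_rpow (hp : p.HolderConjugate p') (hq : q.HolderConjugate q')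
    {z : ℕ → ℂ} (hz : Summable fun j => ‖z j‖ ^ q') :
    (∑' j, ‖extremalSeq p' q' z j‖ₑ ^ q) ^ (p / q) = (∑' j, ‖z j‖ₑ ^ q') ^ (p' / q') := by
  have hS : 0 ≤ ∑' j, ‖z j‖ ^ q' := tsum_nonneg fun j => by positivity
  have hp0 := hp.pos
  have hp0' := hp.symm.pos
  have hq0 := hq.pos
  have hq0' := hq.symm.pos
  have hexp : (p' - 1) * (q - 1) * (p / q) = p' / q' := by
    rw [← hp.symm.div_conj_eq_sub_one, ← hq.div_conj_eq_sub_one]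
    field_simp
  rw [tsum_enorm_rpow hq0.le (summable_norm_extremalSeq_rpow hq hz), tsum_enorm_rpow hq0'.le hz,
    tsum_norm_extremalSeq_rpow hp.symm.lt hq,
    ENNReal.ofReal_rpow_of_nonneg (Real.rpow_nonneg hS _) (by positivity),
    ENNReal.ofReal_rpow_of_nonneg hS (by positivity), ← Real.rpow_mul hS, hexp]

theorem summable_norm_rpow_of_eq_zero (hq : 0 < q) {z : ℕ → ℂ} {N : ℕ}
    (hN : ∀ j, N ≤ j → z j = 0) : Summable fun j => ‖z j‖ ^ q :=
  summable_of_ne_finset_zero (s := Finset.range N) fun j hj => by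
    rw [hN j (not_lt.1 (Finset.mem_range.not.1 hj)), norm_zero, Real.zero_rpow hq.ne']

theorem norm_extremalSeq_le (hp' : 1 < p') (hq : q.HolderConjugate q') {z : ℕ → ℂ} {N : ℕ} {M : ℝ}
    (hN : ∀ j, N ≤ j → z j = 0) (hM : ∀ j, ‖z j‖ ≤ M) (j : ℕ) :
    ‖extremalSeq p' q' z j‖ ≤ (N * M ^ q') ^ ((p' - 1) * (q - 1) / q) := by
  have hq0' := hq.symm.pos
  have hM0 : 0 ≤ M := (norm_nonneg _).trans (hM 0)
  have hz := summable_norm_rpow_of_eq_zero hq0' hN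
  have hS : ∑' j, ‖z j‖ ^ q' ≤ N * M ^ q' := by
    rw [tsum_eq_sum (s := Finset.range N) fun j hj => by
      rw [hN j (not_lt.1 (Finset.mem_range.not.1 hj)), norm_zero, Real.zero_rpow hq0'.ne']]
    refine (Finset.sum_le_card_nsmul _ _ (M ^ q') fun j _ => ?_).trans_eq (by simp)
    exact Real.rpow_le_rpow (norm_nonneg _) (hM j) hq0'.le
  rw [div_eq_mul_inv, Real.rpow_mul (by positivity),
    Real.le_rpow_inv_iff_of_pos (norm_nonneg _) (by positivity) hq.pos]
  calc ‖extremalSeq p' q' z j‖ ^ q ≤ ∑' i, ‖extremalSeq p' q' z i‖ ^ q :=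
        (summable_norm_extremalSeq_rpow hq hz).le_tsum j fun _ _ => by positivity
    _ = (∑' i, ‖z i‖ ^ q') ^ ((p' - 1) * (q - 1)) := tsum_norm_extremalSeq_rpow hp' hq z
    _ ≤ (N * M ^ q') ^ ((p' - 1) * (q - 1)) :=
        Real.rpow_le_rpow (tsum_nonneg fun _ => by positivity) hS
          (mul_pos (by linarith) hq.sub_one_pos).le

/-- The functions on which functionals are tested: finitely many bounded functions in the unit ball
of `L_p(ν; ℓ_q)`, the others being zero. -/
structure IsAdmissible (p q : ℝ) (ν : Measure α) (N : ℕ) (f : ℕ → α → ℂ) : Prop where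
  measurable : ∀ j, Measurable (f j)
  bounded : ∃ M : ℝ, ∀ j x, ‖f j x‖ ≤ M
  eq_zero : ∀ j, N ≤ j → f j = 0
  norm_le : mixedENorm p q ν f ≤ 1

theorem measurable_extremalSeq {g : ℕ → α → ℂ} (hg : ∀ j, Measurable (g j)) (j : ℕ) :
    Measurable fun x => extremalSeq p' q' (fun j => g j x) j := by
  unfold extremalSeq
  fun_prop

theorem lintegral_tsum_enorm_rpow_ne_top [IsFiniteMeasure ν] (hp : 0 < p) (hq : 0 < q)
    {g : ℕ → α → ℂ} {N : ℕ} {M : ℝ} (hN : ∀ j, N ≤ j → g j = 0) (hM : ∀ j x, ‖g j x‖ ≤ M) :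
    ∫⁻ x, (∑' j, ‖g j x‖ₑ ^ q) ^ (p / q) ∂ν ≠ ⊤ := by
  have hbound (x : α) : (∑' j, ‖g j x‖ₑ ^ q) ^ (p / q) ≤ (N * ENNReal.ofReal M ^ q) ^ (p / q) := by
    rw [tsum_eq_sum (s := Finset.range N) fun j hj => by
      rw [hN j (not_lt.1 (Finset.mem_range.not.1 hj)), Pi.zero_apply, enorm_zero,
        ENNReal.zero_rpow_of_pos hq]]
    gcongr
    refine (Finset.sum_le_card_nsmul _ _ (ENNReal.ofReal M ^ q) fun j _ => ?_).trans_eq (by simp)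
    gcongr
    exact ofReal_norm (g j x) ▸ ENNReal.ofReal_le_ofReal (hM j x)
  refine ((lintegral_mono hbound).trans_lt ?_).ne
  rw [lintegral_const]
  finiteness

theorem sum_integral_mul_extremalSeq [IsFiniteMeasure ν] (hp' : 1 < p') (hq : q.HolderConjugate q')
    {g : ℕ → α → ℂ} (hg : ∀ j, Measurable (g j)) {N : ℕ} {M : ℝ} (hN : ∀ j, N ≤ j → g j = 0)
    (hM : ∀ j x, ‖g j x‖ ≤ M) :
    ∑ j ∈ Finset.range N, ∫ x, g j x * extremalSeq p' q' (fun j => g j x) j ∂ν =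
      (((∫⁻ x, (∑' j, ‖g j x‖ₑ ^ q') ^ (p' / q') ∂ν).toReal : ℝ) : ℂ) := by
  have hN' (x : α) (j : ℕ) (hj : N ≤ j) : g j x = 0 := congrFun (hN j hj) x
  have hint (j : ℕ) : Integrable (fun x => g j x * extremalSeq p' q' (fun j => g j x) j) ν := by
    refine .of_bound ((hg j).mul (measurable_extremalSeq hg j)).aestronglyMeasurable
      (M * (N * M ^ q') ^ ((p' - 1) * (q - 1) / q)) (Eventually.of_forall fun x => ?_)
    rw [norm_mul]
    exact mul_le_mul (hM j x) (norm_extremalSeq_le hp' hq (hN' x) (fun j => hM j x) j)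
      (norm_nonneg _) ((norm_nonneg _).trans (hM j x))
  have hpt (x : α) : ∑ j ∈ Finset.range N, g j x * extremalSeq p' q' (fun j => g j x) j =
      ((((∑' j, ‖g j x‖ₑ ^ q') ^ (p' / q')).toReal : ℝ) : ℂ) := by
    rw [← tsum_eq_sum (L := .unconditional ℕ) fun j hj => by
        rw [hN' x j (not_lt.1 (Finset.mem_range.not.1 hj)), zero_mul],
      tsum_mul_extremalSeq (by linarith) hq.symm.pos,
      tsum_enorm_rpow hq.symm.nonneg (summable_norm_rpow_of_eq_zero hq.symm.pos (hN' x)),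
      ← ENNReal.toReal_rpow, ENNReal.toReal_ofReal (tsum_nonneg fun j => by positivity)]
  have hmeas : Measurable fun x => (∑' j, ‖g j x‖ₑ ^ q') ^ (p' / q') := by fun_prop
  rw [← integral_finsetSum _ fun j _ => hint j, funext hpt, integral_complex_ofReal,
    integral_toReal hmeas.aemeasurable
      (ae_lt_top hmeas (lintegral_tsum_enorm_rpow_ne_top (by linarith) hq.symm.pos hN hM))]

/-- Rescaling the extremal sequence by `I ^ (-1 / p)`, where `I` is the `p'`-th power of the norm of
`g`, makes its norm equal to one. -/
theorem exists_isAdmissible_of_bounded [IsFiniteMeasure ν] (hp : p.HolderConjugate p')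
    (hq : q.HolderConjugate q') {g : ℕ → α → ℂ} (hg : ∀ j, Measurable (g j)) {N : ℕ} {M : ℝ}
    (hN : ∀ j, N ≤ j → g j = 0) (hM : ∀ j x, ‖g j x‖ ≤ M) :
    ∃ f, IsAdmissible p q ν N f ∧ (∀ j x, g j x = 0 → f j x = 0) ∧
      ‖∑ j ∈ Finset.range N, ∫ x, g j x * f j x ∂ν‖ₑ = mixedENorm p' q' ν g := by
  have hp0 := hp.pos
  have hN' (x : α) (j : ℕ) (hj : N ≤ j) : g j x = 0 := congrFun (hN j hj) x
  obtain ⟨I, hI⟩ : ∃ I : ℝ≥0, ∫⁻ x, (∑' j, ‖g j x‖ₑ ^ q') ^ (p' / q') ∂ν = I :=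
    ⟨_, (ENNReal.coe_toNNReal
      (lintegral_tsum_enorm_rpow_ne_top hp.symm.pos hq.symm.pos hN hM)).symm⟩
  have hnorm : mixedENorm p q ν (fun j x => extremalSeq p' q' (fun j => g j x) j) =
      (I : ℝ≥0∞) ^ (1 / p) := by
    rw [mixedENorm_eq_lintegral hp0, ← hI]
    simp only [tsum_enorm_extremalSeq_rpow hp hq
      (summable_norm_rpow_of_eq_zero hq.symm.pos (hN' _))]
  set c : ℝ≥0 := I ^ (-(1 / p)) with hc
  have henorm (b : ℝ≥0) : ‖((b : ℝ) : ℂ)‖ₑ = b := by simp [enorm_eq_nnnorm]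
  refine ⟨fun j x => (c : ℝ) * extremalSeq p' q' (fun j => g j x) j,
    ⟨fun j => (measurable_extremalSeq hg j).const_mul _, ?_, fun j hj => ?_, ?_⟩,
    fun j x hjx => ?_, ?_⟩
  · refine ⟨c * (N * M ^ q') ^ ((p' - 1) * (q - 1) / q), fun j x => ?_⟩
    rw [norm_mul, Complex.norm_real, NNReal.norm_eq]
    gcongr
    exact norm_extremalSeq_le hp.symm.lt hq (hN' x) (fun j => hM j x) j
  · funext x
    rw [extremalSeq_of_eq_zero _ _ (hN' x j hj), mul_zero, Pi.zero_apply]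
  · rw [mixedENorm_const_mul hp0 hq.pos, hnorm, henorm,
      ← ENNReal.coe_rpow_of_nonneg _ (by positivity), ← ENNReal.coe_mul, ENNReal.coe_le_one_iff,
      hc, NNReal.rpow_neg]
    exact inv_mul_le_one
  · simp only [extremalSeq_of_eq_zero p' q' (z := fun j => g j x) hjx, mul_zero]
  · have hexp : -(1 / p) + 1 = 1 / p' := by
      rw [one_div, one_div, ← hp.one_sub_inv]; ring
    simp only [mul_left_comm _ ((c : ℝ) : ℂ), integral_const_mul]
    rw [← Finset.mul_sum, sum_integral_mul_extremalSeq hp.symm.lt hq hg hN hM, hI,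
      ENNReal.coe_toReal, ← Complex.ofReal_mul, ← NNReal.coe_mul, hc,
      ← NNReal.rpow_add_one' (by rw [hexp]; exact (one_div_pos.2 hp.symm.pos).ne'), hexp,
      henorm, ENNReal.coe_rpow_of_nonneg _ (one_div_nonneg.2 hp.symm.nonneg),
      mixedENorm_eq_lintegral hp.symm.pos, hI]

/-- The first `N` entries of a sequence, those of norm greater than `N` being replaced by zero. -/
noncomputable def cutoffSeq (N : ℕ) (z : ℕ → ℂ) (j : ℕ) : ℂ :=
  if j < N ∧ ‖z j‖ ≤ N then z j else 0

theorem norm_cutoffSeq_le (N : ℕ) (z : ℕ → ℂ) (j : ℕ) : ‖cutoffSeq N z j‖ ≤ N := by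
  rw [cutoffSeq]
  split_ifs with h
  · exact h.2
  · simp

theorem monotone_enorm_cutoffSeq (z : ℕ → ℂ) (j : ℕ) : Monotone fun N => ‖cutoffSeq N z j‖ₑ := by
  intro N N' h
  dsimp only [cutoffSeq]
  by_cases hz : j < N ∧ ‖z j‖ ≤ N
  · rw [if_pos hz, if_pos ⟨hz.1.trans_le h, hz.2.trans (Nat.cast_le.2 h)⟩]
  · simp [hz]

theorem tendsto_cutoffSeq (z : ℕ → ℂ) (j : ℕ) :
    Tendsto (fun N => cutoffSeq N z j) atTop (𝓝 (z j)) := by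
  refine tendsto_const_nhds.congr' ?_
  filter_upwards [eventually_gt_atTop j, eventually_ge_atTop ⌈‖z j‖⌉₊] with N hj hN
  rw [cutoffSeq, if_pos ⟨hj, Nat.ceil_le.1 hN⟩]

theorem measurable_cutoffSeq {g : ℕ → α → ℂ} (hg : ∀ j, Measurable (g j)) (N j : ℕ) :
    Measurable fun x => cutoffSeq N (fun j => g j x) j :=
  .ite ((MeasurableSet.const _).inter (measurableSet_le (hg j).norm measurable_const)) (hg j)
    measurable_const

theorem tendsto_mixedENorm_cutoffSeq (hp : 0 < p) (hq : 0 < q) {g : ℕ → α → ℂ}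
    (hg : ∀ j, Measurable (g j)) :
    Tendsto (fun N => mixedENorm p q ν fun j x => cutoffSeq N (fun j => g j x) j) atTop
      (𝓝 (mixedENorm p q ν g)) := by
  have hmono (z : ℕ → ℂ) (j : ℕ) : Monotone fun N => ‖cutoffSeq N z j‖ₑ ^ q := fun N N' h =>
    ENNReal.rpow_le_rpow (monotone_enorm_cutoffSeq z j h) hq.le
  have hlim (z : ℕ → ℂ) : Tendsto (fun N => ∑' j, ‖cutoffSeq N z j‖ₑ ^ q) atTop
      (𝓝 (∑' j, ‖z j‖ₑ ^ q)) := by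
    simp only [← lintegral_count]
    exact lintegral_tendsto_of_tendsto_of_monotone (fun N => measurable_from_top.aemeasurable)
      (Eventually.of_forall fun j => hmono z j) (Eventually.of_forall fun j =>
        (ENNReal.continuous_rpow_const.tendsto _).comp (tendsto_cutoffSeq z j).enorm)
  simp only [mixedENorm_eq_lintegral hp]
  refine (ENNReal.continuous_rpow_const.tendsto _).comp
    (lintegral_tendsto_of_tendsto_of_monotone (fun N => (Measurable.pow_const (.tsum fun j =>
      (measurable_cutoffSeq hg N j).enorm.pow_const q) _).aemeasurable)
      (Eventually.of_forall fun x N N' h => ?_) (Eventually.of_forall fun x =>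
        (ENNReal.continuous_rpow_const.tendsto _).comp (hlim _)))
  exact ENNReal.rpow_le_rpow (ENNReal.tsum_le_tsum fun j => hmono _ j h) (by positivity)

theorem exists_isAdmissible_tendsto_mixedENorm [IsFiniteMeasure ν] (hp : p.HolderConjugate p')
    (hq : q.HolderConjugate q') {g : ℕ → α → ℂ} (hg : ∀ j, Measurable (g j)) :
    ∃ f : ℕ → ℕ → α → ℂ, (∀ N, IsAdmissible p q ν N (f N)) ∧
      Tendsto (fun N => ‖∑ j ∈ Finset.range N, ∫ x, g j x * f N j x ∂ν‖ₑ) atTop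
        (𝓝 (mixedENorm p' q' ν g)) := by
  have hex (N : ℕ) := exists_isAdmissible_of_bounded (ν := ν) hp hq (measurable_cutoffSeq hg N)
    (N := N) (fun j hj => funext fun x => if_neg fun h => h.1.not_ge hj)
    (fun j x => norm_cutoffSeq_le N (fun j => g j x) j)
  choose f hf hfz hfg using hex
  refine ⟨f, hf, (tendsto_mixedENorm_cutoffSeq hp.symm.pos hq.symm.pos hg).congr fun N => ?_⟩
  have hmul (j : ℕ) (x : α) : cutoffSeq N (fun j => g j x) j * f N j x = g j x * f N j x := by
    by_cases h : j < N ∧ ‖g j x‖ ≤ N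
    · rw [cutoffSeq, if_pos h]
    · rw [hfz N j x (if_neg h), mul_zero, mul_zero]
  simp only [← hfg N, hmul]

end Extremal

/-! ### Functionals on spaces of families with bounded norms -/

section Families

variable {V : Type*} [AddCommGroup V] [Module ℂ V]

/-- An extended seminorm on a complex vector space: a seminorm that may take the value `∞`. The
reverse of the second inequality is automatic for `c ≠ 0`, and `N 0 = 0` follows from `c = 0`. -/
structure IsExtSeminorm (N : V → ℝ≥0∞) : Prop where
  add_le : ∀ v w, N (v + w) ≤ N v + N w
  smul_le : ∀ (c : ℂ) v, N (c • v) ≤ ‖c‖ₑ * N v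

/-- The linear functional `L` has norm at most `C` on the subspace where the extended seminorm `N`
is finite. Nothing is required elsewhere. -/
def IsBoundedBy (C : ℝ≥0) (N : V → ℝ≥0∞) (L : V →ₗ[ℂ] ℂ) : Prop :=
  ∀ v, N v < ⊤ → ‖L v‖ₑ ≤ C * N v

namespace IsExtSeminorm

variable {N : V → ℝ≥0∞}

theorem zero (hN : IsExtSeminorm N) : N 0 = 0 := by
  simpa using hN.smul_le 0 0

/-- The subspace on which an extended seminorm is finite. -/
def finiteSubmodule (hN : IsExtSeminorm N) : Submodule ℂ V where
  carrier := {v | N v < ⊤}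
  zero_mem' := hN.zero.trans_lt ENNReal.zero_lt_top
  add_mem' hv hw := (hN.add_le _ _).trans_lt (ENNReal.add_lt_top.2 ⟨hv, hw⟩)
  smul_mem' c _ hv := (hN.smul_le c _).trans_lt (ENNReal.mul_lt_top enorm_lt_top hv)

/-- The seminorm that an extended seminorm induces on the subspace where it is finite. -/
noncomputable def toSeminorm (hN : IsExtSeminorm N) : Seminorm ℂ hN.finiteSubmodule :=
  Seminorm.ofSMulLE (fun v => (N v).toReal)
    (by rw [ZeroMemClass.coe_zero, hN.zero, ENNReal.toReal_zero])
    (fun v w => by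
      rw [← ENNReal.toReal_add v.2.ne w.2.ne]
      exact ENNReal.toReal_mono (ENNReal.add_lt_top.2 ⟨v.2, w.2⟩).ne (hN.add_le v w))
    (fun c v => by
      rw [← toReal_enorm, ← ENNReal.toReal_mul]
      exact ENNReal.toReal_mono (ENNReal.mul_lt_top enorm_lt_top v.2).ne (hN.smul_le c v))

theorem exists_isBoundedBy_extension {E : Type*} [NormedAddCommGroup E] [NormedSpace ℂ E]
    (hN : IsExtSeminorm N) (e : E →ₗ[ℂ] V) (he : ∀ x, N (e x) = ‖x‖ₑ) (G : StrongDual ℂ E) :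
    ∃ L : V →ₗ[ℂ] ℂ, (∀ x, L (e x) = G x) ∧ IsBoundedBy ‖G‖₊ N L := by
  let e' : E →ₗ[ℂ] hN.finiteSubmodule :=
    e.codRestrict _ fun x => (he x).trans_lt enorm_lt_top
  have hnorm (x : E) : hN.toSeminorm (e' x) = ‖x‖ := by
    rw [← toReal_enorm, ← he x]
    rfl
  have hinj : Function.Injective e' := (injective_iff_map_eq_zero e').2 fun x hx => by
    rw [← norm_eq_zero, ← hnorm, hx, map_zero]
  let equiv := LinearEquiv.ofInjective e' hinj
  obtain ⟨L₀, hL₀, hL₀G⟩ := Module.Dual.exists_extension_of_le_seminorm (LinearMap.range e')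
    (G.toLinearMap ∘ₗ equiv.symm.toLinearMap) (p := ‖G‖₊ • hN.toSeminorm) fun y => by
      obtain ⟨x, rfl⟩ := equiv.surjective y
      have hx : hN.toSeminorm (equiv x) = ‖x‖ := hnorm x
      simpa [hx, NNReal.smul_def] using G.le_opNorm x
  obtain ⟨L, hL⟩ := L₀.exists_extend
  have hLL₀ (v : hN.finiteSubmodule) : L v = L₀ v := LinearMap.congr_fun hL v
  refine ⟨L, fun x => ?_, fun v hv => ?_⟩
  · have hx := hL₀ (equiv x)
    simp only [LinearMap.comp_apply, LinearEquiv.coe_coe, equiv.symm_apply_apply] at hx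
    exact (hLL₀ (e' x)).trans hx
  · have hbound : ‖L v‖ ≤ ‖G‖ * (N v).toReal := hLL₀ ⟨v, hv⟩ ▸ hL₀G ⟨v, hv⟩
    rw [← ENNReal.toReal_le_toReal enorm_ne_top (ENNReal.mul_ne_top ENNReal.coe_ne_top hv.ne),
      toReal_enorm, ENNReal.toReal_mul]
    exact hbound

end IsExtSeminorm

variable {ι : Type*} {N : ι → V → ℝ≥0∞}

theorem IsExtSeminorm.iSup (hN : ∀ i, IsExtSeminorm (N i)) :
    IsExtSeminorm fun F : ι → V => ⨆ i, N i (F i) where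
  add_le F F' := iSup_le fun i => ((hN i).add_le _ _).trans
    (add_le_add (le_iSup (fun i => N i (F i)) i) (le_iSup (fun i => N i (F' i)) i))
  smul_le c F := iSup_le fun i => ((hN i).smul_le c _).trans
    (by gcongr; exact le_iSup (fun i => N i (F i)) i)

namespace IsBoundedBy

variable [DecidableEq ι] {C : ℝ≥0} {L : (ι → V) →ₗ[ℂ] ℂ}

theorem comp_single (hN : ∀ i, IsExtSeminorm (N i))
    (hL : IsBoundedBy C (fun F => ⨆ i, N i (F i)) L) (i : ι) :
    IsBoundedBy C (N i) (L ∘ₗ LinearMap.single ℂ (fun _ => V) i) := by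
  intro v hv
  have hsingle : ⨆ k, N k ((Pi.single i v : ι → V) k) ≤ N i v := by
    refine iSup_le fun k => ?_
    rcases eq_or_ne k i with rfl | hk
    · rw [Pi.single_eq_same]
    · rw [Pi.single_eq_of_ne hk, (hN k).zero]
      exact zero_le
  exact (hL _ (hsingle.trans_lt hv)).trans (by gcongr)

/-- Unimodular multiples of the given vectors make all summands positive. -/
theorem sum_enorm_apply_single_le (hN : ∀ i, IsExtSeminorm (N i))
    (hL : IsBoundedBy C (fun F => ⨆ i, N i (F i)) L) {v : ι → V} (hv : ∀ i, N i (v i) ≤ 1)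
    (s : Finset ι) : ∑ i ∈ s, ‖L (Pi.single i (v i))‖ₑ ≤ C := by
  choose c hc hcL using fun i => Complex.exists_norm_eq_mul_self (L (Pi.single i (v i)))
  set F : ι → V := ∑ i ∈ s, Pi.single i (c i • v i) with hF
  have hFle : ⨆ i, N i (F i) ≤ 1 := by
    refine iSup_le fun i => ?_
    rw [hF, Finset.sum_apply, Finset.sum_pi_single]
    split_ifs
    · have hci : ‖c i‖ₑ = 1 := by rw [← ofReal_norm, hc, ENNReal.ofReal_one]
      exact ((hN i).smul_le (c i) (v i)).trans (by rw [hci, one_mul]; exact hv i)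
    · exact ((hN i).zero).trans_le zero_le
  have hLF : L F = ((∑ i ∈ s, ‖L (Pi.single i (v i))‖ : ℝ) : ℂ) := by
    rw [hF, map_sum, Complex.ofReal_sum]
    exact Finset.sum_congr rfl fun i _ => by rw [Pi.single_smul', map_smul, hcL, smul_eq_mul]
  calc ∑ i ∈ s, ‖L (Pi.single i (v i))‖ₑ = ‖L F‖ₑ := by
        rw [hLF, ← ofReal_norm, Complex.norm_real, Real.norm_of_nonneg (by positivity),
          ENNReal.ofReal_sum_of_nonneg fun i _ => norm_nonneg _]
        simp only [ofReal_norm]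
    _ ≤ C * ⨆ i, N i (F i) := hL F (hFle.trans_lt ENNReal.one_lt_top)
    _ ≤ C := mul_le_of_le_one_right' hFle

theorem hasSum_apply_single (hN : ∀ i, IsExtSeminorm (N i))
    (hL : IsBoundedBy C (fun F => ⨆ i, N i (F i)) L) {F : ι → V}
    (hF : ⨆ i, N i (F i) < ⊤) (hF0 : Tendsto (fun i => N i (F i)) cofinite (𝓝 0)) :
    HasSum (fun i => L (Pi.single i (F i))) (L F) := by
  rw [HasSum, tendsto_iff_edist_tendsto_0, ENNReal.tendsto_nhds_zero]
  intro ε hε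
  have hε' : 0 < ε / C := ENNReal.div_pos hε.ne' ENNReal.coe_ne_top
  have hfin := eventually_cofinite.1 ((ENNReal.tendsto_nhds_zero.1 hF0) _ hε')
  simp only [SummationFilter.unconditional_filter]
  filter_upwards [eventually_ge_atTop hfin.toFinset] with S hS
  set D : ι → V := F - ∑ i ∈ S, Pi.single i (F i) with hD
  have hDi (i : ι) : N i (D i) ≤ N i (F i) ∧ N i (D i) ≤ ε / C := by
    rw [hD, Pi.sub_apply, Finset.sum_apply, Finset.sum_pi_single]
    split_ifs with hi
    · rw [sub_self, (hN i).zero]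
      exact ⟨zero_le, zero_le⟩
    · rw [sub_zero]
      exact ⟨le_rfl, not_not.1 fun h => hi (hS (hfin.mem_toFinset.2 h))⟩
  have hDlt : ⨆ i, N i (D i) < ⊤ := (iSup_mono fun i => (hDi i).1).trans_lt hF
  calc edist (∑ i ∈ S, L (Pi.single i (F i))) (L F) = ‖L D‖ₑ := by
        rw [edist_comm, edist_eq_enorm_sub, hD, map_sub, map_sum]
    _ ≤ C * (ε / C) := (hL D hDlt).trans (by gcongr; exact iSup_le fun i => (hDi i).2)
    _ ≤ ε := ENNReal.mul_div_le

end IsBoundedBy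

end Families

section Extension

variable {α : Type*} [MeasurableSpace α] {μ : Measure α} {s : Set α} {P : ℝ≥0∞}

/-- Extension by zero of (classes of) functions on a measurable subset. -/
noncomputable def extendByZero (hs : MeasurableSet s) :
    (α →ₘ[μ.restrict s] ℂ) →ₗ[ℂ] (α →ₘ[μ] ℂ) where
  toFun u := AEEqFun.mk (s.indicator u)
    ((aestronglyMeasurable_indicator_iff hs).2 u.aestronglyMeasurable)
  map_add' u v := by
    rw [AEEqFun.mk_add_mk, AEEqFun.mk_eq_mk, ← Set.indicator_add']
    exact (ae_eq_restrict_iff_indicator_ae_eq hs).1 (AEEqFun.coeFn_add u v)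
  map_smul' c u := by
    rw [RingHom.id_apply, AEEqFun.smul_mk, AEEqFun.mk_eq_mk]
    exact ((ae_eq_restrict_iff_indicator_ae_eq hs).1 (AEEqFun.coeFn_smul c u)).trans
      (EventuallyEq.of_eq (Set.indicator_const_smul s c u))

theorem extendByZero_ae_eq (hs : MeasurableSet s) (u : α →ₘ[μ.restrict s] ℂ) :
    extendByZero hs u =ᵐ[μ.restrict s] u :=
  EventuallyEq.trans (ae_restrict_of_ae (AEEqFun.coeFn_mk _ _)) (indicator_ae_eq_restrict hs)

theorem exists_setIntegral_eq_of_isBoundedBy [Fact (1 ≤ P)] (hP : P ≠ ⊤) (hs : MeasurableSet s)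
    (hμs : μ s ≠ ⊤) {T : (α →ₘ[μ] ℂ) →ₗ[ℂ] ℂ} {C : ℝ≥0}
    (hT : IsBoundedBy C (fun u : α →ₘ[μ] ℂ => eLpNorm u P (μ.restrict s)) T) :
    ∃ g : α → ℂ, Measurable g ∧ IntegrableOn g s μ ∧
      ∀ (u : α →ₘ[μ] ℂ) (f : α → ℂ) (M : ℝ), Measurable f → (∀ x, ‖f x‖ ≤ M) →
        u =ᵐ[μ.restrict s] f → T u = ∫ x in s, g x * f x ∂μ := by
  have : IsFiniteMeasure (μ.restrict s) := isFiniteMeasure_restrict.2 hμs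
  let Λ : Lp ℂ P (μ.restrict s) →L[ℂ] ℂ :=
    LinearMap.mkContinuous
      { toFun := fun u => T (extendByZero hs u.1)
        map_add' := fun u v => (T ∘ₗ extendByZero hs).map_add u.1 v.1
        map_smul' := fun c u => (T ∘ₗ extendByZero hs).map_smul c u.1 } C fun u => by
        have hu : eLpNorm (extendByZero hs u.1) P (μ.restrict s) = ‖u‖ₑ :=
          (eLpNorm_congr_ae (extendByZero_ae_eq hs u.1)).trans (Lp.enorm_def u).symm
        have hTu : ‖T (extendByZero hs u.1)‖ₑ ≤ C * ‖u‖ₑ :=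
          hu ▸ hT (extendByZero hs u.1) (hu.trans_lt enorm_lt_top)
        simp only [enorm_eq_nnnorm] at hTu
        exact_mod_cast hTu
  obtain ⟨g, hg, hgi, hgΛ⟩ := exists_integral_eq_of_continuousLinearMap hP Λ
  refine ⟨g, hg, hgi, fun u f M hf hM huf => ?_⟩
  have hfp : MemLp f P (μ.restrict s) :=
    .of_bound hf.aestronglyMeasurable M (Eventually.of_forall hM)
  have hext : eLpNorm (u - extendByZero hs (hfp.toLp f).1 : α →ₘ[μ] ℂ) P (μ.restrict s) = 0 := by
    rw [eLpNorm_congr_ae (g := fun _ => (0 : ℂ)), eLpNorm_zero']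
    filter_upwards [huf, ae_restrict_of_ae (AEEqFun.coeFn_sub u (extendByZero hs (hfp.toLp f).1)),
      extendByZero_ae_eq hs (hfp.toLp f).1, hfp.coeFn_toLp] with x h1 h2 h3 h4
    rw [h2, Pi.sub_apply, h1, h3, h4, sub_self]
  have hzero : T (u - extendByZero hs (hfp.toLp f).1) = 0 := by
    simpa [hext] using hT _ (hext.trans_lt ENNReal.zero_lt_top)
  rw [map_sub, sub_eq_zero] at hzero
  exact hzero.trans (hgΛ f hfp M hf hM)

end Extension

/-! ### The pairing -/

variable {n : ℕ} {p p' q q' r ρ : ℝ}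

/-- The weight `2 ^ (J (n / p + r))` of the cube `Q_{J,M}` in the Morrey norm. -/
noncomputable def cubeWeight (p r : ℝ) (i : Idx n) : ℝ≥0∞ :=
  ENNReal.ofReal ((2 : ℝ) ^ ((i.1 : ℝ) * ((n : ℝ) / p + r)))

theorem cubeWeight_ne_zero (p r : ℝ) (i : Idx n) : cubeWeight p r i ≠ 0 := by
  rw [cubeWeight, ne_eq, ENNReal.ofReal_eq_zero, not_le]
  positivity

theorem cubeWeight_ne_top (p r : ℝ) (i : Idx n) : cubeWeight p r i ≠ ⊤ := ENNReal.ofReal_ne_top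

theorem measurableSet_dyadicCube (i : Idx n) : MeasurableSet (dyadicCube i) :=
  (isClosed_dyadicCube i).measurableSet

theorem cubeWeight_mul_eLpNorm_le_morreyENorm {ε : Type*} [TopologicalSpace ε] [ContinuousENorm ε]
    (p r : ℝ) (F : Sp n → ε) (i : Idx n) :
    cubeWeight p r i * eLpNorm F (ENNReal.ofReal p) (volume.restrict (dyadicCube i)) ≤
      morreyENorm p r F :=
  le_iSup (fun i : Idx n => cubeWeight p r i *
    eLpNorm F (ENNReal.ofReal p) (volume.restrict (dyadicCube i))) i

theorem div_add_eq_neg_of_holderConjugate (hp : p.HolderConjugate p')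
    (hrρ : r + ρ = -(n : ℝ)) : (n : ℝ) / p' + ρ = -((n : ℝ) / p + r) := by
  have hn : (n : ℝ) / p + n / p' = n := by
    rw [div_eq_mul_inv, div_eq_mul_inv, ← mul_add, hp.inv_add_inv_eq_one, mul_one]
  linarith

theorem ofReal_two_rpow_eq_cubeWeight (hp : p.HolderConjugate p') (hrρ : r + ρ = -(n : ℝ))
    (i : Idx n) :
    ENNReal.ofReal ((2 : ℝ) ^ (-((i.1 : ℝ) * ((n : ℝ) / p' + ρ)))) = cubeWeight p r i := by
  rw [cubeWeight, div_add_eq_neg_of_holderConjugate hp hrρ, mul_neg, neg_neg]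

theorem IsAtomic.lintegral_enorm_mul_le (hp : p.HolderConjugate p') (hrρ : r + ρ = -(n : ℝ))
    {lam : Idx n → ℂ} {a : Idx n → Sp n → ℂ} (H : IsAtomic p' ρ lam a) {F : Sp n → ℝ≥0∞}
    (hF : Measurable F) (i : Idx n) : ∫⁻ x, ‖a i x‖ₑ * F x ≤ morreyENorm p r F :=
  calc ∫⁻ x, ‖a i x‖ₑ * F x
      ≤ eLpNorm (a i) (ENNReal.ofReal p') volume *
          eLpNorm F (ENNReal.ofReal p) (volume.restrict (dyadicCube i)) :=
        lintegral_enorm_mul_le_of_support hp.symm (measurableSet_dyadicCube i) (H.memLp i).1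
          (H.supp i) hF.aemeasurable
    _ ≤ cubeWeight p r i * eLpNorm F (ENNReal.ofReal p) (volume.restrict (dyadicCube i)) := by
        gcongr
        exact (H.norm_le i).trans_eq (ofReal_two_rpow_eq_cubeWeight hp hrρ i)
    _ ≤ morreyENorm p r F := cubeWeight_mul_eLpNorm_le_morreyENorm p r F i

theorem lintegral_enorm_mul_le_predualFunENorm_mul_morreyENorm (hp : p.HolderConjugate p')
    (h : PredualIndex n p' ρ) (hrρ : r + ρ = -(n : ℝ)) {k : Sp n → ℂ} {F : Sp n → ℝ≥0∞}
    (hF : Measurable F) (hk : predualFunENorm p' ρ k ≠ ⊤) (hF' : morreyENorm p r F ≠ ⊤) :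
    ∫⁻ x, ‖k x‖ₑ * F x ≤ predualFunENorm p' ρ k * morreyENorm p r F := by
  refine ENNReal.le_mul_of_forall_lt (Or.inr hF') (Or.inl hk) fun c hc m hm => ?_
  obtain ⟨lam, a, H, hka, hlam⟩ := exists_of_predualFunENorm_lt h hc
  calc ∫⁻ x, ‖k x‖ₑ * F x ≤ ∫⁻ x, ∑' i, ‖lam i‖ₑ * (‖a i x‖ₑ * F x) := by
        refine lintegral_mono_ae ?_
        filter_upwards [hka] with x hx
        simp_rw [hx, ← mul_assoc, ← enorm_mul]
        rw [ENNReal.tsum_mul_right]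
        gcongr
        exact enorm_tsum_le_tsum_enorm
    _ = ∑' i, ‖lam i‖ₑ * ∫⁻ x, ‖a i x‖ₑ * F x := by
        have hm (i : Idx n) : AEMeasurable (fun x => ‖a i x‖ₑ * F x) volume :=
          (H.memLp i).1.enorm.mul hF.aemeasurable
        rw [lintegral_tsum fun i => (hm i).const_mul _]
        exact tsum_congr fun i => lintegral_const_mul'' _ (hm i)
    _ ≤ ∑' i, ‖lam i‖ₑ * morreyENorm p r F := by
        gcongr with i
        exact H.lintegral_enorm_mul_le hp hrρ hF i
    _ = (∑' i, ‖lam i‖ₑ) * morreyENorm p r F := ENNReal.tsum_mul_right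
    _ ≤ c * m := by gcongr

theorem tsum_enorm_mul_le_lqNorm_mul_lqNorm (hq : q.HolderConjugate q') (g f : FunSeq n)
    (x : Sp n) : ∑' j, ‖g j x * f j x‖ₑ ≤ lqNorm q' g x * lqNorm q f x := by
  simp_rw [enorm_mul]
  exact tsum_mul_le_Lp_mul_Lq hq.symm _ _

theorem enorm_lqFun {g : FunSeq n} {x : Sp n} (hx : lqNorm q g x < ⊤) :
    ‖lqFun q g x‖ₑ = lqNorm q g x :=
  enorm_ofReal_toReal hx.ne

theorem lintegral_tsum_enorm_mul_le (hp : p.HolderConjugate p') (hq : q.HolderConjugate q')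
    (h : PredualIndex n p' ρ) (hrρ : r + ρ = -(n : ℝ))
    (g : PredualSeq n p' q' ρ h hq.symm.lt) (f : MorreySeq n p q r hp.lt hq.lt) :
    ∫⁻ x, ∑' j, ‖g.1 j x * f.1 j x‖ₑ ≤
      predualSeqENorm p' q' ρ g.1 * morreySeqENorm p q r f.1 := by
  refine le_trans (lintegral_mono_ae ?_)
    (lintegral_enorm_mul_le_predualFunENorm_mul_morreyENorm hp h hrρ
      (measurable_lqNorm q f.1) (PredualSeq.enorm_lt_top g).ne f.2.2.ne)
  filter_upwards [g.2.2.1] with x hx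
  exact (tsum_enorm_mul_le_lqNorm_mul_lqNorm hq g.1 f.1 x).trans_eq (by rw [enorm_lqFun hx])

theorem measurable_mul_apply (g f : FunSeq n) (j : ℕ) : Measurable fun x => g j x * f j x :=
  (g j).stronglyMeasurable.measurable.mul (f j).stronglyMeasurable.measurable

theorem pairingConverges_of_lintegral_lt_top {g f : FunSeq n}
    (hgf : ∫⁻ x, ∑' j, ‖g j x * f j x‖ₑ < ⊤) : PairingConverges g f := by
  refine ⟨?_, (Measurable.tsum (measurable_mul_apply g f)).aestronglyMeasurable,
    (lintegral_mono fun x => enorm_tsum_le_tsum_enorm).trans_lt hgf⟩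
  filter_upwards [ae_lt_top (Measurable.tsum fun j => (measurable_mul_apply g f j).enorm)
    hgf.ne] with x hx
  exact tsum_enorm_ne_top_iff_summable_norm.1 hx.ne

theorem enorm_pairing_le_lintegral (g f : FunSeq n) :
    ‖pairing g f‖ₑ ≤ ∫⁻ x, ∑' j, ‖g j x * f j x‖ₑ :=
  (enorm_integral_le_lintegral_enorm _).trans (lintegral_mono fun _ => enorm_tsum_le_tsum_enorm)

theorem pairingConverges (hp : p.HolderConjugate p') (hq : q.HolderConjugate q')
    (h : PredualIndex n p' ρ) (hrρ : r + ρ = -(n : ℝ))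
    (g : PredualSeq n p' q' ρ h hq.symm.lt) (f : MorreySeq n p q r hp.lt hq.lt) :
    PairingConverges g.1 f.1 :=
  pairingConverges_of_lintegral_lt_top ((lintegral_tsum_enorm_mul_le hp hq h hrρ g f).trans_lt
    (ENNReal.mul_lt_top (PredualSeq.enorm_lt_top g) f.2.2))

theorem norm_pairing_le (hp : p.HolderConjugate p') (hq : q.HolderConjugate q')
    (h : PredualIndex n p' ρ) (hrρ : r + ρ = -(n : ℝ))
    (g : PredualSeq n p' q' ρ h hq.symm.lt) (f : MorreySeq n p q r hp.lt hq.lt) :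
    ‖pairing g.1 f.1‖ ≤ ‖g‖ * ‖f‖ := by
  have hle := ENNReal.toReal_mono (ENNReal.mul_ne_top (PredualSeq.enorm_lt_top g).ne f.2.2.ne)
    ((enorm_pairing_le_lintegral g.1 f.1).trans (lintegral_tsum_enorm_mul_le hp hq h hrρ g f))
  rwa [toReal_enorm, ENNReal.toReal_mul] at hle

theorem pairing_comm (g f : FunSeq n) : pairing g f = pairing f g := by
  simp only [pairing, mul_comm]

theorem PairingConverges.symm {g f : FunSeq n} (h : PairingConverges g f) :
    PairingConverges f g := by
  simpa only [PairingConverges, mul_comm] using h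

theorem pairing_add_right {g f f' : FunSeq n} (h : PairingConverges g f)
    (h' : PairingConverges g f') : pairing g (f + f') = pairing g f + pairing g f' := by
  rw [pairing, pairing, pairing, ← integral_add h.2 h'.2]
  refine integral_congr_ae ?_
  filter_upwards [h.1, h'.1, ae_all_iff.2 fun j => AEEqFun.coeFn_add (f j) (f' j)]
    with x hsum hsum' hadd
  rw [← hsum.of_norm.tsum_add hsum'.of_norm]
  refine tsum_congr fun j => ?_
  rw [← mul_add, ← Pi.add_apply, ← hadd j, Pi.add_apply]

theorem pairing_add_left {g g' f : FunSeq n} (h : PairingConverges g f)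
    (h' : PairingConverges g' f) : pairing (g + g') f = pairing g f + pairing g' f := by
  simpa only [pairing_comm f] using pairing_add_right h.symm h'.symm

theorem pairing_smul_right (c : ℂ) (g f : FunSeq n) : pairing g (c • f) = c * pairing g f := by
  rw [pairing, pairing, ← integral_const_mul]
  refine integral_congr_ae ?_
  filter_upwards [ae_all_iff.2 fun j => AEEqFun.coeFn_smul c (f j)] with x hsmul
  rw [← tsum_mul_left]
  refine tsum_congr fun j => ?_
  rw [mul_left_comm]
  exact congrArg (g j x * ·) (hsmul j)

theorem pairing_smul_left (c : ℂ) (g f : FunSeq n) : pairing (c • g) f = c * pairing g f := by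
  simpa only [pairing_comm f] using pairing_smul_right c f g

/-- The functional `f ↦ ∫ ∑ g_j f_j` on the closure of the test sequences, linearly in `g`. -/
noncomputable def pairingFunctional (hp : p.HolderConjugate p') (hq : q.HolderConjugate q')
    (h : PredualIndex n p' ρ) (hrρ : r + ρ = -(n : ℝ)) :
    PredualSeq n p' q' ρ h hq.symm.lt →ₗ[ℂ]
      StrongDual ℂ (MorreySeqCirc n p q r hp.lt hq.lt) where
  toFun g := LinearMap.mkContinuous
    { toFun := fun f => pairing g.1 f.1.1
      map_add' := fun f f' => pairing_add_right (pairingConverges hp hq h hrρ g f.1)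
        (pairingConverges hp hq h hrρ g f'.1)
      map_smul' := fun c f => pairing_smul_right c g.1 f.1.1 } ‖g‖
    fun f => norm_pairing_le hp hq h hrρ g f.1
  map_add' g g' := ContinuousLinearMap.ext fun f =>
    pairing_add_left (pairingConverges hp hq h hrρ g f.1) (pairingConverges hp hq h hrρ g' f.1)
  map_smul' c g := ContinuousLinearMap.ext fun f => pairing_smul_left c g.1 f.1.1

theorem pairingFunctional_apply (hp : p.HolderConjugate p') (hq : q.HolderConjugate q')
    (h : PredualIndex n p' ρ) (hrρ : r + ρ = -(n : ℝ))
    (g : PredualSeq n p' q' ρ h hq.symm.lt) (f : MorreySeqCirc n p q r hp.lt hq.lt) :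
    pairingFunctional hp hq h hrρ g f = pairing g.1 f.1.1 := rfl

theorem norm_pairingFunctional_le (hp : p.HolderConjugate p') (hq : q.HolderConjugate q')
    (h : PredualIndex n p' ρ) (hrρ : r + ρ = -(n : ℝ))
    (g : PredualSeq n p' q' ρ h hq.symm.lt) :
    ‖pairingFunctional hp hq h hrρ (r := r) g‖ ≤ ‖g‖ :=
  ContinuousLinearMap.opNorm_le_bound _ (norm_nonneg _) fun f => norm_pairing_le hp hq h hrρ g f.1

/-! ### Lebesgue spaces inside Morrey spaces, and density of test sequences -/

theorem one_le_ofReal {u : ℝ} (hu : 1 ≤ u) : 1 ≤ ENNReal.ofReal u := by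
  simpa using ENNReal.ofReal_le_ofReal hu

theorem le_neg_div (hp : 0 < p) (hr : -(n : ℝ) / p < r) (hr0 : r < 0) : p ≤ -(n : ℝ) / r := by
  rw [div_lt_iff₀ hp] at hr
  rw [le_div_iff_of_neg hr0]
  linarith

/-- Both sides scale alike at the exponent `-n / r`, so the constant does not depend on the cube. -/
theorem morreyENorm_le_eLpNorm (hp : 0 < p) (hr : -(n : ℝ) / p < r) (hr0 : r < 0)
    {F : Sp n → ℝ≥0∞} (hF : Measurable F) :
    morreyENorm p r F ≤ ENNReal.ofReal ((2 : ℝ) ^ ((n : ℝ) / p + r)) *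
      eLpNorm F (ENNReal.ofReal (-(n : ℝ) / r)) volume := by
  have hpu := le_neg_div hp hr hr0
  have hu : 0 < -(n : ℝ) / r := hp.trans_le hpu
  have hn : (n : ℝ) ≠ 0 := fun h => by simp [h] at hu
  refine iSup_le fun i => ?_
  have hHölder := eLpNorm_le_eLpNorm_mul_rpow_measure_univ (ENNReal.ofReal_le_ofReal hpu)
    (hF.aestronglyMeasurable (μ := volume.restrict (dyadicCube i)))
  rw [Measure.restrict_apply_univ, volume_dyadicCube, ENNReal.toReal_ofReal hu.le,
    ENNReal.toReal_ofReal hp.le, ENNReal.ofReal_rpow_of_pos (by positivity),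
    ← Real.rpow_mul two_pos.le] at hHölder
  have hscale : (2 : ℝ) ^ ((n : ℝ) / p + r) = (2 : ℝ) ^ ((i.1 : ℝ) * ((n : ℝ) / p + r)) *
      (2 : ℝ) ^ ((n : ℝ) * (1 - (i.1 : ℝ)) * (1 / p - 1 / (-(n : ℝ) / r))) := by
    rw [← Real.rpow_add two_pos]
    congr 1
    field_simp
    ring
  rw [hscale, ENNReal.ofReal_mul (by positivity), mul_assoc]
  gcongr
  refine hHölder.trans ?_
  rw [mul_comm]
  gcongr
  exact Measure.restrict_le_self

theorem morreySeqENorm_le_lebesgueSeqENorm (hp : 0 < p) (hr : -(n : ℝ) / p < r) (hr0 : r < 0)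
    (f : FunSeq n) :
    morreySeqENorm p q r f ≤ ENNReal.ofReal ((2 : ℝ) ^ ((n : ℝ) / p + r)) *
      lebesgueSeqENorm (-(n : ℝ) / r) q f :=
  morreyENorm_le_eLpNorm hp hr hr0 (measurable_lqNorm q f)

theorem mem_morreySeq_of_morreySeqENorm_lt_top (hp : 1 < p) (hq : 1 < q) {f : FunSeq n}
    (hf : morreySeqENorm p q r f < ⊤) : f ∈ MorreySeq n p q r hp hq :=
  ⟨fun j => (morreyENorm_mono (G := lqNorm q f)
    (Eventually.of_forall fun x => enorm_le_lqNorm hq _ j x)).trans_lt hf, hf⟩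

theorem lebesgueSeqENorm_add_le {u : ℝ} (hu : 1 ≤ u) (hq : 1 < q) (f g : FunSeq n) :
    lebesgueSeqENorm u q (f + g) ≤ lebesgueSeqENorm u q f + lebesgueSeqENorm u q g :=
  (eLpNorm_mono_enorm_ae (g := lqNorm q f + lqNorm q g) (lqNorm_add_le hq f g)).trans
    (eLpNorm_add_le (measurable_lqNorm q f).aestronglyMeasurable
      (measurable_lqNorm q g).aestronglyMeasurable (one_le_ofReal hu))

theorem coeFn_zero_ae (n : ℕ) : ∀ᵐ x, (0 : Sp n →ₘ[volume] ℂ) x = 0 :=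
  AEEqFun.coeFn_zero

theorem lqNorm_le_sum (hq : 1 ≤ q) {f : FunSeq n} {k : ℕ} (hf : ∀ j, k < j → f j = 0) :
    ∀ᵐ x, lqNorm q f x ≤ ∑ j ∈ Finset.range (k + 1), ‖f j x‖ₑ := by
  filter_upwards [coeFn_zero_ae n] with x hx
  refine (Lp_le_tsum hq _).trans_eq (tsum_eq_sum fun j hj => ?_)
  rw [hf j (by simpa [Nat.lt_succ_iff] using hj), hx, enorm_zero]

theorem lebesgueSeqENorm_le_sum {u : ℝ} (hu : 1 ≤ u) (hq : 1 ≤ q) {f : FunSeq n} {k : ℕ}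
    (hf : ∀ j, k < j → f j = 0) :
    lebesgueSeqENorm u q f ≤
      ∑ j ∈ Finset.range (k + 1), eLpNorm (f j) (ENNReal.ofReal u) volume := by
  refine (eLpNorm_mono_enorm_ae (g := ∑ j ∈ Finset.range (k + 1), fun x => ‖f j x‖ₑ) ?_).trans
    ((eLpNorm_sum_le (fun j _ => ?_) (one_le_ofReal hu)).trans (Finset.sum_le_sum fun j _ => ?_))
  · filter_upwards [lqNorm_le_sum hq hf] with x hx
    simpa using hx
  · exact (f j).stronglyMeasurable.measurable.enorm.aestronglyMeasurable
  · exact (eLpNorm_enorm _).le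

/-- A finite sequence of test functions, continued by zero. The sequences which occur in the
definition of `MorreySeqCirc` are of this kind. -/
def IsTestSeq (f : FunSeq n) : Prop := (∀ j, IsTestFun (f j)) ∧ ∃ k, ∀ j, k < j → f j = 0

theorem IsTestFun.memLp {f : Sp n →ₘ[volume] ℂ} (hf : IsTestFun f) (u : ℝ≥0∞) :
    MemLp f u volume := by
  obtain ⟨φ, hφ, hφc, hfφ⟩ := hf
  exact (memLp_congr_ae hfφ).2 (hφ.continuous.memLp_of_hasCompactSupport hφc)

theorem IsTestSeq.lebesgueSeqENorm_lt_top {u : ℝ} (hu : 1 ≤ u) (hq : 1 ≤ q) {f : FunSeq n}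
    (hf : IsTestSeq f) : lebesgueSeqENorm u q f < ⊤ := by
  obtain ⟨htest, k, hk⟩ := hf
  exact (lebesgueSeqENorm_le_sum hu hq hk).trans_lt
    (ENNReal.sum_lt_top.2 fun j _ => ((htest j).memLp _).2)

/-- The sequence `f` with its entries beyond the `k`-th replaced by zero, an intermediate step in
the approximation of `f` by finite sequences of test functions. -/
noncomputable def truncSeq (k : ℕ) (f : FunSeq n) : FunSeq n := fun j => if j ≤ k then f j else 0

theorem sub_truncSeq_apply (f : FunSeq n) :
    ∀ᵐ x, ∀ k j, (f - truncSeq k f) j x = if j ≤ k then 0 else f j x := by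
  filter_upwards [coeFn_zero_ae n] with x hx k j
  have key : (f - truncSeq k f) j = if j ≤ k then 0 else f j := by
    by_cases hj : j ≤ k <;> simp [truncSeq, hj]
  rw [key]
  split_ifs with hj
  · exact hx
  · rfl

theorem tendsto_tsum_ite_le_zero {a : ℕ → ℝ≥0∞} (ha : ∑' j, a j ≠ ⊤) :
    Tendsto (fun k => ∑' j, if j ≤ k then 0 else a j) atTop (𝓝 0) := by
  refine ((ENNReal.tendsto_sum_nat_add a ha).comp (tendsto_add_atTop_nat 1)).congr fun k => ?_
  set b : ℕ → ℝ≥0∞ := fun j => if j ≤ k then 0 else a j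
  have head : ∑ j ∈ Finset.range (k + 1), b j = 0 :=
    Finset.sum_eq_zero fun j hj => if_pos (Finset.mem_range_succ_iff.1 hj)
  have tail (j : ℕ) : b (j + (k + 1)) = a (j + (k + 1)) := if_neg (by omega)
  calc ∑' j, a (j + (k + 1)) = ∑ j ∈ Finset.range (k + 1), b j + ∑' j, b (j + (k + 1)) := by
        rw [head, zero_add, tsum_congr tail]
    _ = ∑' j, b j := ENNReal.summable.sum_add_tsum_nat_add' (f := b)

theorem lqNorm_sub_truncSeq (hq : 0 < q) (f : FunSeq n) :
    ∀ᵐ x, ∀ k, lqNorm q (f - truncSeq k f) x =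
      (∑' j, if j ≤ k then 0 else ‖f j x‖ₑ ^ q) ^ (1 / q) := by
  filter_upwards [sub_truncSeq_apply f] with x hx k
  rw [lqNorm]
  congr 1
  refine tsum_congr fun j => ?_
  rw [hx]
  split_ifs <;> simp [hq]

theorem lqNorm_sub_truncSeq_le (hq : 0 < q) (f : FunSeq n) :
    ∀ᵐ x, ∀ k, lqNorm q (f - truncSeq k f) x ≤ lqNorm q f x := by
  filter_upwards [lqNorm_sub_truncSeq hq f] with x hx k
  rw [hx, lqNorm]
  gcongr with j
  split_ifs
  exacts [zero_le, le_rfl]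

theorem tendsto_lqNorm_sub_truncSeq (hq : 0 < q) (f : FunSeq n) :
    ∀ᵐ x, lqNorm q f x < ⊤ →
      Tendsto (fun k => lqNorm q (f - truncSeq k f) x) atTop (𝓝 0) := by
  filter_upwards [lqNorm_sub_truncSeq hq f] with x hx hfin
  rw [lqNorm, ENNReal.rpow_lt_top_iff_of_pos (by positivity)] at hfin
  have hlim := ((ENNReal.continuous_rpow_const (y := 1 / q)).tendsto 0).comp
    (tendsto_tsum_ite_le_zero hfin.ne)
  simp_rw [hx]
  simpa [Function.comp_def, hq] using hlim

theorem tendsto_eLpNorm_zero_of_dominated {α : Type*} [MeasurableSpace α] {μ : Measure α} {u : ℝ}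
    (hu : 0 < u) {F : ℕ → α → ℝ≥0∞} {B : α → ℝ≥0∞} (hF : ∀ k, Measurable (F k))
    (hB : Measurable B) (hBu : eLpNorm B (ENNReal.ofReal u) μ < ⊤) (hle : ∀ k, F k ≤ᵐ[μ] B)
    (hlim : ∀ᵐ x ∂μ, B x < ⊤ → Tendsto (fun k => F k x) atTop (𝓝 0)) :
    Tendsto (fun k => eLpNorm (F k) (ENNReal.ofReal u) μ) atTop (𝓝 0) := by
  simp only [eLpNorm_ofReal_eq_lintegral hu, enorm_eq_self] at hBu ⊢
  rw [ENNReal.rpow_lt_top_iff_of_pos (by positivity)] at hBu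
  have hlimint : Tendsto (fun k => ∫⁻ x, F k x ^ u ∂μ) atTop (𝓝 (∫⁻ _, 0 ∂μ)) := by
    refine tendsto_lintegral_of_dominated_convergence (fun x => B x ^ u)
      (fun k => (hF k).pow_const u) (fun k => ?_) hBu.ne ?_
    · filter_upwards [hle k] with x hx
      gcongr
    · filter_upwards [hlim, ae_lt_top (hB.pow_const u) hBu.ne] with x hx hBx
      have hpow := ((ENNReal.continuous_rpow_const (y := u)).tendsto 0).comp
        (hx ((ENNReal.rpow_lt_top_iff_of_pos hu).1 hBx))
      simpa [Function.comp_def, hu] using hpow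
  rw [lintegral_zero] at hlimint
  have hroot := ((ENNReal.continuous_rpow_const (y := 1 / u)).tendsto 0).comp hlimint
  simpa [Function.comp_def, hu] using hroot

theorem tendsto_lebesgueSeqENorm_sub_truncSeq {u : ℝ} (hu : 0 < u) (hq : 0 < q) {f : FunSeq n}
    (hf : lebesgueSeqENorm u q f < ⊤) :
    Tendsto (fun k => lebesgueSeqENorm u q (f - truncSeq k f)) atTop (𝓝 0) :=
  tendsto_eLpNorm_zero_of_dominated hu (fun _ => measurable_lqNorm q _) (measurable_lqNorm q f) hf
    (ae_all_iff.1 (lqNorm_sub_truncSeq_le hq f)) (tendsto_lqNorm_sub_truncSeq hq f)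

theorem exists_isTestFun_eLpNorm_sub_le {u : ℝ≥0∞} (hu : 1 ≤ u) (hu' : u ≠ ⊤)
    {f : Sp n →ₘ[volume] ℂ} (hf : MemLp f u volume) {ε : ℝ} (hε : 0 < ε) :
    ∃ φ : Sp n →ₘ[volume] ℂ, IsTestFun φ ∧
      eLpNorm (f - φ : Sp n →ₘ[volume] ℂ) u volume ≤ ENNReal.ofReal ε := by
  obtain ⟨φ, hφc, hφ, hle⟩ := MemLp.exist_eLpNorm_sub_le hu' hu hf hε
  refine ⟨AEEqFun.mk φ hφ.continuous.aestronglyMeasurable,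
    ⟨φ, hφ, hφc, AEEqFun.coeFn_mk _ _⟩, le_trans (le_of_eq (eLpNorm_congr_ae ?_)) hle⟩
  exact (AEEqFun.coeFn_sub _ _).trans ((EventuallyEq.refl _ _).sub (AEEqFun.coeFn_mk _ _))

theorem exists_isTestFun_lebesgueSeqENorm_truncSeq_sub_le {u : ℝ} (hu : 1 ≤ u) (hq : 1 < q)
    {f : FunSeq n} (hf : lebesgueSeqENorm u q f < ⊤) (k : ℕ) {ε : ℝ} (hε : 0 < ε) :
    ∃ φ : FunSeq n, (∀ j, IsTestFun (φ j)) ∧ (∀ j, k < j → φ j = 0) ∧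
      lebesgueSeqENorm u q (truncSeq k f - φ) ≤ ENNReal.ofReal ε := by
  have hmem (j : ℕ) : MemLp (f j) (ENNReal.ofReal u) volume :=
    ⟨(f j).aestronglyMeasurable, (eLpNorm_mono_enorm (g := lqNorm q f) fun x =>
      enorm_le_lqNorm hq f j x).trans_lt hf⟩
  have hδ : 0 < ε / (k + 1) := by positivity
  choose φ hφ hfφ using fun j =>
    exists_isTestFun_eLpNorm_sub_le (one_le_ofReal hu) ENNReal.ofReal_ne_top (hmem j) hδ
  refine ⟨truncSeq k φ, fun j => ?_, fun j hj => if_neg (not_le.2 hj), ?_⟩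
  · unfold truncSeq
    split_ifs
    exacts [hφ j, IsTestFun.zero]
  calc lebesgueSeqENorm u q (truncSeq k f - truncSeq k φ)
      ≤ ∑ j ∈ Finset.range (k + 1),
          eLpNorm ((truncSeq k f - truncSeq k φ) j) (ENNReal.ofReal u) volume :=
        lebesgueSeqENorm_le_sum hu hq.le fun j hj => by simp [truncSeq, not_le.2 hj]
    _ ≤ ∑ j ∈ Finset.range (k + 1), ENNReal.ofReal (ε / (k + 1)) := by
        refine Finset.sum_le_sum fun j hj => ?_
        have hjk : j ≤ k := by simpa [Nat.lt_succ_iff] using hj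
        simpa only [Pi.sub_apply, truncSeq, hjk, if_true] using hfφ j
    _ = ENNReal.ofReal ε := by
        rw [Finset.sum_const, Finset.card_range, ← ENNReal.ofReal_nsmul, nsmul_eq_mul]
        congr 1
        push_cast
        field_simp

theorem exists_isTestFun_tendsto_lebesgueSeqENorm_sub {u : ℝ} (hu : 1 ≤ u) (hq : 1 < q)
    {f : FunSeq n} (hf : lebesgueSeqENorm u q f < ⊤) :
    ∃ φ : ℕ → FunSeq n, (∀ k j, IsTestFun (φ k j)) ∧ (∀ k j, k < j → φ k j = 0) ∧
      Tendsto (fun k => lebesgueSeqENorm u q (f - φ k)) atTop (𝓝 0) := by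
  choose φ htest hzero hle using fun k : ℕ =>
    exists_isTestFun_lebesgueSeqENorm_truncSeq_sub_le hu hq hf k
      (ε := 1 / ((k : ℝ) + 1)) (by positivity)
  refine ⟨φ, htest, hzero, ?_⟩
  have hlim := (tendsto_lebesgueSeqENorm_sub_truncSeq (by linarith) (by linarith) hf).add
    ((ENNReal.continuous_ofReal.tendsto 0).comp tendsto_one_div_add_atTop_nhds_zero_nat)
  rw [ENNReal.ofReal_zero, add_zero] at hlim
  refine tendsto_of_tendsto_of_tendsto_of_le_of_le tendsto_const_nhds hlim
    (fun _ => zero_le) fun k => ?_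
  calc lebesgueSeqENorm u q (f - φ k)
      = lebesgueSeqENorm u q ((f - truncSeq k f) + (truncSeq k f - φ k)) := by
        rw [sub_add_sub_cancel]
    _ ≤ _ := (lebesgueSeqENorm_add_le hu hq _ _).trans (by gcongr; exact hle k)

theorem exists_mem_morreySeqCirc (hp : 1 < p) (hq : 1 < q) (hr : -(n : ℝ) / p < r) (hr0 : r < 0)
    {f : FunSeq n} (hf : lebesgueSeqENorm (-(n : ℝ) / r) q f < ⊤) :
    ∃ hf : f ∈ MorreySeq n p q r hp hq, ⟨f, hf⟩ ∈ MorreySeqCirc n p q r hp hq := by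
  have hle := morreySeqENorm_le_lebesgueSeqENorm (q := q) (zero_lt_one.trans hp) hr hr0
  refine ⟨mem_morreySeq_of_morreySeqENorm_lt_top hp hq
    ((hle f).trans_lt (ENNReal.mul_lt_top ENNReal.ofReal_lt_top hf)), ?_⟩
  obtain ⟨φ, htest, hzero, hlim⟩ := exists_isTestFun_tendsto_lebesgueSeqENorm_sub
    (hp.le.trans (le_neg_div (zero_lt_one.trans hp) hr hr0)) hq hf
  refine ⟨φ, htest, hzero, ?_⟩
  have hlim' := ENNReal.Tendsto.const_mul (a := ENNReal.ofReal ((2 : ℝ) ^ ((n : ℝ) / p + r))) hlim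
    (Or.inr ENNReal.ofReal_ne_top)
  rw [mul_zero] at hlim'
  exact tendsto_of_tendsto_of_tendsto_of_le_of_le tendsto_const_nhds hlim'
    (fun _ => zero_le) fun k => hle _

theorem MorreySeqCirc.ext_isTestSeq (hp : 1 < p) (hq : 1 < q) (hr : -(n : ℝ) / p < r)
    (hr0 : r < 0) {G G' : StrongDual ℂ (MorreySeqCirc n p q r hp hq)}
    (h : ∀ f : MorreySeqCirc n p q r hp hq, IsTestSeq f.1.1 → G f = G' f) : G = G' := by
  ext f
  obtain ⟨φ, htest, hzero, hlim⟩ := f.2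
  have hφ (k : ℕ) : IsTestSeq (φ k) := ⟨htest k, k, hzero k⟩
  choose hmem hcirc using fun k => exists_mem_morreySeqCirc (f := φ k) hp hq hr hr0
    ((hφ k).lebesgueSeqENorm_lt_top (hp.le.trans (le_neg_div (by linarith) hr hr0)) hq.le)
  let Φ (k : ℕ) : MorreySeqCirc n p q r hp hq := ⟨⟨φ k, hmem k⟩, hcirc k⟩
  have hΦ : Tendsto Φ atTop (𝓝 f) := by
    rw [tendsto_iff_norm_sub_tendsto_zero]
    refine ((ENNReal.tendsto_toReal ENNReal.zero_ne_top).comp hlim).congr fun k => ?_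
    rw [norm_sub_rev]
    rfl
  refine tendsto_nhds_unique ((G.continuous.tendsto f).comp hΦ) ?_
  exact ((G'.continuous.tendsto f).comp hΦ).congr fun k => (h (Φ k) (hφ k)).symm

/-! ### Functionals on families of sequences indexed by the dyadic cubes -/

/-- The contribution of a single dyadic cube to the Morrey norm of a sequence. -/
noncomputable def cubeENorm (p q r : ℝ) (i : Idx n) (f : FunSeq n) : ℝ≥0∞ :=
  cubeWeight p r i * eLpNorm (lqNorm q f) (ENNReal.ofReal p) (volume.restrict (dyadicCube i))

theorem iSup_cubeENorm (p q r : ℝ) (f : FunSeq n) :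
    ⨆ i, cubeENorm p q r i f = morreySeqENorm p q r f := rfl

theorem isExtSeminorm_cubeENorm (hp : 1 ≤ p) (hq : 1 < q) (r : ℝ) (i : Idx n) :
    IsExtSeminorm (cubeENorm p q r i) where
  add_le f g := by
    simp only [cubeENorm, ← mul_add]
    gcongr
    refine (eLpNorm_mono_enorm_ae (g := lqNorm q f + lqNorm q g) ?_).trans
      (eLpNorm_add_le (measurable_lqNorm q f).aestronglyMeasurable
        (measurable_lqNorm q g).aestronglyMeasurable (one_le_ofReal hp))
    exact ae_restrict_of_ae (lqNorm_add_le hq f g)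
  smul_le c f := by
    rw [cubeENorm, cubeENorm, mul_left_comm]
    gcongr
    refine eLpNorm_le_nnreal_smul_eLpNorm_of_ae_le_mul' (c := ‖c‖₊) (ae_restrict_of_ae ?_) _
    filter_upwards [lqNorm_smul hq c f] with x hx
    exact hx.le

theorem lqNorm_single_ae_le (hq : 1 ≤ q) (j : ℕ) (u : Sp n →ₘ[volume] ℂ) :
    ∀ᵐ x, lqNorm q (Pi.single j u) x ≤ ‖u x‖ₑ := by
  filter_upwards [coeFn_zero_ae n] with x hx
  refine (Lp_le_tsum hq _).trans_eq ?_
  rw [tsum_eq_single j fun k hk => by rw [Pi.single_eq_of_ne hk, hx, enorm_zero],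
    Pi.single_eq_same]

theorem cubeENorm_single_le (hq : 1 ≤ q) (i : Idx n) (j : ℕ) (u : Sp n →ₘ[volume] ℂ) :
    cubeENorm p q r i (Pi.single j u) ≤
      cubeWeight p r i * eLpNorm u (ENNReal.ofReal p) (volume.restrict (dyadicCube i)) := by
  rw [cubeENorm]
  gcongr
  exact eLpNorm_mono_enorm_ae (ae_restrict_of_ae (lqNorm_single_ae_le hq j u))

/-- The functions `g i j` are densities of the entries of `L`: on sequences whose `j`-th component
is the only nonzero one and is bounded on the `i`-th cube, the `i`-th entry of `L` is integration
against `g i j` over that cube. -/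
structure IsDensity (L : (Idx n → FunSeq n) →ₗ[ℂ] ℂ) (g : Idx n → ℕ → Sp n → ℂ) : Prop where
  measurable : ∀ i j, Measurable (g i j)
  integrableOn : ∀ i j, IntegrableOn (g i j) (dyadicCube i)
  apply_single : ∀ i j (u : Sp n →ₘ[volume] ℂ) (f : Sp n → ℂ) (M : ℝ), Measurable f →
    (∀ x, ‖f x‖ ≤ M) → u =ᵐ[volume.restrict (dyadicCube i)] f →
      L (Pi.single i (Pi.single j u)) = ∫ x in dyadicCube i, g i j x * f x

theorem volume_dyadicCube_ne_top (i : Idx n) : volume (dyadicCube i) ≠ ⊤ := by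
  rw [volume_dyadicCube]
  exact ENNReal.ofReal_ne_top

section Functional

variable {L : (Idx n → FunSeq n) →ₗ[ℂ] ℂ} {C : ℝ≥0} {g : Idx n → ℕ → Sp n → ℂ}

theorem IsBoundedBy.exists_isDensity (hp : 1 ≤ p) (hq : 1 < q)
    (hL : IsBoundedBy C (fun F => ⨆ i, cubeENorm p q r i (F i)) L) : ∃ g, IsDensity L g := by
  have : Fact (1 ≤ ENNReal.ofReal p) := ⟨one_le_ofReal hp⟩
  have hentry (i : Idx n) (j : ℕ) : IsBoundedBy (C * (cubeWeight p r i).toNNReal)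
      (fun u : Sp n →ₘ[volume] ℂ => eLpNorm u (ENNReal.ofReal p) (volume.restrict (dyadicCube i)))
      (L ∘ₗ LinearMap.single ℂ (fun _ : Idx n => FunSeq n) i ∘ₗ
        LinearMap.single ℂ (fun _ : ℕ => Sp n →ₘ[volume] ℂ) j) := by
    intro u hu
    have hsingle := cubeENorm_single_le (p := p) (r := r) hq.le i j u
    have hlt := hsingle.trans_lt (ENNReal.mul_lt_top (cubeWeight_ne_top p r i).lt_top hu)
    refine (hL.comp_single (isExtSeminorm_cubeENorm hp hq r) i _ hlt).trans ?_
    rw [ENNReal.coe_mul, ENNReal.coe_toNNReal (cubeWeight_ne_top p r i), mul_assoc]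
    gcongr
  choose g hg hgi hgL using fun i j => exists_setIntegral_eq_of_isBoundedBy ENNReal.ofReal_ne_top
    (measurableSet_dyadicCube i) (volume_dyadicCube_ne_top i) (hentry i j)
  exact ⟨g, hg, hgi, hgL⟩

theorem IsDensity.apply_single_eq_sum (hg : IsDensity L g) {i : Idx n} {φ : FunSeq n}
    {f : ℕ → Sp n → ℂ} {N : ℕ} (hN : ∀ j, N ≤ j → φ j = 0) (hf : ∀ j, Measurable (f j))
    (hM : ∀ j, ∃ M : ℝ, ∀ x, ‖f j x‖ ≤ M) (hφf : ∀ j, φ j =ᵐ[volume] f j) :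
    L (Pi.single i φ) = ∑ j ∈ Finset.range N, ∫ x in dyadicCube i, g i j x * f j x := by
  have hφ : φ = ∑ j ∈ Finset.range N, Pi.single j (φ j) := by
    funext k
    rw [Finset.sum_apply, Finset.sum_pi_single]
    split_ifs with hk
    · rfl
    · exact hN k (by simpa using hk)
  have hsum := map_sum (L ∘ₗ LinearMap.single ℂ (fun _ : Idx n => FunSeq n) i)
    (fun j => Pi.single j (φ j)) (Finset.range N)
  rw [← hφ] at hsum
  refine hsum.trans (Finset.sum_congr rfl fun j _ => ?_)
  obtain ⟨M, hM⟩ := hM j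
  exact hg.apply_single i j _ _ M (hf j) hM (ae_restrict_of_ae (hφf j))

theorem IsDensity.exists_cubeENorm_le_one (hp : 1 ≤ p) (hq : 1 < q) (hg : IsDensity L g)
    {i : Idx n} {N : ℕ} {f : ℕ → Sp n → ℂ}
    (hf : IsAdmissible p q (volume.restrict (dyadicCube i)) N f) :
    ∃ v : FunSeq n, cubeENorm p q r i v ≤ 1 ∧ ‖L (Pi.single i v)‖ₑ = (cubeWeight p r i)⁻¹ *
      ‖∑ j ∈ Finset.range N, ∫ x in dyadicCube i, g i j x * f j x‖ₑ := by
  let φ : FunSeq n := fun j => AEEqFun.mk (f j) (hf.measurable j).aestronglyMeasurable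
  have hφ (j : ℕ) : φ j =ᵐ[volume] f j := AEEqFun.coeFn_mk _ _
  have hN (j : ℕ) (hj : N ≤ j) : φ j = 0 := by
    refine AEEqFun.ext ((hφ j).trans ?_)
    rw [hf.eq_zero j hj]
    exact AEEqFun.coeFn_zero.symm
  have hφnorm : eLpNorm (lqNorm q φ) (ENNReal.ofReal p) (volume.restrict (dyadicCube i)) ≤ 1 := by
    refine (eLpNorm_congr_ae (ae_restrict_of_ae ?_)).trans_le hf.norm_le
    filter_upwards [ae_all_iff.2 hφ] with x hx
    simp only [lqNorm, hx]
  set c : ℂ := ((cubeWeight p r i).toReal : ℂ)⁻¹ with hc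
  have hcnorm : ‖c‖ₑ = (cubeWeight p r i)⁻¹ := by
    rw [hc, enorm_inv (by simp [ENNReal.toReal_eq_zero_iff, cubeWeight_ne_zero, cubeWeight_ne_top]),
      enorm_ofReal_toReal (cubeWeight_ne_top p r i)]
  refine ⟨c • φ, ?_, ?_⟩
  · calc cubeENorm p q r i (c • φ)
        ≤ (cubeWeight p r i)⁻¹ * (cubeWeight p r i * 1) := by
          rw [← hcnorm]
          exact ((isExtSeminorm_cubeENorm hp hq r i).smul_le c φ).trans (by
            gcongr
            exact mul_le_mul_right hφnorm _)
      _ = 1 := by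
          rw [mul_one, ENNReal.inv_mul_cancel (cubeWeight_ne_zero p r i) (cubeWeight_ne_top p r i)]
  · have hsmul := (L ∘ₗ LinearMap.single ℂ (fun _ : Idx n => FunSeq n) i).map_smul c φ
    rw [← hg.apply_single_eq_sum hN hf.measurable (fun j => hf.bounded.imp fun _ hM => hM j) hφ,
      ← hcnorm, ← enorm_mul]
    exact congrArg _ hsmul

/-- The test families consist of Hölder extremals on finitely many cubes. -/
theorem IsDensity.tsum_mixedENorm_le (hp : p.HolderConjugate p') (hq : q.HolderConjugate q')
    (hL : IsBoundedBy C (fun F => ⨆ i, cubeENorm p q r i (F i)) L) (hg : IsDensity L g) :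
    ∑' i, (cubeWeight p r i)⁻¹ * mixedENorm p' q' (volume.restrict (dyadicCube i)) (g i) ≤ C := by
  rw [ENNReal.tsum_eq_iSup_sum]
  refine iSup_le fun S => ?_
  have hfin (i : Idx n) : IsFiniteMeasure (volume.restrict (dyadicCube i)) :=
    isFiniteMeasure_restrict.2 (volume_dyadicCube_ne_top i)
  choose f hf hlim using fun i : Idx n => exists_isAdmissible_tendsto_mixedENorm
    (ν := volume.restrict (dyadicCube i)) hp hq (hg.measurable i)
  have hlimS := tendsto_finsetSum S fun i _ =>
    ENNReal.Tendsto.const_mul (hlim i) (Or.inr (ENNReal.inv_ne_top.2 (cubeWeight_ne_zero p r i)))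
  refine le_of_tendsto' hlimS fun N => ?_
  choose v hv hLv using fun i => hg.exists_cubeENorm_le_one (r := r) hp.lt.le hq.lt (hf i N)
  simp only [← hLv]
  exact hL.sum_enorm_apply_single_le (isExtSeminorm_cubeENorm hp.lt.le hq.lt r) hv S

end Functional

/-! ### Vanishing of the contributions of very small, very large and distant cubes -/

theorem IsTestFun.exists_bounds {f : Sp n →ₘ[volume] ℂ} (hf : IsTestFun f) :
    ∃ M R : ℝ, ∀ᵐ x, ‖f x‖ ≤ M ∧ (R < ‖x‖ → f x = 0) := by
  obtain ⟨φ, hφ, hφc, hfφ⟩ := hf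
  obtain ⟨M, hM⟩ := hφc.exists_bound_of_continuous hφ.continuous
  obtain ⟨R, hR⟩ := hφc.isCompact.isBounded.exists_norm_le
  refine ⟨M, R, ?_⟩
  filter_upwards [hfφ] with x hx
  rw [hx]
  refine ⟨hM x, fun hRx => ?_⟩
  by_contra hne
  exact hRx.not_ge (hR x (subset_tsupport φ hne))

theorem IsTestSeq.exists_bounds (hq : 1 ≤ q) {f : FunSeq n} (hf : IsTestSeq f) :
    ∃ (B : ℝ≥0∞) (R : ℝ), B ≠ ⊤ ∧ ∀ᵐ x, lqNorm q f x ≤ B ∧ (R < ‖x‖ → lqNorm q f x = 0) := by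
  obtain ⟨hsmooth, N, hN⟩ := hf
  choose M R hMR using fun j => (hsmooth j).exists_bounds
  obtain ⟨R', hR'⟩ := ((Finset.range (N + 1)).image R).bddAbove
  refine ⟨∑ j ∈ Finset.range (N + 1), ENNReal.ofReal (M j), R',
    ENNReal.sum_ne_top.2 fun j _ => ENNReal.ofReal_ne_top, ?_⟩
  filter_upwards [lqNorm_le_sum hq hN, ae_all_iff.2 hMR] with x hsum hx
  refine ⟨hsum.trans (Finset.sum_le_sum fun j _ => ?_), fun hRx => ?_⟩
  · rw [← ofReal_norm]
    exact ENNReal.ofReal_le_ofReal (hx j).1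
  · refine le_antisymm (hsum.trans_eq (Finset.sum_eq_zero fun j hj => ?_)) zero_le
    rw [(hx j).2 ((hR' (Finset.mem_image_of_mem R hj)).trans_lt hRx), enorm_zero]

theorem cubeENorm_le_lebesgueSeqENorm (p q r : ℝ) (i : Idx n) (f : FunSeq n) :
    cubeENorm p q r i f ≤ cubeWeight p r i * lebesgueSeqENorm p q f :=
  mul_le_mul_right (eLpNorm_mono_measure _ Measure.restrict_le_self) _

theorem cubeENorm_le_of_ae_le (hp : 0 < p) {f : FunSeq n} {B : ℝ≥0∞}
    (hf : ∀ᵐ x, lqNorm q f x ≤ B) (i : Idx n) :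
    cubeENorm p q r i f ≤
      ENNReal.ofReal (2 ^ ((i.1 : ℝ) * r)) * (ENNReal.ofReal (2 ^ ((n : ℝ) / p)) * B) := by
  have hvol : volume (dyadicCube i) ^ (1 / p) =
      ENNReal.ofReal (2 ^ ((n : ℝ) * (1 - (i.1 : ℝ)) * (1 / p))) := by
    rw [volume_dyadicCube, ENNReal.ofReal_rpow_of_pos (by positivity), ← Real.rpow_mul two_pos.le]
  calc cubeENorm p q r i f
      ≤ cubeWeight p r i * eLpNorm (fun _ => B) (ENNReal.ofReal p)
          (volume.restrict (dyadicCube i)) :=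
        mul_le_mul_right (eLpNorm_mono_enorm_ae (ae_restrict_of_ae hf)) _
    _ = cubeWeight p r i * volume (dyadicCube i) ^ (1 / p) * B := by
        rw [eLpNorm_const' _ (by simpa using hp) ENNReal.ofReal_ne_top,
          Measure.restrict_apply_univ, ENNReal.toReal_ofReal hp.le, enorm_eq_self, mul_comm B,
          mul_assoc]
    _ = ENNReal.ofReal (2 ^ ((i.1 : ℝ) * r)) * (ENNReal.ofReal (2 ^ ((n : ℝ) / p)) * B) := by
        rw [hvol, cubeWeight, ← mul_assoc, ← ENNReal.ofReal_mul (by positivity),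
          ← ENNReal.ofReal_mul (by positivity), ← Real.rpow_add two_pos, ← Real.rpow_add two_pos]
        ring_nf

theorem cubeENorm_eq_zero {f : FunSeq n} {R : ℝ} (hf : ∀ᵐ x, R < ‖x‖ → lqNorm q f x = 0)
    {i : Idx n} (hi : Disjoint (dyadicCube i) (Metric.closedBall 0 R)) :
    cubeENorm p q r i f = 0 := by
  rw [cubeENorm, eLpNorm_congr_ae (g := fun _ => (0 : ℝ≥0∞)), eLpNorm_zero', mul_zero]
  filter_upwards [ae_restrict_of_ae hf, ae_restrict_mem (measurableSet_dyadicCube i)] with x hx hxi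
  refine hx (not_le.1 fun hxR => hi.notMem_of_mem_left hxi ?_)
  simpa using hxR

theorem abs_le_of_mem_dyadicCube {i : Idx n} {x : Sp n} (hx : x ∈ dyadicCube i) (k : Fin n) :
    |(i.2 k : ℝ)| ≤ 2 ^ i.1 * ‖x‖ + 1 := by
  have hxk := abs_le.1 (PiLp.norm_apply_le x k)
  have hpos : (0 : ℝ) < 2 ^ i.1 := by positivity
  obtain ⟨hlower, hupper⟩ := hx k
  rw [zpow_neg, inv_mul_le_iff₀ hpos] at hlower
  rw [zpow_neg, le_inv_mul_iff₀ hpos] at hupper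
  rw [abs_le]
  constructor <;> nlinarith

theorem finite_setOf_dyadicCube_inter_closedBall_nonempty (J₁ J₂ : ℤ) (R : ℝ) :
    {i : Idx n | J₁ ≤ i.1 ∧ i.1 ≤ J₂ ∧
      (dyadicCube i ∩ Metric.closedBall 0 R).Nonempty}.Finite := by
  obtain ⟨K, hK⟩ := exists_nat_ge ((2 : ℝ) ^ J₂ * R + 1)
  refine ((Set.finite_Icc J₁ J₂).prod
    (Set.finite_Icc (fun _ : Fin n => -(K : ℤ)) fun _ => (K : ℤ))).subset ?_
  rintro i ⟨hJ₁, hJ₂, x, hxi, hxR⟩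
  have hcoord (k : Fin n) : |i.2 k| ≤ (K : ℤ) := by
    have hbound : |(i.2 k : ℝ)| ≤ K := calc
      |(i.2 k : ℝ)| ≤ 2 ^ i.1 * ‖x‖ + 1 := abs_le_of_mem_dyadicCube hxi k
      _ ≤ 2 ^ J₂ * R + 1 := by
        gcongr
        · exact one_le_two
        · simpa using hxR
      _ ≤ K := hK
    exact_mod_cast hbound
  exact ⟨⟨hJ₁, hJ₂⟩, fun k => (abs_le.1 (hcoord k)).1, fun k => (abs_le.1 (hcoord k)).2⟩

theorem tendsto_ofReal_two_rpow_mul {ι : Type*} {l : Filter ι} {u : ι → ℝ}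
    (hu : Tendsto u l atBot) {c : ℝ≥0∞} (hc : c ≠ ⊤) :
    Tendsto (fun i => ENNReal.ofReal (2 ^ u i) * c) l (𝓝 0) := by
  have hpow := ENNReal.tendsto_ofReal
    ((tendsto_rpow_atBot_of_base_gt_one 2 one_lt_two).comp hu)
  simpa using ENNReal.Tendsto.mul_const hpow (Or.inr hc)

theorem IsTestSeq.tendsto_cubeENorm (hp : 1 ≤ p) (hq : 1 ≤ q) (hr : -(n : ℝ) / p < r)
    (hr0 : r < 0) {f : FunSeq n} (hf : IsTestSeq f) :
    Tendsto (fun i => cubeENorm p q r i f) cofinite (𝓝 0) := by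
  obtain ⟨B, R, hB, hBR⟩ := hf.exists_bounds hq
  have hexp : 0 < (n : ℝ) / p + r := by
    rw [neg_div] at hr
    linarith
  have hlarge : Tendsto (fun J : ℤ => ENNReal.ofReal (2 ^ ((J : ℝ) * ((n : ℝ) / p + r))) *
      lebesgueSeqENorm p q f) atBot (𝓝 0) :=
    tendsto_ofReal_two_rpow_mul ((tendsto_intCast_atBot_iff.2 tendsto_id).atBot_mul_const hexp)
      (hf.lebesgueSeqENorm_lt_top hp hq).ne
  have hsmall : Tendsto (fun J : ℤ => ENNReal.ofReal (2 ^ ((J : ℝ) * r)) *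
      (ENNReal.ofReal (2 ^ ((n : ℝ) / p)) * B)) atTop (𝓝 0) :=
    tendsto_ofReal_two_rpow_mul (tendsto_intCast_atTop_atTop.atTop_mul_const_of_neg hr0)
      (ENNReal.mul_ne_top ENNReal.ofReal_ne_top hB)
  refine ENNReal.tendsto_nhds_zero.2 fun ε hε => ?_
  obtain ⟨J₁, hJ₁⟩ := eventually_atBot.1 (hlarge.eventually (ge_mem_nhds hε))
  obtain ⟨J₂, hJ₂⟩ := eventually_atTop.1 (hsmall.eventually (ge_mem_nhds hε))
  refine (finite_setOf_dyadicCube_inter_closedBall_nonempty J₁ J₂ R).subset fun i hi => ?_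
  have hi : ¬ cubeENorm p q r i f ≤ ε := hi
  refine ⟨not_lt.1 fun hlt => hi ?_, not_lt.1 fun hlt => hi ?_, ?_⟩
  · exact (cubeENorm_le_lebesgueSeqENorm p q r i f).trans (hJ₁ i.1 hlt.le)
  · exact (cubeENorm_le_of_ae_le (by linarith) (hBR.mono fun x hx => hx.1) i).trans
      (hJ₂ i.1 hlt.le)
  · refine Set.not_disjoint_iff_nonempty_inter.1 fun hdisj => hi ?_
    rw [cubeENorm_eq_zero (hBR.mono fun x hx => hx.2) hdisj]
    exact zero_le

/-! ### Synthesis of elements of the predual -/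

theorem exists_isAtomic (hp : p.HolderConjugate p') (hrρ : r + ρ = -(n : ℝ))
    {b : Idx n → Sp n → ℂ} (hb : ∀ i, MemLp (b i) (ENNReal.ofReal p') volume)
    (hsupp : ∀ i, ∀ᵐ x, x ∉ dyadicCube i → b i x = 0)
    (hsum : ∑' i, (cubeWeight p r i)⁻¹ * eLpNorm (b i) (ENNReal.ofReal p') volume ≠ ⊤) :
    ∃ (lam : Idx n → ℂ) (a : Idx n → Sp n → ℂ), IsAtomic p' ρ lam a ∧
      (∀ i, b i =ᵐ[volume] fun x => lam i * a i x) ∧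
      ∀ i, ‖lam i‖ₑ = (cubeWeight p r i)⁻¹ * eLpNorm (b i) (ENNReal.ofReal p') volume := by
  set ν : Idx n → ℝ≥0∞ :=
    fun i => (cubeWeight p r i)⁻¹ * eLpNorm (b i) (ENNReal.ofReal p') volume with hν
  have hνtop (i : Idx n) : ν i ≠ ⊤ := ENNReal.ne_top_of_tsum_ne_top hsum i
  let lam : Idx n → ℂ := fun i => ((ν i).toReal : ℂ)
  have hlam (i : Idx n) : ‖lam i‖ₑ = ν i := enorm_ofReal_toReal (hνtop i)
  have hnorm (i : Idx n) :
      eLpNorm (b i) (ENNReal.ofReal p') volume = cubeWeight p r i * ‖lam i‖ₑ := by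
    rw [hlam, hν, ← mul_assoc, ENNReal.mul_inv_cancel (cubeWeight_ne_zero p r i)
      (cubeWeight_ne_top p r i), one_mul]
  refine ⟨lam, fun i => (lam i)⁻¹ • b i, ⟨fun i => (hb i).const_smul _, fun i => ?_, fun i => ?_,
    tsum_enorm_ne_top_iff_summable_norm.1 (by simpa only [hlam] using hsum)⟩, fun i => ?_, hlam⟩
  · filter_upwards [hsupp i] with x hx hxi
    rw [Pi.smul_apply, hx hxi, smul_zero]
  · rw [ofReal_two_rpow_eq_cubeWeight hp hrρ, eLpNorm_const_smul, hnorm, mul_left_comm,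
      ← enorm_mul]
    refine mul_le_of_le_one_right' ?_
    rcases eq_or_ne (lam i) 0 with h0 | h0 <;> simp [h0]
  · rcases eq_or_ne (lam i) 0 with h0 | h0
    · have hb0 := hnorm i
      rw [h0, enorm_zero, mul_zero, eLpNorm_eq_zero_iff (hb i).1
        (by simpa using hp.symm.pos)] at hb0
      filter_upwards [hb0] with x hx
      rw [hx, h0, zero_mul, Pi.zero_apply]
    · refine Eventually.of_forall fun x => ?_
      simp only [Pi.smul_apply, smul_eq_mul, mul_inv_cancel_left₀ h0]

theorem summable_and_predualFunENorm_tsum_le (hp : p.HolderConjugate p')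
    (h : PredualIndex n p' ρ) (hrρ : r + ρ = -(n : ℝ)) {b : Idx n → Sp n → ℂ}
    (hb : ∀ i, MemLp (b i) (ENNReal.ofReal p') volume)
    (hsupp : ∀ i, ∀ᵐ x, x ∉ dyadicCube i → b i x = 0)
    (hsum : ∑' i, (cubeWeight p r i)⁻¹ * eLpNorm (b i) (ENNReal.ofReal p') volume ≠ ⊤) :
    (∀ᵐ x, Summable fun i => b i x) ∧ predualFunENorm p' ρ (fun x => ∑' i, b i x) ≤
      ∑' i, (cubeWeight p r i)⁻¹ * eLpNorm (b i) (ENNReal.ofReal p') volume := by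
  obtain ⟨lam, a, ha, hba, hlam⟩ := exists_isAtomic hp hrρ hb hsupp hsum
  have hba := ae_all_iff.2 hba
  constructor
  · filter_upwards [(ha.exists_decomp h).1, hba] with x hx hbx
    exact hx.congr fun i => (hbx i).symm
  · simp only [← hlam]
    exact (ha.memPredual h (hba.mono fun x hx => tsum_congr hx)).2

theorem tsum_lt_top_and_predualFunENorm_toReal_tsum_le (hp : p.HolderConjugate p')
    (h : PredualIndex n p' ρ) (hrρ : r + ρ = -(n : ℝ)) {k : Idx n → Sp n → ℝ≥0∞}
    (hk : ∀ i, Measurable (k i)) (hsupp : ∀ i, ∀ x ∉ dyadicCube i, k i x = 0)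
    (hsum : ∑' i, (cubeWeight p r i)⁻¹ * eLpNorm (k i) (ENNReal.ofReal p') volume ≠ ⊤) :
    (∀ᵐ x, ∑' i, k i x < ⊤) ∧ predualFunENorm p' ρ (fun x => ((∑' i, k i x).toReal : ℂ)) ≤
      ∑' i, (cubeWeight p r i)⁻¹ * eLpNorm (k i) (ENNReal.ofReal p') volume := by
  have hktop (i : Idx n) : eLpNorm (k i) (ENNReal.ofReal p') volume ≠ ⊤ := fun htop =>
    ENNReal.ne_top_of_tsum_ne_top hsum i (by
      rw [htop, ENNReal.mul_top (ENNReal.inv_ne_zero.2 (cubeWeight_ne_top p r i))])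
  have hkfin : ∀ᵐ x, ∀ i, k i x < ⊤ :=
    ae_all_iff.2 fun i => ae_lt_top_of_eLpNorm_ne_top hp.symm.pos (hk i) (hktop i)
  let b : Idx n → Sp n → ℂ := fun i x => ((k i x).toReal : ℂ)
  have hnorm (i : Idx n) :
      eLpNorm (b i) (ENNReal.ofReal p') volume = eLpNorm (k i) (ENNReal.ofReal p') volume := by
    refine eLpNorm_congr_enorm_ae (hkfin.mono fun x hx => ?_)
    rw [enorm_ofReal_toReal (hx i).ne, enorm_eq_self]
  have hmem (i : Idx n) : MemLp (b i) (ENNReal.ofReal p') volume :=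
    ⟨(Complex.measurable_ofReal.comp (hk i).ennreal_toReal).aestronglyMeasurable,
      (hnorm i).trans_lt (hktop i).lt_top⟩
  obtain ⟨hsummable, hle⟩ := summable_and_predualFunENorm_tsum_le hp h hrρ hmem
    (fun i => Eventually.of_forall fun x hx => by simp [b, hsupp i x hx])
    (by simpa only [hnorm] using hsum)
  refine ⟨?_, ?_⟩
  · filter_upwards [hsummable, hkfin] with x hx hkx
    rw [← tsum_congr fun i => enorm_ofReal_toReal (hkx i).ne]
    exact (tsum_enorm_ne_top_iff_summable_norm.2 hx.norm).lt_top
  · simp only [hnorm] at hle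
    refine (predualFunENorm_mono h ?_ (hkfin.mono fun x hx => ?_)).trans hle
    · exact (Complex.measurable_ofReal.comp
        (Measurable.tsum hk).ennreal_toReal).aestronglyMeasurable
    · rw [ENNReal.tsum_toReal_eq fun i => (hx i).ne, Complex.ofReal_tsum]

theorem predualSeqENorm_le_of_lqNorm_le (h : PredualIndex n p ρ) {γ : FunSeq n} {K : Sp n → ℝ≥0∞}
    (hK : ∀ᵐ x, K x < ⊤) (hγ : ∀ᵐ x, lqNorm q γ x ≤ K x) :
    predualSeqENorm p q ρ γ ≤ predualFunENorm p ρ (fun x => ((K x).toReal : ℂ)) := by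
  refine predualFunENorm_mono h (measurable_lqFun q γ).aestronglyMeasurable ?_
  filter_upwards [hγ, hK] with x hx hKx
  rw [norm_lqFun, Complex.norm_real, Real.norm_of_nonneg ENNReal.toReal_nonneg]
  exact ENNReal.toReal_mono hKx.ne hx

theorem exists_predualSeq (hp : p.HolderConjugate p') (hq : 1 < q') (h : PredualIndex n p' ρ)
    (hrρ : r + ρ = -(n : ℝ)) {g : Idx n → ℕ → Sp n → ℂ} (hg : ∀ i j, Measurable (g i j))
    (hsum : ∑' i, (cubeWeight p r i)⁻¹ *
      mixedENorm p' q' (volume.restrict (dyadicCube i)) (g i) ≠ ⊤) :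
    ∃ γ : PredualSeq n p' q' ρ h hq,
      predualSeqENorm p' q' ρ γ.1 ≤ ∑' i, (cubeWeight p r i)⁻¹ *
        mixedENorm p' q' (volume.restrict (dyadicCube i)) (g i) ∧
      ∀ j, ∀ᵐ x, γ.1 j x = ∑' i, (dyadicCube i).indicator (g i j) x := by
  have hq0 : 0 < q' := by linarith
  let G : Idx n → ℕ → Sp n → ℂ := fun i j => (dyadicCube i).indicator (g i j)
  have hG (i : Idx n) (j : ℕ) : Measurable (G i j) :=
    (hg i j).indicator (measurableSet_dyadicCube i)
  let k : Idx n → Sp n → ℝ≥0∞ := fun i x => (∑' j, ‖G i j x‖ₑ ^ q') ^ (1 / q')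
  have hk (i : Idx n) : k i =
      (dyadicCube i).indicator fun x => (∑' j, ‖g i j x‖ₑ ^ q') ^ (1 / q') := by
    funext x
    by_cases hx : x ∈ dyadicCube i <;> simp [k, G, hx, hq0]
  have hkm (i : Idx n) : Measurable (k i) :=
    (Measurable.tsum fun j => (hG i j).enorm.pow_const q').pow_const _
  have hknorm (i : Idx n) : eLpNorm (k i) (ENNReal.ofReal p') volume =
      mixedENorm p' q' (volume.restrict (dyadicCube i)) (g i) := by
    rw [hk, eLpNorm_indicator_eq_eLpNorm_restrict (measurableSet_dyadicCube i), mixedENorm]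
  obtain ⟨hfin, hle⟩ := tsum_lt_top_and_predualFunENorm_toReal_tsum_le hp h hrρ hkm
    (fun i x hx => by rw [hk, Set.indicator_of_notMem hx]) (by simpa only [hknorm] using hsum)
  simp only [hknorm] at hle
  let γ : FunSeq n := fun j =>
    AEEqFun.mk (fun x => ∑' i, G i j x) (Measurable.tsum (hG · j)).aestronglyMeasurable
  have hγ (j : ℕ) : ∀ᵐ x, γ j x = ∑' i, G i j x := AEEqFun.coeFn_mk _ _
  have hγk : ∀ᵐ x, lqNorm q' γ x ≤ ∑' i, k i x := by
    filter_upwards [ae_all_iff.2 hγ] with x hx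
    refine le_trans ?_ (Lp_tsum_le_tsum_Lp hq.le fun i j => ‖G i j x‖ₑ)
    rw [lqNorm]
    gcongr with j
    exact (congrArg _ (hx j)).trans_le enorm_tsum_le_tsum_enorm
  have hγfin : ∀ᵐ x, lqNorm q' γ x < ⊤ := by
    filter_upwards [hγk, hfin] with x hx hkx
    exact hx.trans_lt hkx
  have hγle := (predualSeqENorm_le_of_lqNorm_le h hfin hγk).trans hle
  have hγlt := hγle.trans_lt hsum.lt_top
  exact ⟨⟨γ, memPredual_component h hq hγfin hγlt, hγfin, (memPredual_iff h).2 hγlt⟩, hγle, hγ⟩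

theorem tsum_setLIntegral_enorm_mul_le (hp : p.HolderConjugate p') (hq : q.HolderConjugate q')
    (r : ℝ) {g : Idx n → ℕ → Sp n → ℂ} (hg : ∀ i j, Measurable (g i j)) (f : FunSeq n) :
    ∑' i, ∫⁻ x in dyadicCube i, ∑' j, ‖g i j x * f j x‖ₑ ≤
      (∑' i, (cubeWeight p r i)⁻¹ * mixedENorm p' q' (volume.restrict (dyadicCube i)) (g i)) *
        morreySeqENorm p q r f := by
  rw [← ENNReal.tsum_mul_right]
  gcongr with i
  set ν := volume.restrict (dyadicCube i)
  calc ∫⁻ x, ∑' j, ‖g i j x * f j x‖ₑ ∂ν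
      ≤ ∫⁻ x, ‖(∑' j, ‖g i j x‖ₑ ^ q') ^ (1 / q')‖ₑ * lqNorm q f x ∂ν := by
        simp only [enorm_mul, enorm_eq_self]
        exact lintegral_mono fun x => tsum_mul_le_Lp_mul_Lq hq.symm _ _
    _ ≤ mixedENorm p' q' ν (g i) * eLpNorm (lqNorm q f) (ENNReal.ofReal p) ν :=
        lintegral_enorm_mul_le_eLpNorm_mul_eLpNorm hp.symm
          ((Measurable.tsum fun j => (hg i j).enorm.pow_const q').pow_const _).aestronglyMeasurable
          (measurable_lqNorm q f).aemeasurable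
    _ = (cubeWeight p r i)⁻¹ * mixedENorm p' q' ν (g i) *
          (cubeWeight p r i * eLpNorm (lqNorm q f) (ENNReal.ofReal p) ν) := by
        rw [mul_mul_mul_comm, ENNReal.inv_mul_cancel (cubeWeight_ne_zero p r i)
          (cubeWeight_ne_top p r i), one_mul]
    _ ≤ (cubeWeight p r i)⁻¹ * mixedENorm p' q' ν (g i) * morreySeqENorm p q r f := by
        gcongr
        exact cubeWeight_mul_eLpNorm_le_morreyENorm p r (lqNorm q f) i

/-! ### Representation of functionals -/

theorem hasSum_integral_of_tsum_lintegral_enorm_ne_top {α ι : Type*} {m : MeasurableSpace α}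
    {μ : Measure α} [Countable ι] {F : ι → α → ℂ} (hF : ∀ i, AEStronglyMeasurable (F i) μ)
    (hfin : ∑' i, ∫⁻ x, ‖F i x‖ₑ ∂μ ≠ ⊤) :
    HasSum (fun i => ∫ x, F i x ∂μ) (∫ x, ∑' i, F i x ∂μ) := by
  have hnorm (i : ι) : ∫ x, ‖F i x‖ ∂μ = (∫⁻ x, ‖F i x‖ₑ ∂μ).toReal :=
    integral_norm_eq_lintegral_enorm (hF i)
  refine hasSum_integral_of_summable_integral_norm
    (fun i => ⟨hF i, (ENNReal.ne_top_of_tsum_ne_top hfin i).lt_top⟩) ?_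
  simp only [hnorm]
  exact ENNReal.summable_toReal hfin

theorem hasSum_setIntegral_tsum_mul {g : Idx n → ℕ → Sp n → ℂ} (hg : ∀ i j, Measurable (g i j))
    {γ f : FunSeq n} (hγ : ∀ j, ∀ᵐ x, γ j x = ∑' i, (dyadicCube i).indicator (g i j) x)
    (hfin : ∑' i, ∫⁻ x in dyadicCube i, ∑' j, ‖g i j x * f j x‖ₑ ≠ ⊤) :
    HasSum (fun i => ∫ x in dyadicCube i, ∑' j, g i j x * f j x) (pairing γ f) := by
  let F : Idx n → ℕ → Sp n → ℂ := fun i j x => (dyadicCube i).indicator (g i j) x * f j x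
  have hF (i : Idx n) (j : ℕ) : Measurable (F i j) :=
    ((hg i j).indicator (measurableSet_dyadicCube i)).mul (f j).stronglyMeasurable.measurable
  have hlintegral (i : Idx n) : ∫⁻ x in dyadicCube i, ∑' j, ‖g i j x * f j x‖ₑ =
      ∫⁻ x, ∑' j, ‖F i j x‖ₑ := by
    rw [← lintegral_indicator (measurableSet_dyadicCube i)]
    congr 1 with x
    by_cases hx : x ∈ dyadicCube i <;> simp [F, hx]
  have hintegral (i : Idx n) : ∫ x in dyadicCube i, ∑' j, g i j x * f j x =
      ∫ x, ∑' j, F i j x := by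
    rw [← integral_indicator (measurableSet_dyadicCube i)]
    congr 1 with x
    by_cases hx : x ∈ dyadicCube i <;> simp [F, hx]
  have hle (i : Idx n) : ∫⁻ x, ‖∑' j, F i j x‖ₑ ≤ ∫⁻ x, ∑' j, ‖F i j x‖ₑ :=
    lintegral_mono fun _ => enorm_tsum_le_tsum_enorm
  simp only [hlintegral] at hfin
  have hsum := hasSum_integral_of_tsum_lintegral_enorm_ne_top
    (fun i => (Measurable.tsum (hF i)).aestronglyMeasurable)
    (ne_top_of_le_ne_top hfin (ENNReal.tsum_le_tsum hle))
  simp only [hintegral]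
  convert hsum using 1
  refine integral_congr_ae ?_
  rw [← lintegral_tsum fun i => (Measurable.tsum fun j => (hF i j).enorm).aemeasurable] at hfin
  filter_upwards [ae_all_iff.2 hγ, ae_lt_top (Measurable.tsum fun i =>
    Measurable.tsum fun j => (hF i j).enorm) hfin] with x hx hFx
  have hsummable : Summable (Function.uncurry fun i j => F i j x) := by
    refine (tsum_enorm_ne_top_iff_summable_norm.1 ?_).of_norm
    rw [ENNReal.tsum_prod']
    exact hFx.ne
  rw [← hsummable.tsum_comm]
  simp only [hx, F, tsum_mul_right]

theorem IsDensity.apply_single_eq_setIntegral {L : (Idx n → FunSeq n) →ₗ[ℂ] ℂ}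
    {g : Idx n → ℕ → Sp n → ℂ} (hg : IsDensity L g) {f : FunSeq n} (hf : IsTestSeq f)
    (i : Idx n) : L (Pi.single i f) = ∫ x in dyadicCube i, ∑' j, g i j x * f j x := by
  obtain ⟨hsmooth, N, hN⟩ := hf
  choose φ hφ hφc hfφ using hsmooth
  choose M hM using fun j => (hφc j).exists_bound_of_continuous (hφ j).continuous
  have hint (j : ℕ) : IntegrableOn (fun x => g i j x * φ j x) (dyadicCube i) :=
    (hg.integrableOn i j).mul_bdd (c := M j) (hφ j).continuous.aestronglyMeasurable
      (Eventually.of_forall (hM j))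
  rw [hg.apply_single_eq_sum (N := N + 1) hN (fun j => (hφ j).continuous.measurable)
    (fun j => ⟨M j, hM j⟩) hfφ, ← integral_finsetSum _ fun j _ => hint j]
  refine integral_congr_ae (ae_restrict_of_ae ?_)
  filter_upwards [ae_all_iff.2 hfφ, coeFn_zero_ae n] with x hx h0
  rw [tsum_eq_sum (s := Finset.range (N + 1))]
  · simp only [hx]
  · intro j hj
    rw [hN j (by simpa [Nat.lt_succ_iff] using hj), h0, mul_zero]

theorem PredualIndex.neg_div_lt (h : PredualIndex n p' ρ)
    (hp : p.HolderConjugate p') (hrρ : r + ρ = -(n : ℝ)) : -(n : ℝ) / p < r := by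
  have hupper := h.upper
  rw [neg_div] at hupper ⊢
  linarith [div_add_eq_neg_of_holderConjugate hp hrρ]

theorem PredualIndex.neg_of_add_eq (h : PredualIndex n p' ρ) (hrρ : r + ρ = -(n : ℝ)) : r < 0 := by
  linarith [h.lower]

theorem IsBoundedBy.exists_predualSeq (hp : p.HolderConjugate p') (hq : q.HolderConjugate q')
    (h : PredualIndex n p' ρ) (hrρ : r + ρ = -(n : ℝ)) {L : (Idx n → FunSeq n) →ₗ[ℂ] ℂ} {C : ℝ≥0}
    (hL : IsBoundedBy C (fun F => ⨆ i, cubeENorm p q r i (F i)) L) :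
    ∃ γ : PredualSeq n p' q' ρ h hq.symm.lt, predualSeqENorm p' q' ρ γ.1 ≤ C ∧
      ∀ f, IsTestSeq f → morreySeqENorm p q r f < ⊤ → L (fun _ => f) = pairing γ.1 f := by
  obtain ⟨g, hg⟩ := hL.exists_isDensity hp.lt.le hq.lt
  have hC := hg.tsum_mixedENorm_le hp hq hL
  have hfin := ne_top_of_le_ne_top ENNReal.coe_ne_top hC
  obtain ⟨γ, hγC, hγ⟩ := MorreyDuality.exists_predualSeq hp hq.symm.lt h hrρ hg.measurable hfin
  refine ⟨γ, hγC.trans hC, fun f hf hfr => ?_⟩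
  have hsum : HasSum (fun i => L (Pi.single i f)) (L fun _ => f) :=
    hL.hasSum_apply_single (isExtSeminorm_cubeENorm hp.lt.le hq.lt r) hfr
      (hf.tendsto_cubeENorm hp.lt.le hq.lt.le (h.neg_div_lt hp hrρ) (h.neg_of_add_eq hrρ))
  simp only [hg.apply_single_eq_setIntegral hf] at hsum
  exact hsum.unique (hasSum_setIntegral_tsum_mul hg.measurable hγ (ne_top_of_le_ne_top
    (ENNReal.mul_ne_top hfin hfr.ne) (tsum_setLIntegral_enorm_mul_le hp hq r hg.measurable f)))

theorem exists_pairingFunctional_eq (hp : p.HolderConjugate p') (hq : q.HolderConjugate q')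
    (h : PredualIndex n p' ρ) (hrρ : r + ρ = -(n : ℝ))
    (G : StrongDual ℂ (MorreySeqCirc n p q r hp.lt hq.lt)) :
    ∃ γ : PredualSeq n p' q' ρ h hq.symm.lt, ‖γ‖ ≤ ‖G‖ ∧ pairingFunctional hp hq h hrρ γ = G := by
  let e : MorreySeqCirc n p q r hp.lt hq.lt →ₗ[ℂ] (Idx n → FunSeq n) :=
    { toFun := fun f _ => f.1.1
      map_add' := fun _ _ => rfl
      map_smul' := fun _ _ => rfl }
  have he (f : MorreySeqCirc n p q r hp.lt hq.lt) : ⨆ i, cubeENorm p q r i (e f i) = ‖f‖ₑ := by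
    rw [← ofReal_norm]
    exact (iSup_cubeENorm p q r f.1.1).trans (ENNReal.ofReal_toReal f.1.2.2.ne).symm
  obtain ⟨L, hLe, hL⟩ := (IsExtSeminorm.iSup (isExtSeminorm_cubeENorm (n := n) hp.lt.le hq.lt
    r)).exists_isBoundedBy_extension e he G
  obtain ⟨γ, hγ, hLγ⟩ := hL.exists_predualSeq hp hq h hrρ
  refine ⟨γ, ENNReal.toReal_le_coe_of_le_coe hγ, MorreySeqCirc.ext_isTestSeq hp.lt hq.lt
    (h.neg_div_lt hp hrρ) (h.neg_of_add_eq hrρ) fun f hf => ?_⟩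
  rw [pairingFunctional_apply, ← hLe]
  exact (hLγ f.1.1 hf f.1.2.2).symm

theorem isTestSeq_single (j : ℕ) {u : Sp n →ₘ[volume] ℂ} (hu : IsTestFun u) :
    IsTestSeq (Pi.single j u : FunSeq n) := by
  refine ⟨fun k => ?_, j, fun k hk => Pi.single_eq_of_ne hk.ne' _⟩
  rcases eq_or_ne k j with rfl | hk
  · rwa [Pi.single_eq_same]
  · rw [Pi.single_eq_of_ne hk]
    exact IsTestFun.zero

theorem pairing_single (g : FunSeq n) (j : ℕ) (u : Sp n →ₘ[volume] ℂ) :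
    pairing g (Pi.single j u) = ∫ x, g j x * u x := by
  refine integral_congr_ae ?_
  filter_upwards [coeFn_zero_ae n] with x h0
  rw [tsum_eq_single j fun k hk => by rw [Pi.single_eq_of_ne hk, h0, mul_zero],
    Pi.single_eq_same]

theorem pairingFunctional_injective (hp : p.HolderConjugate p') (hq : q.HolderConjugate q')
    (h : PredualIndex n p' ρ) (hrρ : r + ρ = -(n : ℝ)) :
    Function.Injective (pairingFunctional (r := r) hp hq h hrρ) := by
  have hr := h.neg_div_lt hp hrρ
  have hr0 := h.neg_of_add_eq hrρ
  refine (injective_iff_map_eq_zero (pairingFunctional (r := r) hp hq h hrρ)).2 fun γ hγ => ?_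
  refine Subtype.ext (funext fun j => AEEqFun.ext (EventuallyEq.trans ?_ AEEqFun.coeFn_zero.symm))
  obtain ⟨T, -, hT⟩ := γ.2.1 j
  refine ae_eq_zero_of_integral_contDiff_smul_eq_zero hT.1 fun φ hφ hφc => ?_
  have hψ : ContDiff ℝ ∞ (Complex.ofRealCLM ∘ φ) := by fun_prop
  let u : Sp n →ₘ[volume] ℂ := AEEqFun.mk _ hψ.continuous.aestronglyMeasurable
  have hu : u =ᵐ[volume] Complex.ofRealCLM ∘ φ := AEEqFun.coeFn_mk _ _
  have htest := isTestSeq_single j ⟨_, hψ, hφc.comp_left rfl, hu⟩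
  obtain ⟨hmem, hcirc⟩ := exists_mem_morreySeqCirc hp.lt hq.lt hr hr0
    (htest.lebesgueSeqENorm_lt_top (hp.lt.le.trans (le_neg_div hp.pos hr hr0)) hq.lt.le)
  have hpair : pairing γ.1 (Pi.single j u) = 0 :=
    DFunLike.congr_fun hγ (⟨⟨_, hmem⟩, hcirc⟩ : MorreySeqCirc n p q r hp.lt hq.lt)
  rw [pairing_single] at hpair
  refine Eq.trans (integral_congr_ae ?_) hpair
  filter_upwards [hu] with x hx
  rw [hx, Function.comp_apply, Complex.ofRealCLM_apply, Complex.real_smul, mul_comm]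

/-- The pairing as a linear isometric isomorphism of the predual sequence space onto the dual of the
closure of the test sequences. -/
noncomputable def pairingEquiv (hp : p.HolderConjugate p') (hq : q.HolderConjugate q')
    (h : PredualIndex n p' ρ) (hrρ : r + ρ = -(n : ℝ)) :
    PredualSeq n p' q' ρ h hq.symm.lt ≃ₗᵢ[ℂ] StrongDual ℂ (MorreySeqCirc n p q r hp.lt hq.lt) :=
  LinearIsometryEquiv.ofSurjective
    { pairingFunctional (r := r) hp hq h hrρ with
      norm_map' := fun g => by
        refine le_antisymm (norm_pairingFunctional_le hp hq h hrρ g) ?_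
        obtain ⟨γ, hγ, heq⟩ :=
          exists_pairingFunctional_eq hp hq h hrρ (pairingFunctional hp hq h hrρ g)
        rwa [pairingFunctional_injective hp hq h hrρ heq] at hγ }
    fun G => (exists_pairingFunctional_eq hp hq h hrρ G).imp fun _ hγ => hγ.2

theorem pairingEquiv_apply (hp : p.HolderConjugate p') (hq : q.HolderConjugate q')
    (h : PredualIndex n p' ρ) (hrρ : r + ρ = -(n : ℝ)) (g : PredualSeq n p' q' ρ h hq.symm.lt)
    (f : MorreySeqCirc n p q r hp.lt hq.lt) :
    pairingEquiv hp hq h hrρ g f = pairing g.1 f.1.1 := rfl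

theorem pairingEquiv_eq_of_forall (hp : p.HolderConjugate p') (hq : q.HolderConjugate q')
    (h : PredualIndex n p' ρ) (hrρ : r + ρ = -(n : ℝ))
    {G : StrongDual ℂ (MorreySeqCirc n p q r hp.lt hq.lt)}
    {g : PredualSeq n p' q' ρ h hq.symm.lt}
    (hg : ∀ f : MorreySeqCirc n p q r hp.lt hq.lt,
      lebesgueSeqENorm (-(n : ℝ) / r) q f.1.1 < ⊤ → G f = pairing g.1 f.1.1) :
    pairingEquiv hp hq h hrρ g = G := by
  have hr := h.neg_div_lt hp hrρ
  have hr0 := h.neg_of_add_eq hrρ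
  have hu := hp.lt.le.trans (le_neg_div hp.pos hr hr0)
  exact MorreySeqCirc.ext_isTestSeq hp.lt hq.lt hr hr0 fun f hf =>
    (hg f (hf.lebesgueSeqENorm_lt_top hu hq.lt.le)).symm

theorem isLUB_norm_apply {E : Type*} [NormedAddCommGroup E] [NormedSpace ℂ E]
    (G : StrongDual ℂ E) : IsLUB {t : ℝ | ∃ x : E, ‖x‖ ≤ 1 ∧ t = ‖G x‖} ‖G‖ := by
  refine ⟨?_, fun c hc => ?_⟩
  · rintro t ⟨x, hx, rfl⟩
    exact G.unit_le_opNorm x hx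
  · have hc0 : 0 ≤ c := hc ⟨0, by simp, by simp⟩
    exact G.opNorm_le_of_unit_norm hc0 fun x hx => hc ⟨x, hx.le, rfl⟩

end MorreyDuality

theorem mainTheorem3 (n : ℕ) (p p' q q' r ρ : ℝ)
    (hp : p.HolderConjugate p') (hq : q.HolderConjugate q')
    (hr : -(n : ℝ) / p < r) (hr0 : r < 0) (hrρ : r + ρ = -(n : ℝ)) :
    -- the continuous embedding of `L_{-n/r}(ℓ_q)` into the closure of the test sequences
    (∃ C : ℝ≥0, ∀ f : FunSeq n, lebesgueSeqENorm (-(n : ℝ) / r) q f < ⊤ →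
      (∃ hf : f ∈ MorreySeq n p q r hp.lt hq.lt, ⟨f, hf⟩ ∈ MorreySeqCirc n p q r hp.lt hq.lt) ∧
      morreySeqENorm p q r f ≤ C * lebesgueSeqENorm (-(n : ℝ) / r) q f) ∧
    -- the dual space is `H^ρ L_{p'}(ℓ_{q'})`, isometrically, through the pairing
    ∃ Φ : PredualSeq n p' q' ρ (predualIndex_of_holderConjugate hp hr hr0 hrρ) hq.symm.lt
        ≃ₗᵢ[ℂ] StrongDual ℂ (MorreySeqCirc n p q r hp.lt hq.lt),
      (∀ g f, PairingConverges g.1 f.1.1 ∧ Φ g f = pairing g.1 f.1.1) ∧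
      -- unique representation, tested on `L_{-n/r}(ℓ_q)` only
      (∀ G : StrongDual ℂ (MorreySeqCirc n p q r hp.lt hq.lt),
        ∃! g : PredualSeq n p' q' ρ (predualIndex_of_holderConjugate hp hr hr0 hrρ) hq.symm.lt,
          ∀ f : MorreySeqCirc n p q r hp.lt hq.lt,
            lebesgueSeqENorm (-(n : ℝ) / r) q f.1.1 < ⊤ → G f = pairing g.1 f.1.1) ∧
      (∀ (G : StrongDual ℂ (MorreySeqCirc n p q r hp.lt hq.lt))
        (g : PredualSeq n p' q' ρ (predualIndex_of_holderConjugate hp hr hr0 hrρ) hq.symm.lt),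
        (∀ f : MorreySeqCirc n p q r hp.lt hq.lt,
        lebesgueSeqENorm (-(n : ℝ) / r) q f.1.1 < ⊤ → G f = pairing g.1 f.1.1) →
          Φ g = G ∧ ‖G‖ = ‖g‖) ∧
      -- the norm formula
      (∀ g : PredualSeq n p' q' ρ (predualIndex_of_holderConjugate hp hr hr0 hrρ) hq.symm.lt,
        IsLUB {t : ℝ | ∃ f : MorreySeqCirc n p q r hp.lt hq.lt,
        ‖f‖ ≤ 1 ∧ t = ‖pairing g.1 f.1.1‖} ‖g‖) := by
  have h := predualIndex_of_holderConjugate hp hr hr0 hrρ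
  refine ⟨⟨((2 : ℝ) ^ ((n : ℝ) / p + r)).toNNReal, fun f hf =>
    ⟨exists_mem_morreySeqCirc hp.lt hq.lt hr hr0 hf,
      morreySeqENorm_le_lebesgueSeqENorm hp.pos hr hr0 f⟩⟩,
    pairingEquiv hp hq h hrρ, fun g f => ⟨pairingConverges hp hq h hrρ g f.1, rfl⟩,
    fun G => ?_, fun G g hg => ?_, fun g => ?_⟩
  · refine ⟨(pairingEquiv hp hq h hrρ).symm G, fun f _ => ?_, fun g hg => ?_⟩
    · rw [← pairingEquiv_apply hp hq h hrρ, LinearIsometryEquiv.apply_symm_apply]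
    · rw [← pairingEquiv_eq_of_forall hp hq h hrρ hg, LinearIsometryEquiv.symm_apply_apply]
  · have hG := pairingEquiv_eq_of_forall hp hq h hrρ hg
    exact ⟨hG, by rw [← hG, LinearIsometryEquiv.norm_map]⟩
  · have hlub := isLUB_norm_apply (pairingEquiv hp hq h hrρ g)
    rw [LinearIsometryEquiv.norm_map] at hlub
    exact hlub
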